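/- Let $\mathbb H^1=\mathbb C\times\mathbb R\ni(z,t)$ be the Heisenberg group with the CR structure spanned by $Z_1=\partial_z+i\bar z\,\partial_t$, let $\theta_0=\tfrac12\bigl(dt+i(z\,d\bar z-\bar z\,dz)\bigr)$ and $\rho(z,t)=(|z|^4+t^2)^{1/4}$. Fix $r>0$, $r\neq1$, and let $\Gamma$ be the group generated by the dilation $(z,t)\mapsto(rz,r^2t)$. Then $M:=(\mathbb H^1\setminus\{0\})/\Gamma$ is homeomorphic to $S^1\times S^2$; equip it with the induced CR structure. For a contact form $\theta$ on $M$ (smooth, with kernel $\mathrm{Re}\,T^{1,0}M$ and positive definite Levi form), let $\nabla$, $R$, $A_{11}$ be its pseudohermitian connection, scalar curvature and torsion, with the conventions $d\theta=ih_{1\bar1}\theta^1\wedge\theta^{\bar1}$, $d\theta^1=\theta^1\wedge\omega_1{}^1+\theta\wedge h^{1\bar1}\overline{A_{11}}\,\theta^{\bar1}$, $h_{1\bar1}(\omega_1{}^1+\overline{\omega_1{}^1})=dh_{1\bar1}$, $d\omega_1{}^1=R\,h_{1\bar1}\theta^1\wedge\theta^{\bar1}\bmod\theta$. Let $\Delta_b=\nabla^1\nabla_1+\nabla^{\bar1}\nabla_{\bar1}$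 and $W_1=\nabla_1R-i\nabla^1A_{11}$; $\theta$ is pseudo-Einstein if $W_1=0$. Let $\mathcal P\subset C^\infty(M;\mathbb R)$ be the space of CR pluriharmonic functions (locally real parts of smooth functions $f$ with $Z_{\bar1}f=0$), and let $\tau$ be the orthogonal projection of $L^2(M,\theta\wedge d\theta)$ onto the closure of $\mathcal P$. For $f\in\mathcal P$ put $$P_4'f=4\Delta_b^2f-8\,\mathrm{Im}\,\nabla^1(A_{11}\nabla^1f)-4\,\mathrm{Re}\,\nabla^1(R\nabla_1f)+\tfrac83\mathrm{Re}\,W_1\nabla^1f-\tfrac43f\,\nabla^1W_1 ,$$ and for $\theta$ pseudo-Einstein put $Q_4'=-2\Delta_bR-4|A|^2+R^2$. Let $\overline P_4'=\tau P_4'$, $\overline Q_4'=\tau Q_4'$, and, for $w\in\mathcal P$, with all integrals taken with respect to $\theta\wedge d\theta$, $$II(w)=\int_Mw\,\overline P_4'w+2\int_M\overline Q_4'w-\Bigl(\int_M\overline Q_4'\Bigr)\log\frac{\int_Me^{2w}}{\int_M1}.$$ Then: (a) The form $\theta_1=\rho^{-2}\theta_0$ descends to a pseudo-Einstein contact form on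 $M$. It has $\overline Q_4'\equiv0$, but $Q_4'=8\,\dfrac{|z|^4-t^2}{|z|^4+t^2}\not\equiv0$. (b) For every pseudo-Einstein contact form $\theta$ on $M$, the $II$-functional of $\theta$ has a minimizer $w\in\mathcal P$, and any two minimizers differ by an additive constant. A function $w\colon M\to\mathbb R$ is a minimizer if and only if $e^w\theta$ is a positive constant multiple of $\rho^{-2}\theta_0$. For every minimizer $w$, the contact form $\hat\theta=e^w\theta$ is pseudo-Einstein and has $\widehat{\overline Q}{}_4'\equiv0$ but $\hat Q_4'\not\equiv0$. -/

import Mathlib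

open MeasureTheory Topology
open scoped ContDiff

noncomputable section

namespace HeisCR

/-! ### The Heisenberg group and its CR structure -/

/-- The Heisenberg group `ℍ¹`, with coordinates `(z, t)`, as a smooth manifold. -/
abbrev Heis : Type := ℂ × ℝ

/-- The real vector field `X = Z₁ + Z̄₁ = ∂ₓ + 2y ∂ₜ`, where `Z₁ = ∂_z + i z̄ ∂ₜ`. -/
def X (p : Heis) : Heis := (1, 2 * p.1.im)

/-- The real vector field `Y = J X = i (Z₁ - Z̄₁) = ∂_y - 2x ∂ₜ`. The CR structure `T^{1,0}` is
spanned by `Z₁ = (X - i Y) / 2`. -/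
def Y (p : Heis) : Heis := (Complex.I, -2 * p.1.re)

/-- The derivative `Z₁ f` of a complex-valued function. -/
def Z (f : Heis → ℂ) (p : Heis) : ℂ :=
  (fderiv ℝ f p (X p) - Complex.I * fderiv ℝ f p (Y p)) / 2

/-- The derivative `Z̄₁ f` of a complex-valued function. -/
def Zbar (f : Heis → ℂ) (p : Heis) : ℂ :=
  (fderiv ℝ f p (X p) + Complex.I * fderiv ℝ f p (Y p)) / 2

/-- The pseudo-distance `ρ(z,t) = (|z|⁴ + t²)^{1/4}`. -/
def rho (p : Heis) : ℝ := (‖p.1‖ ^ 4 + p.2 ^ 2) ^ (1 / 4 : ℝ)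

/-- The flat contact form `θ₀ = (dt + i (z dz̄ - z̄ dz)) / 2 = dt / 2 + x dy - y dx`, normalized so
that `dθ₀ = i dz ∧ dz̄`. -/
def theta0 (p : Heis) : Heis →L[ℝ] ℝ :=
  (1 / 2 : ℝ) • ContinuousLinearMap.snd ℝ ℂ ℝ
    + p.1.re • Complex.imCLM.comp (ContinuousLinearMap.fst ℝ ℂ ℝ)
    - p.1.im • Complex.reCLM.comp (ContinuousLinearMap.fst ℝ ℂ ℝ)

/-- The contact form `ρ⁻² θ₀` on `ℍ¹ \ {0}`. -/
def theta1 (p : Heis) : Heis →L[ℝ] ℝ := (rho p ^ 2)⁻¹ • theta0 p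

/-- The exterior derivative `dα(V, W)` of a one-form `α`, at `p`. -/
def dform {F : Type*} [NormedAddCommGroup F] [NormedSpace ℝ F]
    (α : Heis → Heis →L[ℝ] F) (p V W : Heis) : F :=
  fderiv ℝ α p V W - fderiv ℝ α p W V

/-! ### The quotient of `ℍ¹ \ {0}` by a dilation -/

/-- The Heisenberg dilation `δ_r(z,t) = (r z, r² t)`. It is a linear map of the coordinate space,
hence it equals its own differential. -/
def dil (r : ℝ) (p : Heis) : Heis := (r • p.1, r ^ 2 * p.2)

/-- `ℍ¹ \ {0}`. -/
abbrev Punctured : Type := {p : Heis // p ≠ 0}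

/-- The quotient `(ℍ¹ \ {0}) / Γ`, where `Γ` is generated by the dilation `δ_r`: the quotient by the
equivalence relation generated by `p ∼ δ_r p`. It carries the quotient topology and the quotient
(Borel) `σ`-algebra. -/
abbrev M (r : ℝ) : Type := Quot (fun p q : Punctured => q.1 = dil r p.1)

/-- The pullback to `ℍ¹ \ {0}` of a function on the quotient (extended by `0` to the origin). -/
def lift {r : ℝ} (w : M r → ℝ) (p : Heis) : ℝ :=
  open Classical in if h : p ≠ 0 then w (Quot.mk _ ⟨p, h⟩) else 0

/-- The function on the quotient induced by a `Γ`-invariant function on `ℍ¹ \ {0}`. -/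
def descend {r : ℝ} (f : Heis → ℝ) (m : M r) : ℝ := f m.out.1

/-- A function on the quotient is smooth if its pullback to `ℍ¹ \ {0}` is. -/
def IsSmooth {r : ℝ} (w : M r → ℝ) : Prop := ContDiffOn ℝ ∞ (lift w) {0}ᶜ

/-- The space `𝒫` of CR pluriharmonic functions on the quotient: smooth real functions that are
locally the real part of a smooth function annihilated by `Z̄₁`. -/
def pluriharmonic (r : ℝ) : Set (M r → ℝ) :=
  {w | IsSmooth w ∧ ∀ p : Heis, p ≠ 0 → ∃ (U : Set Heis) (f : Heis → ℂ), IsOpen U ∧ p ∈ U ∧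
    ContDiffOn ℝ ∞ f U ∧ ∀ q ∈ U, q ≠ 0 → Zbar f q = 0 ∧ lift w q = (f q).re}

/-! ### Pseudohermitian geometry of a contact form `θ`

The frame is `Z₁`, `Z̄₁`, `T`, with `T` the Reeb field of `θ`. -/

/-- `T` is the value at `p` of the Reeb field of `θ`. -/
def IsReebAt (θ : Heis → Heis →L[ℝ] ℝ) (p T : Heis) : Prop :=
  θ p T = 1 ∧ ∀ V, dform θ p T V = 0

/-- The Reeb field `T` of `θ`. -/
def reeb (θ : Heis → Heis →L[ℝ] ℝ) (p : Heis) : Heis := Classical.epsilon (IsReebAt θ p)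

/-- The admissible coframe `θ¹` dual to `Z₁`, that is `θ¹(Z₁) = 1`, `θ¹(Z̄₁) = 0`, `θ¹(T) = 0`:
explicitly `θ¹ = dz - dz(T) θ`. -/
def coframe (θ : Heis → Heis →L[ℝ] ℝ) (p : Heis) : Heis →L[ℝ] ℂ :=
  ContinuousLinearMap.fst ℝ ℂ ℝ - (θ p).smulRight (reeb θ p).1

/-- The Levi form `h_{11̄}`, given by `dθ = i h_{11̄} θ¹ ∧ θ^{1̄}`; evaluated on `(X, Y) = (X, J X)`
this reads `dθ(X, J X) = 2 h_{11̄}`. -/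
def levi (θ : Heis → Heis →L[ℝ] ℝ) (p : Heis) : ℝ := dform θ p (X p) (Y p) / 2

/-- `η` is the value at `p` of the connection form `ω₁¹` and `A` is the value at `p` of the torsion
coefficient `A₁₁`: the structure equations `dθ¹ = θ¹ ∧ ω₁¹ + θ ∧ τ¹`, where
`τ¹ = h^{11̄} conj(A₁₁) θ^{1̄}`, and `ω_{11̄} + ω_{1̄1} = dh_{11̄}` hold. -/
def IsConnectionAt (θ : Heis → Heis →L[ℝ] ℝ) (p : Heis) (η : Heis →L[ℝ] ℂ) (A : ℂ) : Prop :=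
  (∀ V W : Heis, dform (coframe θ) p V W =
    (coframe θ p V * η W - coframe θ p W * η V)
      + ((levi θ p)⁻¹ : ℂ) * star A *
        ((θ p V : ℂ) * star (coframe θ p W) - (θ p W : ℂ) * star (coframe θ p V))) ∧
  ∀ V : Heis, (levi θ p : ℂ) * (η V + star (η V)) = (fderiv ℝ (levi θ) p V : ℂ)

/-- The connection form `ω₁¹` and the torsion coefficient `A₁₁`; they are the unique solution of the
structure equations. -/
def connection (θ : Heis → Heis →L[ℝ] ℝ) (p : Heis) : (Heis →L[ℝ] ℂ) × ℂ :=
  Classical.epsilon (fun q => IsConnectionAt θ p q.1 q.2)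

/-- The connection form `ω₁¹`. -/
def omega (θ : Heis → Heis →L[ℝ] ℝ) (p : Heis) : Heis →L[ℝ] ℂ := (connection θ p).1

/-- The torsion coefficient `A₁₁`. -/
def torsion (θ : Heis → Heis →L[ℝ] ℝ) (p : Heis) : ℂ := (connection θ p).2

/-- The scalar curvature `R`, given by `dω₁¹ = R h_{11̄} θ¹ ∧ θ^{1̄} mod θ`; evaluated on `(X, Y)`,
on which `θ¹ ∧ θ^{1̄}` is `-2i`, this reads `dω₁¹(X, Y) = -2i h_{11̄} R`. -/
def scalarCurv (θ : Heis → Heis →L[ℝ] ℝ) (p : Heis) : ℝ :=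
  (Complex.I * dform (omega θ) p (X p) (Y p)).re / (2 * levi θ p)

/-- The divergence `∇¹σ₁ = h^{11̄} (Z̄₁ σ₁ - ω₁¹(Z̄₁) σ₁)` of a `(1,0)`-form `σ₁ θ¹`. -/
def div (θ : Heis → Heis →L[ℝ] ℝ) (σ : Heis → ℂ) (p : Heis) : ℂ :=
  ((levi θ p)⁻¹ : ℂ) *
    (Zbar σ p - (omega θ p (X p) + Complex.I * omega θ p (Y p)) / 2 * σ p)

/-- `∇₁ f = Z₁ f` for a real function `f`. -/
def grad (f : Heis → ℝ) : Heis → ℂ := Z (fun q => (f q : ℂ))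

/-- `∇¹ f = h^{11̄} Z̄₁ f` for a real function `f`. -/
def gradUp (θ : Heis → Heis →L[ℝ] ℝ) (f : Heis → ℝ) (p : Heis) : ℂ :=
  ((levi θ p)⁻¹ : ℂ) * Zbar (fun q => (f q : ℂ)) p

/-- The sublaplacian `Δ_b f = ∇¹∇₁ f + ∇^{1̄}∇_{1̄} f = 2 Re ∇¹∇₁ f` of a real function `f`. -/
def sublap (θ : Heis → Heis →L[ℝ] ℝ) (f : Heis → ℝ) (p : Heis) : ℝ :=
  2 * (div θ (grad f) p).re

/-- `W₁ = ∇₁ R - i ∇¹ A₁₁`, with `∇¹ A₁₁ = h^{11̄} (Z̄₁ A₁₁ - 2 ω₁¹(Z̄₁) A₁₁)`. -/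
def Wform (θ : Heis → Heis →L[ℝ] ℝ) (p : Heis) : ℂ :=
  grad (scalarCurv θ) p - Complex.I * (((levi θ p)⁻¹ : ℂ) *
    (Zbar (torsion θ) p - (omega θ p (X p) + Complex.I * omega θ p (Y p)) * torsion θ p))

/-- The `P'`-operator
`P₄' f = 4 Δ_b² f - 8 Im ∇¹(A₁₁ ∇¹ f) - 4 Re ∇¹(R ∇₁ f) + (8/3) Re(W₁ ∇¹ f) - (4/3) f ∇¹ W₁`
(the function `∇¹ W₁` is real). -/
def Pprime (θ : Heis → Heis →L[ℝ] ℝ) (f : Heis → ℝ) (p : Heis) : ℝ :=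
  4 * sublap θ (sublap θ f) p
    - 8 * (div θ (fun q => torsion θ q * gradUp θ f q) p).im
    - 4 * (div θ (fun q => (scalarCurv θ q : ℂ) * grad f q) p).re
    + 8 / 3 * (Wform θ p * gradUp θ f p).re
    - 4 / 3 * f p * (div θ (Wform θ) p).re

/-- The `Q'`-curvature `Q₄' = -2 Δ_b R - 4 |A|² + R²`, for the nonpositive sublaplacian
`Δ_b = ∇¹∇₁ + ∇^{1̄}∇_{1̄}`. -/
def Qprime (θ : Heis → Heis →L[ℝ] ℝ) (p : Heis) : ℝ :=
  -2 * sublap θ (scalarCurv θ) p - 4 * ((levi θ p)⁻¹ * ‖torsion θ p‖) ^ 2 + scalarCurv θ p ^ 2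

/-- `θ` is (the pullback to `ℍ¹ \ {0}` of) a contact form on the quotient `M r` with its standard CR
structure: smooth, with kernel `Re T^{1,0}`, with positive definite Levi form, and invariant
under `Γ`. -/
structure IsContactForm (r : ℝ) (θ : Heis → Heis →L[ℝ] ℝ) : Prop where
  smooth : ContDiffOn ℝ ∞ θ {0}ᶜ
  ne_zero : ∀ p : Heis, p ≠ 0 → θ p ≠ 0
  ker_X : ∀ p : Heis, p ≠ 0 → θ p (X p) = 0
  ker_Y : ∀ p : Heis, p ≠ 0 → θ p (Y p) = 0
  levi_pos : ∀ p : Heis, p ≠ 0 → 0 < levi θ p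
  invariant : ∀ p : Heis, p ≠ 0 → ∀ V : Heis, θ (dil r p) (dil r V) = θ p V

/-- `θ` is pseudo-Einstein: `W₁ = 0`. -/
def IsPseudoEinstein (θ : Heis → Heis →L[ℝ] ℝ) : Prop :=
  ∀ p : Heis, p ≠ 0 → Wform θ p = 0

/-- The contact form `e^w θ`. -/
def conformal {r : ℝ} (w : M r → ℝ) (θ : Heis → Heis →L[ℝ] ℝ) (p : Heis) : Heis →L[ℝ] ℝ :=
  Real.exp (lift w p) • θ p

/-! ### The volume form, the projection `τ`, and the `II`-functional -/

/-- The coefficient `(θ ∧ dθ)(∂ₓ, ∂_y, ∂ₜ)` of the volume form. -/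
def volDensity (θ : Heis → Heis →L[ℝ] ℝ) (p : Heis) : ℝ :=
  θ p (1, 0) * dform θ p (Complex.I, 0) (0, 1)
    + θ p (Complex.I, 0) * dform θ p (0, 1) (1, 0)
    + θ p (0, 1) * dform θ p (1, 0) (Complex.I, 0)

/-- A fundamental domain for the action of `Γ` on `ℍ¹ \ {0}`. -/
def fundDomain (r : ℝ) : Set Heis := {p | min 1 r ≤ rho p ∧ rho p < max 1 r}

/-- The measure on the quotient `M r` given by the volume form `θ ∧ dθ`. -/
def vol (r : ℝ) (θ : Heis → Heis →L[ℝ] ℝ) : Measure (M r) :=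
  Measure.map (Quot.mk _) (Measure.comap (Subtype.val : Punctured → Heis)
    (((volume : Measure Heis).restrict (fundDomain r)).withDensity
      (fun p => ENNReal.ofReal (volDensity θ p))))

/-- The space `𝒫̂` of `L²` CR pluriharmonic functions: the closure of `𝒫` in `L²(M)`. -/
abbrev pluriharmonicL2 (r : ℝ) (θ : Heis → Heis →L[ℝ] ℝ) : Submodule ℝ (Lp ℝ 2 (vol r θ)) :=
  (Submodule.span ℝ
    {F : Lp ℝ 2 (vol r θ) | ∃ w ∈ pluriharmonic r, (F : M r → ℝ) =ᵐ[vol r θ] w}).topologicalClosure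

/-- The orthogonal projection `τ` onto the CR pluriharmonic functions, with respect to the `L²`
inner product of `θ ∧ dθ`, applied to a square-integrable function. -/
def tau (r : ℝ) (θ : Heis → Heis →L[ℝ] ℝ) (f : M r → ℝ) : Lp ℝ 2 (vol r θ) :=
  open Classical in
  if h : MemLp f 2 (vol r θ) then (pluriharmonicL2 r θ).starProjection (h.toLp f) else 0

/-- `P̄₄' w = τ (P₄' w)`. -/
def Pbar (r : ℝ) (θ : Heis → Heis →L[ℝ] ℝ) (w : M r → ℝ) : Lp ℝ 2 (vol r θ) :=
  tau r θ (descend (Pprime θ (lift w)))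

/-- `Q̄₄' = τ (Q₄')`. -/
def Qbar (r : ℝ) (θ : Heis → Heis →L[ℝ] ℝ) : Lp ℝ 2 (vol r θ) :=
  tau r θ (descend (Qprime θ))

/-- The functional
`II(w) = ∫ w P̄₄' w + 2 ∫ Q̄₄' w - (∫ Q̄₄') log ⨍ e^{2w}`, all integrals with respect to `θ ∧ dθ`. -/
def II (r : ℝ) (θ : Heis → Heis →L[ℝ] ℝ) (w : M r → ℝ) : ℝ :=
  (∫ m, w m * Pbar r θ w m ∂(vol r θ)) + 2 * (∫ m, Qbar r θ m * w m ∂(vol r θ))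
    - (∫ m, Qbar r θ m ∂(vol r θ)) * Real.log (⨍ m, Real.exp (2 * w m) ∂(vol r θ))

/-- `w` minimizes the `II`-functional of `θ` on `𝒫`. -/
def IsMinimizer (r : ℝ) (θ : Heis → Heis →L[ℝ] ℝ) (w : M r → ℝ) : Prop :=
  w ∈ pluriharmonic r ∧ ∀ v ∈ pluriharmonic r, II r θ w ≤ II r θ v

end HeisCR

end

open MeasureTheory Topology
open scoped ContDiff

noncomputable section

namespace HeisCR

/-! ### The algebra of smooth functions on the punctured Heisenberg group -/

/-! Write a contact form as `θ = e^σ θ₀`. A direct computation of its connection gives `W₁ = -3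
e^{-σ} Z Z Z̄ σ`, so `θ` is pseudo-Einstein exactly when `σ` is pluriharmonic, which for real
functions is the linear equation `Z̄Z̄Z σ = 0` (`isPseudoEinstein_iff`, `mem_pluriharmonic_iff`). In
that case nearly all nonlinear terms cancel: with `Δ = ZZ̄ + Z̄Z` and `P = ZZ̄Z̄Z`, one has `e^{2σ}
P₄' v = 4ΔΔv + 4P(σv)` for pluriharmonic `v`, and `e^{2σ} Q₄' = 4ΔΔσ + 2P(σ²)` (`aP_eq`, `aQ_eq`).
The factor `e^{2σ}` is the density of `θ ∧ dθ`, so integrals over the quotient become flat integrals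
over one annulus, and functions homogeneous of degree `-3` can be integrated by parts there
(`setIntegral_annulus_eq_zero_of_one_lt`).

Every contact form on the quotient has `σ = s + u` with `s = -log ρ²` and `u` invariant under the
dilation; it is pseudo-Einstein if and only if `u` is pluriharmonic. Integration by parts gives `∫ v
P(g) = 0` for pluriharmonic `v` and invariant `g`. The obstruction is that `s` is not invariant. It
is overcome with the CR function `q = |z|² - it`: since `log q = -s + iφ` is CR and `φ = arg q` is
invariant, `Z̄ s = i Z̄ φ`, and `s² - φ² = Re (log q)²` is pluriharmonic. The first fact yields `∫ v
P(s w) = 0` (`intF_mul_aPan_sS_mul`), the second replaces `P(s²)` by `P(φ²)` (`aPan_phiS_sq`).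

Thus, tested against pluriharmonic functions, `P₄'` and `Q₄'` reduce to `4ΔΔ` and `4ΔΔu`. In
particular `∫ Q̄₄' = 0`, the logarithmic term of the functional drops out, and completing the square
gives `II(w) = 4∫(Δ(w+u))² - 4∫(Δu)²` (`II_eq`). The minimum is reached at `w = -u`, that is at `e^w
θ = ρ⁻²θ₀`. Uniqueness is rigidity: for pluriharmonic `v`, `∫(Δv)² = 2∫|Z̄Zv|²`; if this vanishes,
then `∂ₜv = 0` by the commutator relation, and invariance under the dilation forces `v` to be
constant (`const_of_intF_lapS_sq`). Finally the curvature `Q₄'` of `ρ⁻²θ₀` is computed from `4(q⁻² +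
q̄⁻²)`. -/

lemma two_le_infty : (1 + 1 : WithTop ℕ∞) ≤ ∞ :=
  WithTop.coe_le_coe.2 (le_top (a := (1 + 1 : ℕ∞)))

lemma isOpen_compl_zero : IsOpen ({0}ᶜ : Set Heis) := isOpen_compl_singleton

/-- The algebra of smooth complex functions on `ℍ¹ \ {0}`. -/
def smoothAlg : Subalgebra ℂ (Punctured → ℂ) where
  carrier := {f | ∃ g : Heis → ℂ, ContDiffOn ℝ ∞ g {0}ᶜ ∧ ∀ p, f p = g p}
  mul_mem' := by
    rintro a b ⟨g, hg, hga⟩ ⟨h, hh, hhb⟩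
    exact ⟨fun p => g p * h p, hg.mul hh, fun p => by simp [hga, hhb]⟩
  add_mem' := by
    rintro a b ⟨g, hg, hga⟩ ⟨h, hh, hhb⟩
    exact ⟨fun p => g p + h p, hg.add hh, fun p => by simp [hga, hhb]⟩
  algebraMap_mem' c := ⟨fun _ => c, contDiffOn_const, fun _ => rfl⟩

/-- Smooth complex functions on `ℍ¹ \ {0}`. -/
def SF : Type := smoothAlg

instance : CommRing SF := inferInstanceAs (CommRing smoothAlg)
instance : Algebra ℂ SF := inferInstanceAs (Algebra ℂ smoothAlg)

/-- The underlying function on the punctured space. -/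
def SF.val (f : SF) : Punctured → ℂ := Subtype.val (p := (· ∈ smoothAlg)) f

@[simp] lemma SF.val_add (f g : SF) (p : Punctured) : (f + g).val p = f.val p + g.val p := rfl
@[simp] lemma SF.val_sub (f g : SF) (p : Punctured) : (f - g).val p = f.val p - g.val p := rfl
@[simp] lemma SF.val_neg (f : SF) (p : Punctured) : (-f).val p = -f.val p := rfl
@[simp] lemma SF.val_mul (f g : SF) (p : Punctured) : (f * g).val p = f.val p * g.val p := rfl
@[simp] lemma SF.val_smul (c : ℂ) (f : SF) (p : Punctured) : (c • f).val p = c * f.val p := rfl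
@[simp] lemma SF.val_zero (p : Punctured) : (0 : SF).val p = 0 := rfl
@[simp] lemma SF.val_one (p : Punctured) : (1 : SF).val p = 1 := rfl
@[simp] lemma SF.val_pow (f : SF) (n : ℕ) (p : Punctured) : (f ^ n).val p = f.val p ^ n := rfl

lemma SF.exists_contDiffOn (f : SF) :
    ∃ g : Heis → ℂ, ContDiffOn ℝ ∞ g {0}ᶜ ∧ ∀ p : Punctured, f.val p = g p :=
  Subtype.property (p := (· ∈ smoothAlg)) f

/-- A function on the Heisenberg group that is smooth off the origin, as an element of `SF`. -/
def SF.mk (g : Heis → ℂ) (hg : ContDiffOn ℝ ∞ g {0}ᶜ) : SF :=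
  ⟨fun p => g p, g, hg, fun _ => rfl⟩

/-- The extension by `0` to the origin of a smooth function on `ℍ¹ \ {0}`. -/
def SF.ext (f : SF) (p : Heis) : ℂ :=
  open Classical in if h : p ≠ 0 then f.val ⟨p, h⟩ else 0

lemma SF.ext_of_ne (f : SF) {p : Heis} (h : p ≠ 0) : f.ext p = f.val ⟨p, h⟩ := by
  simp [SF.ext, h]

@[simp] lemma SF.ext_coe (f : SF) (p : Punctured) : f.ext p = f.val p := by
  rw [f.ext_of_ne p.2]

@[simp] lemma SF.mk_apply (g : Heis → ℂ) (hg : ContDiffOn ℝ ∞ g {0}ᶜ) (p : Punctured) :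
    (SF.mk g hg).val p = g p := rfl

lemma SF.ext_mk (g : Heis → ℂ) (hg : ContDiffOn ℝ ∞ g {0}ᶜ) {p : Heis} (hp : p ≠ 0) :
    (SF.mk g hg).ext p = g p := by
  rw [SF.ext_of_ne _ hp]; rfl

lemma SF.contDiffOn_ext (f : SF) : ContDiffOn ℝ ∞ f.ext {0}ᶜ := by
  obtain ⟨g, hg, h⟩ := f.exists_contDiffOn
  exact hg.congr fun p hp => by rw [f.ext_of_ne hp]; exact h _

lemma SF.contDiffAt_ext (f : SF) {p : Heis} (hp : p ≠ 0) : ContDiffAt ℝ ∞ f.ext p :=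
  f.contDiffOn_ext.contDiffAt (isOpen_compl_zero.mem_nhds hp)

lemma SF.differentiableAt_ext (f : SF) {p : Heis} (hp : p ≠ 0) :
    DifferentiableAt ℝ f.ext p :=
  (f.contDiffAt_ext hp).differentiableAt (by simp)

lemma eventuallyEq_of_compl_zero {F : Type*} {f g : Heis → F} (h : ∀ p, p ≠ 0 → f p = g p)
    {p : Heis} (hp : p ≠ 0) : f =ᶠ[𝓝 p] g :=
  Filter.eventually_of_mem (isOpen_compl_zero.mem_nhds hp) fun q hq => h q hq

lemma SF.ext_mk_eventuallyEq (g : Heis → ℂ) (hg : ContDiffOn ℝ ∞ g {0}ᶜ) {p : Heis}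
    (hp : p ≠ 0) : (SF.mk g hg).ext =ᶠ[𝓝 p] g :=
  eventuallyEq_of_compl_zero (fun _ hq => SF.ext_mk g hg hq) hp

lemma SF.ext_add (f g : SF) : (f + g).ext = fun p => f.ext p + g.ext p := by
  funext p; by_cases hp : p = 0 <;> simp [SF.ext, hp]

lemma SF.ext_mul (f g : SF) : (f * g).ext = fun p => f.ext p * g.ext p := by
  funext p; by_cases hp : p = 0 <;> simp [SF.ext, hp]

lemma SF.ext_smul (c : ℂ) (f : SF) : (c • f).ext = fun p => c * f.ext p := by
  funext p; by_cases hp : p = 0 <;> simp [SF.ext, hp]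

lemma SF.eq_of_forall {f g : SF} (h : ∀ p : Punctured, f.val p = g.val p) : f = g :=
  Subtype.ext (funext h)

lemma contDiffOn_fderiv_apply {F : Type*} [NormedAddCommGroup F] [NormedSpace ℝ F]
    {g : Heis → F} (hg : ContDiffOn ℝ ∞ g {0}ᶜ) {V : Heis → Heis} (hV : ContDiff ℝ ∞ V) :
    ContDiffOn ℝ ∞ (fun p => fderiv ℝ g p (V p)) {0}ᶜ :=
  (hg.fderiv_of_isOpen isOpen_compl_zero (by simp)).clm_apply hV.contDiffOn

/-- The derivation of `SF` given by a smooth vector field. -/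
def vfDeriv (V : Heis → Heis) (hV : ContDiff ℝ ∞ V) : Derivation ℂ SF SF :=
  Derivation.mk'
    { toFun := fun f => SF.mk (fun p => fderiv ℝ f.ext p (V p))
        (contDiffOn_fderiv_apply f.contDiffOn_ext hV)
      map_add' := fun f g => SF.eq_of_forall fun p => by
        have h1 := f.differentiableAt_ext p.2
        have h2 := g.differentiableAt_ext p.2
        simp only [SF.mk_apply, SF.ext_add, fderiv_fun_add h1 h2]
        rfl
      map_smul' := fun c f => SF.eq_of_forall fun p => by
        have h1 := f.differentiableAt_ext p.2
        simp only [SF.mk_apply, SF.ext_smul, fderiv_const_mul h1]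
        rfl }
    fun f g => SF.eq_of_forall fun p => by
      have h1 := f.differentiableAt_ext p.2
      have h2 := g.differentiableAt_ext p.2
      simp only [LinearMap.coe_mk, AddHom.coe_mk, SF.mk_apply, SF.ext_mul, fderiv_fun_mul h1 h2]
      simp

lemma vfDeriv_apply (V : Heis → Heis) (hV : ContDiff ℝ ∞ V) (f : SF) (p : Punctured) :
    (vfDeriv V hV f).val p = fderiv ℝ f.ext p (V p) := rfl

lemma contDiff_X : ContDiff ℝ ∞ X := by
  unfold X
  exact contDiff_const.prodMk (contDiff_const.mul (Complex.imCLM.contDiff.comp contDiff_fst))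

lemma contDiff_Y : ContDiff ℝ ∞ Y := by
  unfold Y
  exact contDiff_const.prodMk (contDiff_const.mul (Complex.reCLM.contDiff.comp contDiff_fst))

/-- The vector field `X` as a derivation. -/
def dX : Derivation ℂ SF SF := vfDeriv X contDiff_X
/-- The vector field `Y` as a derivation. -/
def dY : Derivation ℂ SF SF := vfDeriv Y contDiff_Y
/-- The vector field `∂ₜ` as a derivation. -/
def dT : Derivation ℂ SF SF := vfDeriv (fun _ => (0, 1)) contDiff_const
/-- The vector field `Z₁` as a derivation. -/
def dZ : Derivation ℂ SF SF := (1 / 2 : ℂ) • (dX - Complex.I • dY)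
/-- The vector field `Z̄₁` as a derivation. -/
def dW : Derivation ℂ SF SF := (1 / 2 : ℂ) • (dX + Complex.I • dY)

lemma dZ_apply (f : SF) (p : Punctured) : (dZ f).val p = Z f.ext p := by
  simp [dZ, dX, dY, Z, vfDeriv_apply]; ring

lemma dW_apply (f : SF) (p : Punctured) : (dW f).val p = Zbar f.ext p := by
  simp [dW, dX, dY, Zbar, vfDeriv_apply]; ring

/-- The linear part of the affine vector field `X`. -/
def linX : Heis →L[ℝ] Heis :=
  ((2 : ℝ) • Complex.imCLM.comp (ContinuousLinearMap.fst ℝ ℂ ℝ)).smulRight ((0, 1) : Heis)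
/-- The linear part of the affine vector field `Y`. -/
def linY : Heis →L[ℝ] Heis :=
  ((-2 : ℝ) • Complex.reCLM.comp (ContinuousLinearMap.fst ℝ ℂ ℝ)).smulRight ((0, 1) : Heis)

lemma hasFDerivAt_X (p : Heis) : HasFDerivAt X linX p := by
  have : X = fun p => (1, 0) + linX p := by
    funext p; simp [X, linX]
  rw [this]; exact linX.hasFDerivAt.const_add _

lemma hasFDerivAt_Y (p : Heis) : HasFDerivAt Y linY p := by
  have : Y = fun p => (Complex.I, 0) + linY p := by
    funext p; simp [Y, linY]
  rw [this]; exact linY.hasFDerivAt.const_add _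

/-- The Hessian term is symmetric in the two fields, so in a commutator only the first-order terms
survive; for the affine fields `X`, `Y` these come from `linX`, `linY`. -/
lemma vfDeriv_vfDeriv (V W : Heis → Heis) (hV : ContDiff ℝ ∞ V) (hW : ContDiff ℝ ∞ W) (f : SF)
    (p : Punctured) (L : Heis →L[ℝ] Heis) (hL : HasFDerivAt W L p) :
    (vfDeriv V hV (vfDeriv W hW f)).val p
      = fderiv ℝ (fderiv ℝ f.ext) p (V p) (W p) + fderiv ℝ f.ext p (L (V p)) := by
  have h1 : (vfDeriv W hW f).ext =ᶠ[𝓝 p.1] fun q => fderiv ℝ f.ext q (W q) :=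
    SF.ext_mk_eventuallyEq (fun q => fderiv ℝ f.ext q (W q))
      (contDiffOn_fderiv_apply f.contDiffOn_ext hW) p.2
  have h2 : DifferentiableAt ℝ (fderiv ℝ f.ext) p.1 :=
    ((f.contDiffAt_ext p.2).fderiv_right (m := 1) two_le_infty).differentiableAt (by simp)
  rw [vfDeriv_apply, h1.fderiv_eq, (h2.hasFDerivAt.clm_apply hL).fderiv]
  simp [add_comm]

lemma fderiv_fderiv_symm (f : SF) (p : Punctured) (v w : Heis) :
    fderiv ℝ (fderiv ℝ f.ext) p v w = fderiv ℝ (fderiv ℝ f.ext) p w v :=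
  ((f.contDiffAt_ext p.2).isSymmSndFDerivAt (by simpa [one_add_one_eq_two] using two_le_infty)) v w

lemma dX_dY_sub (f : SF) : dX (dY f) - dY (dX f) = (-4 : ℂ) • dT f := by
  refine SF.eq_of_forall fun p => ?_
  have h1 := vfDeriv_vfDeriv X Y contDiff_X contDiff_Y f p linY (hasFDerivAt_Y p)
  have h2 := vfDeriv_vfDeriv Y X contDiff_Y contDiff_X f p linX (hasFDerivAt_X p)
  have e1 : linY (X p) = (-2 : ℝ) • ((0, 1) : Heis) := by simp [linY, X]
  have e2 : linX (Y p) = (2 : ℝ) • ((0, 1) : Heis) := by simp [linX, Y]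
  rw [e1, map_smul] at h1
  rw [e2, map_smul] at h2
  have h3 := fderiv_fderiv_symm f p (X p) (Y p)
  change (vfDeriv X contDiff_X (vfDeriv Y contDiff_Y f)).val p
    - (vfDeriv Y contDiff_Y (vfDeriv X contDiff_X f)).val p = -4 * fderiv ℝ f.ext p (0, 1)
  rw [h1, h2, h3]
  simp only [Complex.real_smul]; push_cast; ring

lemma dT_dX (f : SF) : dT (dX f) = dX (dT f) := by
  refine SF.eq_of_forall fun p => ?_
  have h1 := vfDeriv_vfDeriv (fun _ => (0, 1)) X contDiff_const contDiff_X f p linX (hasFDerivAt_X p)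
  have h2 := vfDeriv_vfDeriv X (fun _ => (0, 1)) contDiff_X contDiff_const f p 0
    (hasFDerivAt_const _ _)
  have e1 : linX ((0, 1) : Heis) = 0 := by simp [linX]
  rw [e1] at h1
  exact h1.trans ((congrArg₂ (· + ·) (fderiv_fderiv_symm f p _ _) (by simp)).trans h2.symm)

lemma dT_dY (f : SF) : dT (dY f) = dY (dT f) := by
  refine SF.eq_of_forall fun p => ?_
  have h1 := vfDeriv_vfDeriv (fun _ => (0, 1)) Y contDiff_const contDiff_Y f p linY (hasFDerivAt_Y p)
  have h2 := vfDeriv_vfDeriv Y (fun _ => (0, 1)) contDiff_Y contDiff_const f p 0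
    (hasFDerivAt_const _ _)
  have e1 : linY ((0, 1) : Heis) = 0 := by simp [linY]
  rw [e1] at h1
  exact h1.trans ((congrArg₂ (· + ·) (fderiv_fderiv_symm f p _ _) (by simp)).trans h2.symm)

/-- `[Z̄₁, Z₁] = 2i ∂ₜ`. -/
lemma dW_dZ (f : SF) : dW (dZ f) = dZ (dW f) + (2 * Complex.I) • dT f := by
  have h := dX_dY_sub f
  simp only [dZ, dW, Derivation.smul_apply, Derivation.sub_apply, Derivation.add_apply, Derivation.map_smul,
    map_add, map_sub]
  rw [sub_eq_iff_eq_add] at h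
  rw [h]
  module

lemma dT_dZ (f : SF) : dT (dZ f) = dZ (dT f) := by
  simp only [dZ, Derivation.smul_apply, Derivation.sub_apply, Derivation.map_smul, map_sub, dT_dX, dT_dY]

lemma dT_dW (f : SF) : dT (dW f) = dW (dT f) := by
  simp only [dW, Derivation.smul_apply, Derivation.add_apply, Derivation.map_smul, map_add, dT_dX, dT_dY]

/-- `[Z₁, [Z₁, Z̄₁]] = 0`. -/
lemma dW_dZ_dZ (f : SF) : dW (dZ (dZ f)) = (2 : ℂ) • dZ (dW (dZ f)) - dZ (dZ (dW f)) := by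
  rw [dW_dZ (dZ f), dW_dZ f, dT_dZ]
  simp only [map_add, Derivation.map_smul]
  module

/-- `[Z̄₁, [Z̄₁, Z₁]] = 0`. -/
lemma dZ_dW_dW (f : SF) : dZ (dW (dW f)) = (2 : ℂ) • dW (dZ (dW f)) - dW (dW (dZ f)) := by
  rw [dW_dZ (f := f), map_add, dW_dZ (dW f), Derivation.map_smul, ← dT_dW]
  module

/-! ### Complex conjugation -/

/-- Complex conjugation on `SF`. -/
def conj : SF →+* SF where
  toFun f := SF.mk (fun p => star (f.ext p))
    (Complex.conjCLE.contDiff.comp_contDiffOn f.contDiffOn_ext)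
  map_one' := SF.eq_of_forall fun p => by simp
  map_mul' f g := SF.eq_of_forall fun p => by simp
  map_zero' := SF.eq_of_forall fun p => by simp
  map_add' f g := SF.eq_of_forall fun p => by simp

lemma conj_apply (f : SF) (p : Punctured) : (conj f).val p = star (f.val p) := by
  simp [conj]

@[simp] lemma conj_conj (f : SF) : conj (conj f) = f :=
  SF.eq_of_forall fun p => by simp [conj_apply]

@[simp] lemma conj_smul (c : ℂ) (f : SF) : conj (c • f) = star c • conj f :=
  SF.eq_of_forall fun p => by simp [conj_apply]

lemma conj_ext (f : SF) : (conj f).ext = fun p => star (f.ext p) := by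
  funext p; by_cases hp : p = 0 <;> simp [SF.ext, hp, conj_apply]

lemma vfDeriv_conj (V : Heis → Heis) (hV : ContDiff ℝ ∞ V) (f : SF) :
    vfDeriv V hV (conj f) = conj (vfDeriv V hV f) := by
  refine SF.eq_of_forall fun p => ?_
  rw [conj_apply, vfDeriv_apply, vfDeriv_apply, conj_ext]
  have := (Complex.conjCLE.toContinuousLinearMap.hasFDerivAt.comp p.1
    (f.differentiableAt_ext p.2).hasFDerivAt).fderiv
  exact congrArg (fun L => L (V p)) this

lemma dZ_conj (f : SF) : dZ (conj f) = conj (dW f) := by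
  simp only [dZ, dW, dX, dY, Derivation.smul_apply, Derivation.sub_apply, Derivation.add_apply,
    vfDeriv_conj, conj_smul, map_add]
  simp [sub_eq_add_neg]

lemma dW_conj (f : SF) : dW (conj f) = conj (dZ f) := by
  rw [← conj_conj (dW (conj f)), ← dZ_conj, conj_conj]

/-! ### Identities in a ring with two derivations -/

section Algebraic

variable {R : Type*} [CommRing R] [Algebra ℂ R] (Z W : Derivation ℂ R R)

lemma deriv_two : Z (2 : R) = 0 := by
  have := Z.map_natCast 2
  simpa using this

/-- The pair `(k, k')` witnesses that `v` is pluriharmonic: `Z̄Z v = k` and `ZZ̄ v = k'` with `k`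
holomorphic and `k'` antiholomorphic. -/
structure IsPair (v k k' : R) : Prop where
  WZ : W (Z v) = k
  ZW : Z (W v) = k'
  W_k : W k = 0
  Z_k' : Z k' = 0
  WZZ : W (Z (Z v)) = 2 * Z k
  ZWW : Z (W (W v)) = 2 * W k'

/-- The divergence `∇¹τ` for the contact form `e^s θ₀`. -/
def aDiv (s E' τ : R) : R := E' * (W τ + W s * τ)

/-- The sublaplacian for the contact form `e^s θ₀`. -/
def aLap (s E' f : R) : R := aDiv W s E' (Z f) + aDiv Z s E' (W f)

/-- The torsion of the contact form `e^s θ₀`, divided by `i`. -/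
def aTor (s : R) : R := Z (Z s) - Z s ^ 2

/-- The scalar curvature of the contact form `e^s θ₀`. -/
def aScal (s E' : R) : R := -(2 * (E' * (W (Z s) + Z (W s) + Z s * W s)))

/-- The form `W₁` of the contact form `e^s θ₀`. -/
def aForm (s E' : R) : R :=
  Z (aScal Z W s E') + E' * (W (aTor Z s) + 2 * W s * aTor Z s)

/-- The operator `P₄'` of a pseudo-Einstein contact form `e^s θ₀`. -/
def aP (s E' f : R) : R :=
  4 * aLap Z W s E' (aLap Z W s E' f)
    - 4 * (aDiv W s E' (aTor Z s * (E' * W f)) + aDiv Z s E' (aTor W s * (E' * Z f)))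
    - 2 * (aDiv W s E' (aScal Z W s E' * Z f) + aDiv Z s E' (aScal Z W s E' * W f))

/-- The curvature `Q₄'` of the contact form `e^s θ₀`. -/
def aQ (s E' : R) : R :=
  -(2 * aLap Z W s E' (aScal Z W s E')) - 4 * (E' ^ 2 * aTor Z s * aTor W s)
    + aScal Z W s E' ^ 2

/-- The operator `ΔΔ`, for `Δ = ZZ̄ + Z̄Z`. -/
def aBi (f : R) : R :=
  W (Z (W (Z f) + Z (W f))) + Z (W (W (Z f) + Z (W f)))

/-- The operator `ZZ̄Z̄Z`. -/
def aPan (f : R) : R := Z (W (W (Z f)))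

variable {Z W}

/-- All products of derivatives of `s` cancel between the curvature and the torsion term, leaving
third-order terms; `h`, which encodes `[Z, [Z, Z̄]] = 0`, merges them into one. This makes the
pseudo-Einstein condition linear in `s`. -/
lemma aForm_eq {s E E' : R} (hE : E * E' = 1) (hZE : Z E' = -(E' * Z s))
    (h : W (Z (Z s)) = 2 * Z (W (Z s)) - Z (Z (W s))) :
    E * aForm Z W s E' = -(3 * Z (Z (W s))) := by
  simp only [aForm, aScal, aTor, map_neg, map_add, map_sub, Derivation.leibniz, smul_eq_mul,
    deriv_two, hZE, h, pow_two]
  linear_combination (-2 * Z (W (Z s)) - 2 * Z (Z (W s)) +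
    (2 * Z (W (Z s)) - Z (Z (W s)))) * hE

/-- By Leibniz, the terms in which `s` or `v` stays undifferentiated carry `W (W (Z v))` or `W (W (Z
s))`, which vanish. The right side therefore depends on `s` only through its derivatives, which is
what allows an `s` that is not dilation invariant. -/
lemma aPan_mul {s S S' v k k' : R} (hs : IsPair Z W s S S') (hv : IsPair Z W v k k') :
    aPan Z W (s * v) = Z (2 * S * W v + 2 * k * W s + Z s * W (W v) + W (W s) * Z v) := by
  simp only [aPan, map_add, Derivation.leibniz, smul_eq_mul,
    deriv_two, hs.WZ, hs.ZW, hs.W_k, hs.ZWW, hv.WZ, hv.ZW, hv.W_k, hv.ZWW, map_zero]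
  ring

/-- After full expansion each term on the left carries `E² E'²`; the terms of degree two or more in
`s` cancel, so the result is affine in `s`. -/
lemma aP_eq {s S S' v k k' E E' : R} (hE : E * E' = 1) (hZE : Z E' = -(E' * Z s))
    (hWE : W E' = -(E' * W s)) (hs : IsPair Z W s S S') (hv : IsPair Z W v k k') :
    E ^ 2 * aP Z W s E' v = 4 * aBi Z W v + 4 * aPan Z W (s * v) := by
  have h2 : E ^ 2 * E' ^ 2 = 1 := by rw [← mul_pow, hE, one_pow]
  simp only [aP, aLap, aDiv, aTor, aScal, aBi, aPan, map_neg, map_add, map_sub, pow_two E,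
    pow_two (Z s), pow_two (W s), Derivation.leibniz, smul_eq_mul, hZE, hWE,
    deriv_two, hs.WZ, hs.ZW, hs.W_k, hs.Z_k', hs.WZZ, hs.ZWW, hv.WZ, hv.ZW, hv.W_k, hv.Z_k',
    hv.WZZ, hv.ZWW, map_zero]
  linear_combination (4 * W (Z k) + 4 * Z (W k') + 8 * W s * Z k + 4 * Z (Z v) * W (W s)
    + 8 * Z v * W S' + 8 * S' * k + 8 * S * k' + 8 * Z s * W k' + 8 * W v * Z S
    + 4 * Z (Z s) * W (W v)) * h2

/-- The same cancellation as in `aP_eq`: the cubic and quartic terms in `s` disappear, and the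
quadratic ones assemble into `Z W W Z` applied to `s²`. -/
lemma aQ_eq {s S S' E E' : R} (hE : E * E' = 1) (hZE : Z E' = -(E' * Z s))
    (hWE : W E' = -(E' * W s)) (hs : IsPair Z W s S S') :
    E ^ 2 * aQ Z W s E' = 4 * aBi Z W s + 2 * aPan Z W (s * s) := by
  have h2 : E ^ 2 * E' ^ 2 = 1 := by rw [← mul_pow, hE, one_pow]
  simp only [aQ, aLap, aDiv, aTor, aScal, aBi, aPan, map_neg, map_add, pow_two E,
    pow_two (Z s), pow_two (W s), Derivation.leibniz, smul_eq_mul, hZE, hWE,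
    deriv_two, hs.WZ, hs.ZW, hs.W_k, hs.Z_k', hs.WZZ, hs.ZWW, map_zero]
  linear_combination (4 * W (Z S) + 4 * Z (W S') + 8 * Z s * W S' + 8 * S' * S + 8 * W s * Z S
    + 4 * Z (Z s) * W (W s)) * h2

end Algebraic

/-! ### The frame `X`, `Y`, `∂ₜ` and the contact form `θ₀` -/

lemma theta0_apply (p V : Heis) :
    theta0 p V = V.2 / 2 + p.1.re * V.1.im - p.1.im * V.1.re := by
  simp [theta0]; ring

@[simp] lemma theta0_X (p : Heis) : theta0 p (X p) = 0 := by
  simp [theta0_apply, X]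

@[simp] lemma theta0_Y (p : Heis) : theta0 p (Y p) = 0 := by
  simp [theta0_apply, Y]; ring

lemma frame_decomp (p V : Heis) :
    V = V.1.re • X p + V.1.im • Y p + (2 * theta0 p V) • ((0, 1) : Heis) := by
  refine Prod.ext (Complex.ext ?_ ?_) ?_ <;> simp [X, Y, theta0_apply]
  ring

lemma clm_frame {F : Type*} [NormedAddCommGroup F] [NormedSpace ℝ F] (L : Heis →L[ℝ] F)
    (p V : Heis) :
    L V = V.1.re • L (X p) + V.1.im • L (Y p) + (2 * theta0 p V) • L (0, 1) := by
  conv_lhs => rw [frame_decomp p V]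
  simp only [map_add, map_smul]

lemma clm_ext_frame {F : Type*} [NormedAddCommGroup F] [NormedSpace ℝ F] {L L' : Heis →L[ℝ] F}
    (p : Heis) (hX : L (X p) = L' (X p)) (hY : L (Y p) = L' (Y p))
    (hT : L (0, 1) = L' (0, 1)) : L = L' := by
  refine ContinuousLinearMap.ext fun V => ?_
  rw [clm_frame L p V, clm_frame L' p V, hX, hY, hT]

/-- The coframe dual to `Z₁`, `Z̄₁`, `∂ₜ` is `dz`, `dz̄`, `2θ₀`. -/
lemma fderiv_frame (f : Heis → ℂ) (p V : Heis) :
    fderiv ℝ f p V = V.1 * Z f p + star V.1 * Zbar f p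
      + 2 * theta0 p V * fderiv ℝ f p (0, 1) := by
  rw [clm_frame _ p V]
  have h : V.1 = V.1.re + V.1.im * Complex.I := (Complex.re_add_im _).symm
  have h' : star V.1 = V.1.re - V.1.im * Complex.I := by
    apply Complex.ext <;> simp
  simp only [Complex.real_smul, Z, Zbar]
  push_cast
  linear_combination (-(fderiv ℝ f p (X p) - Complex.I * fderiv ℝ f p (Y p)) / 2) * h
    - ((fderiv ℝ f p (X p) + Complex.I * fderiv ℝ f p (Y p)) / 2) * h'
    + (V.1.im * fderiv ℝ f p (Y p)) * Complex.I_mul_I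

/-- The derivative of `θ₀`. -/
def theta0Deriv : Heis →L[ℝ] Heis →L[ℝ] ℝ :=
  (Complex.reCLM.comp (ContinuousLinearMap.fst ℝ ℂ ℝ)).smulRight
      (Complex.imCLM.comp (ContinuousLinearMap.fst ℝ ℂ ℝ))
    - (Complex.imCLM.comp (ContinuousLinearMap.fst ℝ ℂ ℝ)).smulRight
      (Complex.reCLM.comp (ContinuousLinearMap.fst ℝ ℂ ℝ))

lemma theta0Deriv_apply (V W : Heis) :
    theta0Deriv V W = V.1.re * W.1.im - V.1.im * W.1.re := by
  simp [theta0Deriv]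

lemma theta0_eq :
    theta0 = fun p => (1 / 2 : ℝ) • ContinuousLinearMap.snd ℝ ℂ ℝ + theta0Deriv p := by
  funext p
  refine ContinuousLinearMap.ext fun V => ?_
  simp only [theta0_apply, add_apply, theta0Deriv_apply]
  simp; ring

lemma hasFDerivAt_theta0 (p : Heis) : HasFDerivAt theta0 theta0Deriv p := by
  rw [theta0_eq]
  exact theta0Deriv.hasFDerivAt.const_add _

lemma contDiff_theta0 : ContDiff ℝ ∞ theta0 := by
  rw [theta0_eq]
  exact contDiff_const.add theta0Deriv.contDiff

/-! ### Representing functions off the origin by elements of `SF` -/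

/-- The function `g` agrees with `f` off the origin. -/
def Rep (g : Heis → ℂ) (f : SF) : Prop := ∀ p : Punctured, g p = f.val p

lemma Rep.eventuallyEq {g : Heis → ℂ} {f : SF} (h : Rep g f) {p : Heis} (hp : p ≠ 0) :
    g =ᶠ[𝓝 p] f.ext :=
  eventuallyEq_of_compl_zero (fun q hq => (h ⟨q, hq⟩).trans (f.ext_of_ne hq).symm) hp

lemma Rep.Z {g : Heis → ℂ} {f : SF} (h : Rep g f) : Rep (Z g) (dZ f) := fun p => by
  rw [dZ_apply, HeisCR.Z, HeisCR.Z, (h.eventuallyEq p.2).fderiv_eq]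

lemma Rep.Zbar {g : Heis → ℂ} {f : SF} (h : Rep g f) : Rep (Zbar g) (dW f) := fun p => by
  rw [dW_apply, HeisCR.Zbar, HeisCR.Zbar, (h.eventuallyEq p.2).fderiv_eq]

/-- A real smooth function as an element of `SF`. -/
def SF.ofReal (f : Heis → ℝ) (hf : ContDiffOn ℝ ∞ f {0}ᶜ) : SF :=
  SF.mk (fun p => (f p : ℂ)) (Complex.ofRealCLM.contDiff.comp_contDiffOn hf)

@[simp] lemma SF.ofReal_apply (f : Heis → ℝ) (hf : ContDiffOn ℝ ∞ f {0}ᶜ) (p : Punctured) :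
    (SF.ofReal f hf).val p = (f p : ℂ) := rfl

@[simp] lemma conj_ofReal (f : Heis → ℝ) (hf : ContDiffOn ℝ ∞ f {0}ᶜ) :
    conj (SF.ofReal f hf) = SF.ofReal f hf :=
  SF.eq_of_forall fun p => by simp [conj_apply]

lemma rep_ofReal (f : Heis → ℝ) (hf : ContDiffOn ℝ ∞ f {0}ᶜ) :
    Rep (fun p => (f p : ℂ)) (SF.ofReal f hf) := fun _ => rfl

lemma fderiv_ofReal_comp {f : Heis → ℝ} {p : Heis} (hf : DifferentiableAt ℝ f p) (V : Heis) :
    fderiv ℝ (fun q => (f q : ℂ)) p V = (fderiv ℝ f p V : ℂ) := by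
  have := (Complex.ofRealCLM.hasFDerivAt.comp p hf.hasFDerivAt).fderiv
  exact congrArg (fun L => L V) this

lemma fderiv_exp_comp {g : Heis → ℝ} {p : Heis} (hg : DifferentiableAt ℝ g p) (V : Heis) :
    fderiv ℝ (fun q => Real.exp (g q)) p V = Real.exp (g p) * fderiv ℝ g p V := by
  rw [fderiv_exp hg]; simp

lemma vfDeriv_exp (V : Heis → Heis) (hV : ContDiff ℝ ∞ V) (g : Heis → ℝ)
    (hg : ContDiffOn ℝ ∞ g {0}ᶜ) :
    vfDeriv V hV (SF.ofReal (fun p => Real.exp (g p)) hg.exp)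
      = SF.ofReal (fun p => Real.exp (g p)) hg.exp * vfDeriv V hV (SF.ofReal g hg) := by
  refine SF.eq_of_forall fun p => ?_
  have h1 : DifferentiableAt ℝ g p :=
    (hg.contDiffAt (isOpen_compl_zero.mem_nhds p.2)).differentiableAt (by simp)
  simp only [SF.val_mul, vfDeriv_apply]
  rw [((rep_ofReal _ hg.exp).eventuallyEq p.2).symm.fderiv_eq,
    ((rep_ofReal _ hg).eventuallyEq p.2).symm.fderiv_eq, fderiv_ofReal_comp h1,
    fderiv_ofReal_comp h1.exp, fderiv_exp_comp h1]
  simp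

lemma dZ_exp (g : Heis → ℝ) (hg : ContDiffOn ℝ ∞ g {0}ᶜ) :
    dZ (SF.ofReal (fun p => Real.exp (g p)) hg.exp)
      = SF.ofReal (fun p => Real.exp (g p)) hg.exp * dZ (SF.ofReal g hg) := by
  simp only [dZ, dX, dY, Derivation.smul_apply, Derivation.sub_apply]
  rw [vfDeriv_exp _ _ g hg, vfDeriv_exp _ _ g hg]
  simp only [mul_smul_comm, mul_sub]

lemma dW_exp (g : Heis → ℝ) (hg : ContDiffOn ℝ ∞ g {0}ᶜ) :
    dW (SF.ofReal (fun p => Real.exp (g p)) hg.exp)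
      = SF.ofReal (fun p => Real.exp (g p)) hg.exp * dW (SF.ofReal g hg) := by
  simp only [dW, dX, dY, Derivation.smul_apply, Derivation.add_apply]
  rw [vfDeriv_exp _ _ g hg, vfDeriv_exp _ _ g hg]
  simp only [mul_smul_comm, mul_add]

/-! ### The pseudohermitian geometry of `e^σ θ₀` -/

/-- The one-form `θ` equals `e^σ θ₀` off the origin, with `σ` smooth. -/
structure IsExpForm (θ : Heis → Heis →L[ℝ] ℝ) (σ : Heis → ℝ) : Prop where
  smooth : ContDiffOn ℝ ∞ σ {0}ᶜ
  eq : ∀ p : Heis, p ≠ 0 → θ p = Real.exp (σ p) • theta0 p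

namespace IsExpForm

variable {θ : Heis → Heis →L[ℝ] ℝ} {σ : Heis → ℝ} (h : IsExpForm θ σ)
include h

lemma differentiableAt {p : Heis} (hp : p ≠ 0) : DifferentiableAt ℝ σ p :=
  (h.smooth.contDiffAt (isOpen_compl_zero.mem_nhds hp)).differentiableAt (by simp)

/-- The function `σ` as an element of `SF`. -/
def s : SF := SF.ofReal σ h.smooth
/-- The function `e^σ` as an element of `SF`. -/
def E : SF := SF.ofReal (fun p => Real.exp (σ p)) h.smooth.exp
/-- The function `e^{-σ}` as an element of `SF`. -/
def E' : SF := SF.ofReal (fun p => Real.exp (-σ p)) h.smooth.neg.exp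

lemma conj_s : conj h.s = h.s := conj_ofReal _ _
lemma conj_E' : conj h.E' = h.E' := conj_ofReal _ _

lemma E_mul_E' : h.E * h.E' = 1 := SF.eq_of_forall fun p => by
  simp only [E, E', SF.val_mul, SF.ofReal_apply, SF.val_one]
  rw [← Complex.ofReal_mul, ← Real.exp_add]; simp

lemma ofReal_neg : SF.ofReal (fun p => -σ p) h.smooth.neg = -h.s :=
  SF.eq_of_forall fun p => by simp [s]

lemma dZ_E' : dZ h.E' = -(h.E' * dZ h.s) := by
  have := dZ_exp _ h.smooth.neg
  rw [h.ofReal_neg, map_neg, mul_neg] at this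
  exact this
lemma dW_E' : dW h.E' = -(h.E' * dW h.s) := by
  have := dW_exp _ h.smooth.neg
  rw [h.ofReal_neg, map_neg, mul_neg] at this
  exact this

lemma hasFDerivAt {p : Heis} (hp : p ≠ 0) :
    HasFDerivAt θ (Real.exp (σ p) • theta0Deriv
      + (Real.exp (σ p) • fderiv ℝ σ p).smulRight (theta0 p)) p := by
  have h1 := ((h.differentiableAt hp).hasFDerivAt.exp).smul (hasFDerivAt_theta0 p)
  exact h1.congr_of_eventuallyEq (eventuallyEq_of_compl_zero h.eq hp)

lemma dform_apply {p : Heis} (hp : p ≠ 0) (V W : Heis) :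
    dform θ p V W = Real.exp (σ p) * (fderiv ℝ σ p V * theta0 p W - fderiv ℝ σ p W * theta0 p V
      + 2 * (V.1.re * W.1.im - V.1.im * W.1.re)) := by
  rw [dform, (h.hasFDerivAt hp).fderiv]
  simp [theta0Deriv_apply]; ring

lemma levi_eq {p : Heis} (hp : p ≠ 0) : levi θ p = Real.exp (σ p) := by
  rw [levi, h.dform_apply hp, theta0_X, theta0_Y]
  simp [X, Y]

/-- The `dσ` terms drop out on wedging with `θ₀`, and the coordinate density of `θ₀ ∧ dθ₀` is `1`.
Hence Lebesgue measure with the weight `e^{2σ}` is the volume. -/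
lemma volDensity_eq {p : Heis} (hp : p ≠ 0) : volDensity θ p = Real.exp (2 * σ p) := by
  rw [volDensity, h.dform_apply hp, h.dform_apply hp, h.dform_apply hp, h.eq p hp,
    two_mul (σ p), Real.exp_add]
  simp [theta0_apply]; ring

lemma fderiv_σ {p : Heis} (hp : p ≠ 0) (V : Heis) :
    (fderiv ℝ σ p V : ℂ) = V.1 * (dZ h.s).val ⟨p, hp⟩ + star V.1 * (dW h.s).val ⟨p, hp⟩
      + 2 * theta0 p V * (dT h.s).val ⟨p, hp⟩ := by
  have h1 := fderiv_frame (fun q => (σ q : ℂ)) p V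
  rw [fderiv_ofReal_comp (h.differentiableAt hp)] at h1
  rw [h1, (rep_ofReal σ h.smooth).Z ⟨p, hp⟩, (rep_ofReal σ h.smooth).Zbar ⟨p, hp⟩,
    ((rep_ofReal σ h.smooth).eventuallyEq hp).fderiv_eq]
  rfl

lemma star_dW (p : Punctured) : star ((dW h.s).val p) = (dZ h.s).val p := by
  rw [← conj_apply, ← dZ_conj, h.conj_s]

/-- The horizontal part of the Reeb field. -/
def reebHor (p : Punctured) : ℂ := -(Complex.I * Real.exp (-σ p) * (dW h.s).val p)

/-- Testing `dθ(T, ·) = 0` on `X` and `Y` gives two real equations that determine the complex number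
`T.1`; the normalization `θ(T) = 1` gives the remaining component. -/
lemma isReebAt_iff {p : Heis} (hp : p ≠ 0) (T : Heis) :
    IsReebAt θ p T ↔ theta0 p T = Real.exp (-σ p) ∧ T.1 = h.reebHor ⟨p, hp⟩ := by
  have hE : Real.exp (σ p) ≠ 0 := (Real.exp_pos _).ne'
  have hθ : θ p T = 1 ↔ theta0 p T = Real.exp (-σ p) := by
    rw [h.eq p hp, Real.exp_neg]
    simp only [smul_apply, smul_eq_mul]
    rw [← mul_eq_one_iff_eq_inv₀ hE, mul_comm]
  have hZW : (dZ h.s).val ⟨p, hp⟩ = star ((dW h.s).val ⟨p, hp⟩) := (h.star_dW _).symm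
  have key : ∀ V : Heis, theta0 p T = Real.exp (-σ p) → ((dform θ p T V : ℝ) : ℂ)
      = Real.exp (σ p) * (fderiv ℝ σ p T * theta0 p V
        - (V.1 * (dZ h.s).val ⟨p, hp⟩ + star V.1 * (dW h.s).val ⟨p, hp⟩
          + 2 * theta0 p V * (dT h.s).val ⟨p, hp⟩) * Real.exp (-σ p)
        + Complex.I * (T.1 * star V.1 - star T.1 * V.1)) := by
    intro V hT
    rw [h.dform_apply hp, hT]
    push_cast
    rw [h.fderiv_σ hp V]
    have e : Complex.I * (T.1 * star V.1 - star T.1 * V.1)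
        = 2 * (T.1.re * V.1.im - T.1.im * V.1.re) := by
      apply Complex.ext <;> (simp; try ring)
    rw [e]
  constructor
  · rintro ⟨h1, h2⟩
    have h1' := hθ.1 h1
    refine ⟨h1', ?_⟩
    have hX := key (X p) h1'
    have hY := key (Y p) h1'
    rw [h2, theta0_X] at hX
    rw [h2, theta0_Y] at hY
    have hE' : (Real.exp (σ p) : ℂ) ≠ 0 := by exact_mod_cast hE
    simp only [X, Y, Complex.ofReal_zero, mul_zero, zero_mul, add_zero, zero_sub, zero_eq_mul, hE',
      false_or, star_one, one_mul, mul_one] at hX hY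
    rw [show star Complex.I = -Complex.I from Complex.conj_I] at hY
    simp only [reebHor]
    linear_combination (-Complex.I / 2) * hX + (1 / 2) * hY + T.1 * Complex.I_sq
  · rintro ⟨h1, h2⟩
    refine ⟨hθ.2 h1, fun V => ?_⟩
    have hV := key V h1
    have e : star (h.reebHor ⟨p, hp⟩) = Complex.I * Real.exp (-σ p) * (dZ h.s).val ⟨p, hp⟩ := by
      rw [hZW]; simp [reebHor, -Complex.ofReal_exp]
    rw [h.fderiv_σ hp T, h1, h2, e, reebHor] at hV
    have : ((dform θ p T V : ℝ) : ℂ) = 0 := by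
      rw [hV]
      linear_combination (-(Real.exp (σ p)) * Real.exp (-σ p) * ((dZ h.s).val ⟨p, hp⟩ * V.1
        + (dW h.s).val ⟨p, hp⟩ * star V.1) : ℂ) * Complex.I_sq
    exact_mod_cast this

end IsExpForm

/-! ### Reeb field, admissible coframe and connection form of `e^σ θ₀`. -/

namespace IsExpForm

variable {θ : Heis → Heis →L[ℝ] ℝ} {σ : Heis → ℝ} (h : IsExpForm θ σ)
include h

lemma exists_isReebAt {p : Heis} (hp : p ≠ 0) : ∃ T, IsReebAt θ p T := by
  set a := h.reebHor ⟨p, hp⟩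
  -- The `t`-component is obtained by solving `theta0 p T = exp (-σ p)` for it once `T.1 = a` is
  -- prescribed.
  refine ⟨(a, 2 * (Real.exp (-σ p) - p.1.re * a.im + p.1.im * a.re)), ?_⟩
  rw [h.isReebAt_iff hp, theta0_apply]
  exact ⟨by ring, rfl⟩

lemma reeb_fst {p : Heis} (hp : p ≠ 0) : (reeb θ p).1 = h.reebHor ⟨p, hp⟩ :=
  ((h.isReebAt_iff hp _).1 (Classical.epsilon_spec (h.exists_isReebAt hp))).2

lemma coframe_apply {p : Heis} (hp : p ≠ 0) (V : Heis) :
    coframe θ p V = V.1 + theta0 p V * (Complex.I * (dW h.s).val ⟨p, hp⟩) := by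
  rw [coframe, h.reeb_fst hp, h.eq p hp]
  have hE : (Real.exp (σ p) : ℂ) * Real.exp (-σ p) = 1 := by
    rw [← Complex.ofReal_mul, ← Real.exp_add]; simp
  simp only [sub_apply, ContinuousLinearMap.coe_fst', ContinuousLinearMap.smulRight_apply,
    smul_apply, smul_eq_mul, Complex.real_smul, reebHor]
  push_cast at hE ⊢
  linear_combination (theta0 p V * Complex.I * (dW h.s).val ⟨p, hp⟩) * hE

lemma coframe_eq {p : Heis} (hp : p ≠ 0) : coframe θ p
    = ContinuousLinearMap.fst ℝ ℂ ℝ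
      + (Complex.I * (dW h.s).ext p) • Complex.ofRealCLM.comp (theta0 p) := by
  refine ContinuousLinearMap.ext fun V => ?_
  rw [h.coframe_apply hp, SF.ext_of_ne _ hp]
  simp [mul_comm]

lemma dform_coframe {p : Heis} (hp : p ≠ 0) (V W : Heis) : dform (coframe θ) p V W =
    Complex.I * (fderiv ℝ (dW h.s).ext p V * theta0 p W - fderiv ℝ (dW h.s).ext p W * theta0 p V)
      + Complex.I * (dW h.s).val ⟨p, hp⟩ * (2 * (V.1.re * W.1.im - V.1.im * W.1.re)) := by
  have hb := ((dW h.s).differentiableAt_ext hp).hasFDerivAt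
  have key : ∀ W, HasFDerivAt (fun q => coframe θ q W)
      ((theta0 p W : ℂ) • (Complex.I • fderiv ℝ (dW h.s).ext p)
        + (Complex.I * (dW h.s).ext p) •
          (Complex.ofRealCLM.comp (theta0Deriv.flip W))) p := by
    intro W
    have h1 : HasFDerivAt (fun q => (theta0 q W : ℂ))
        (Complex.ofRealCLM.comp (theta0Deriv.flip W)) p := by
      refine Complex.ofRealCLM.hasFDerivAt.comp p ?_
      have := (hasFDerivAt_theta0 p).clm_apply (hasFDerivAt_const W p)
      simpa using this
    have h2 := (h1.mul (hb.const_mul Complex.I)).const_add W.1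
    refine h2.congr_of_eventuallyEq (eventuallyEq_of_compl_zero (fun q hq => ?_) hp)
    rw [h.coframe_apply hq, ← SF.ext_of_ne _ hq]
    rfl
  have hd : DifferentiableAt ℝ (coframe θ) p := by
    have : DifferentiableAt ℝ (fun q => ContinuousLinearMap.fst ℝ ℂ ℝ
        + (Complex.I * (dW h.s).ext q) • Complex.ofRealCLM.comp (theta0 q)) p :=
      (differentiableAt_const _).add ((hb.differentiableAt.const_mul Complex.I).smul
        ((differentiableAt_const _).clm_comp (hasFDerivAt_theta0 p).differentiableAt))
    exact this.congr_of_eventuallyEq (eventuallyEq_of_compl_zero (fun q hq => h.coframe_eq hq) hp)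
  have app : ∀ V W, fderiv ℝ (coframe θ) p V W = fderiv ℝ (fun q => coframe θ q W) p V := by
    intro V W
    have := (hd.hasFDerivAt.clm_apply (hasFDerivAt_const W p)).fderiv
    rw [this]; simp
  rw [dform, app, app, (key V).fderiv, (key W).fderiv, SF.ext_of_ne _ hp]
  simp [theta0Deriv_apply]
  ring

/-- The coefficient of `θ₀` in the connection form. -/
def connCoeff : SF := Complex.I • (dZ (dW h.s) + 2 * (dZ h.s * dW h.s))

/-- The connection form of `e^σ θ₀`. -/
def connForm (p : Heis) : Heis →L[ℝ] ℂ :=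
  (2 * (dZ h.s).ext p) • ContinuousLinearMap.fst ℝ ℂ ℝ
    - (dW h.s).ext p • Complex.conjCLE.toContinuousLinearMap.comp (ContinuousLinearMap.fst ℝ ℂ ℝ)
    + h.connCoeff.ext p • Complex.ofRealCLM.comp (theta0 p)

lemma connForm_apply (p V : Heis) : h.connForm p V =
    2 * (dZ h.s).ext p * V.1 - (dW h.s).ext p * star V.1 + h.connCoeff.ext p * theta0 p V := by
  simp [connForm]

/-- The torsion coefficient of `e^σ θ₀`. -/
def torsCoeff : SF := Complex.I • aTor dZ h.s

lemma conj_aTor : conj (aTor dZ h.s) = aTor dW h.s := by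
  simp only [aTor, map_sub, map_pow, ← dW_conj, h.conj_s]

lemma isConnectionAt {p : Heis} (hp : p ≠ 0) :
    IsConnectionAt θ p (h.connForm p) (h.torsCoeff.ext p) := by
  have hE : (Real.exp (σ p) : ℂ) ≠ 0 := by exact_mod_cast (Real.exp_pos _).ne'
  have hA : star (h.torsCoeff.ext p) = -Complex.I * ((dW (dW h.s)).ext p - (dW h.s).ext p ^ 2) := by
    rw [SF.ext_of_ne _ hp, ← conj_apply, torsCoeff, conj_smul, conj_aTor]
    simp [aTor, SF.ext_of_ne _ hp]
  have hb : star ((dW h.s).ext p) = (dZ h.s).ext p := by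
    rw [SF.ext_of_ne _ hp, SF.ext_of_ne _ hp]; exact h.star_dW _
  have ha : star ((dZ h.s).ext p) = (dW h.s).ext p := by rw [← hb, star_star]
  have hI : star Complex.I = -Complex.I := Complex.conj_I
  constructor
  · intro V W
    have e : (2 * ((V.1.re : ℂ) * W.1.im - V.1.im * W.1.re))
        = Complex.I * (V.1 * star W.1 - star V.1 * W.1) := by
      apply Complex.ext <;> (simp; try ring)
    rw [h.dform_coframe hp, e, h.levi_eq hp, hA, h.connForm_apply, h.connForm_apply,
      h.coframe_apply hp, h.coframe_apply hp, fderiv_frame _ p V, fderiv_frame _ p W,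
      ← dW_apply _ ⟨p, hp⟩, ← dZ_apply _ ⟨p, hp⟩, ← SF.ext_of_ne _ hp, ← SF.ext_of_ne _ hp,
      ← SF.ext_of_ne _ hp, h.eq p hp]
    simp only [star_add, star_mul', hI, hb, Complex.star_def, Complex.conj_ofReal, smul_apply,
      smul_eq_mul, Complex.ofReal_mul, connCoeff, SF.ext_smul, SF.ext_add, SF.ext_mul]
    have h2 : (2 : SF).ext p = 2 := by
      rw [SF.ext_of_ne _ hp]; rfl
    rw [h2]
    field_simp
    ring_nf
    simp only [Complex.I_sq]
    ring
  · intro V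
    have hd : (fderiv ℝ (levi θ) p V : ℂ) = Real.exp (σ p) * fderiv ℝ σ p V := by
      rw [(eventuallyEq_of_compl_zero (fun q hq => h.levi_eq hq) hp).fderiv_eq,
        fderiv_exp_comp (h.differentiableAt hp)]
      push_cast; rfl
    have hc : (dZ (dW h.s)).ext p = star ((dW (dZ h.s)).ext p) := by
      rw [SF.ext_of_ne _ hp, SF.ext_of_ne _ hp, ← conj_apply, ← dZ_conj, ← dW_conj, h.conj_s]
    -- The real part of the `θ₀`-coefficient of the connection is half the difference `i(ZZ̄σ -
    -- Z̄Zσ)`; the commutator relation turns it into the `∂ₜσ` part required by `dh`.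
    have hT : (dW (dZ h.s)).ext p = (dZ (dW h.s)).ext p + 2 * Complex.I * (dT h.s).ext p := by
      rw [dW_dZ, SF.ext_add, SF.ext_smul]
    have h2 : (2 : SF).ext p = 2 := by
      rw [SF.ext_of_ne _ hp]; rfl
    have hk : star ((dZ (dW h.s)).ext p) = (dW (dZ h.s)).ext p := by rw [hc, star_star]
    rw [hd, h.levi_eq hp, h.connForm_apply, h.fderiv_σ hp]
    simp only [← SF.ext_of_ne _ hp, connCoeff, SF.ext_smul, SF.ext_add, SF.ext_mul, h2, star_add,
      star_sub, star_mul', ha, hb, hI, hk, hT, Complex.star_def, Complex.conj_ofReal,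
      Complex.conj_conj, map_ofNat]
    ring_nf
    simp only [Complex.I_sq]
    ring

end IsExpForm

/-! ### Torsion, curvature and the operators of `e^σ θ₀` as elements of `SF`. -/

lemma ofReal_re_of_conj {f : SF} (hf : conj f = f) (p : Punctured) :
    ((f.val p).re : ℂ) = f.val p := by
  have := congrArg (fun g => g.val p) hf
  rw [conj_apply] at this
  exact Complex.conj_eq_iff_re.1 this

lemma rep_conj_eq {f : Heis → ℝ} {t : SF} (ht : Rep (fun q => (f q : ℂ)) t) : conj t = t :=
  SF.eq_of_forall fun p => by rw [conj_apply, ← ht p]; simp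

lemma two_re (f : SF) (p : Punctured) : ((2 * (f.val p).re : ℝ) : ℂ) = (f + conj f).val p := by
  rw [SF.val_add, conj_apply, Complex.star_def, Complex.add_conj]

namespace IsExpForm

variable {θ : Heis → Heis →L[ℝ] ℝ} {σ : Heis → ℝ} (h : IsExpForm θ σ)
include h

/-- Compatibility with `h` makes `η - η'` purely imaginary. The structure equation on `(X, Y)` says
that its value at `Y` is `i` times its value at `X`, so both values vanish; the equations on `(X,
∂ₜ)` and `(Y, ∂ₜ)` then involve the `∂ₜ`-component and the torsion with opposite relative signs, and
both differences are zero. -/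
lemma isConnectionAt_unique {p : Heis} (hp : p ≠ 0) {η η' : Heis →L[ℝ] ℂ} {A A' : ℂ}
    (H : IsConnectionAt θ p η A) (H' : IsConnectionAt θ p η' A') : η = η' ∧ A = A' := by
  have hE : (Real.exp (σ p) : ℂ) ≠ 0 := by exact_mod_cast (Real.exp_pos _).ne'
  set b := Complex.I * (dW h.s).val ⟨p, hp⟩ with hb
  have c1 : coframe θ p (X p) = 1 := by rw [h.coframe_apply hp, theta0_X]; simp [X]
  have c2 : coframe θ p (Y p) = Complex.I := by rw [h.coframe_apply hp, theta0_Y]; simp [Y]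
  have c3 : coframe θ p (0, 1) = b / 2 := by
    rw [h.coframe_apply hp, hb]; simp [theta0_apply]; ring
  have t1 : (θ p (X p) : ℂ) = 0 := by rw [h.eq p hp]; simp
  have t2 : (θ p (Y p) : ℂ) = 0 := by rw [h.eq p hp]; simp
  have t3 : (θ p (0, 1) : ℂ) = Real.exp (σ p) / 2 := by
    rw [h.eq p hp, smul_apply, smul_eq_mul, theta0_apply]; push_cast; simp; ring
  have hI : star Complex.I = -Complex.I := Complex.conj_I
  have re0 : ∀ V, (η V - η' V).re = 0 := by
    intro V
    have e := (H.2 V).trans (H'.2 V).symm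
    rw [h.levi_eq hp] at e
    have e := congrArg Complex.re (mul_left_cancel₀ hE e)
    simp at e
    simp; linarith
  have eXY := (H.1 (X p) (Y p)).symm.trans (H'.1 (X p) (Y p))
  have eXT := (H.1 (X p) (0, 1)).symm.trans (H'.1 (X p) (0, 1))
  have eYT := (H.1 (Y p) (0, 1)).symm.trans (H'.1 (Y p) (0, 1))
  rw [h.levi_eq hp] at eXY eXT eYT
  rw [c1, c2, t1, t2] at eXY
  rw [c1, c3, t1, t3] at eXT
  rw [c2, c3, t2, t3, hI] at eYT
  rw [star_one] at eXT
  have d : η (Y p) - η' (Y p) = Complex.I * (η (X p) - η' (X p)) := by linear_combination eXY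
  have dX0 : η (X p) - η' (X p) = 0 := by
    refine Complex.ext (re0 _) ?_
    have := congrArg Complex.re d
    rw [re0] at this
    rw [Complex.mul_re, Complex.I_re, Complex.I_im] at this
    rw [Complex.zero_im]
    linarith
  have dY0 : η (Y p) - η' (Y p) = 0 := by rw [d, dX0, mul_zero]
  have hinv : (Real.exp (σ p) : ℂ)⁻¹ * (Real.exp (σ p) / 2) = 1 / 2 := by field_simp
  have f1 : η (0, 1) - η' (0, 1) - (star A - star A') / 2 = 0 := by
    linear_combination eXT + b / 2 * dX0 + (star A - star A') * hinv
  have f2 : η (0, 1) - η' (0, 1) + (star A - star A') / 2 = 0 := by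
    linear_combination (-Complex.I) * eYT - Complex.I * b / 2 * dY0
      + (star A - star A') * Complex.I ^ 2 * hinv
      + (η (0, 1) - η' (0, 1) + (star A - star A') / 2) * Complex.I_sq
  have dT0 : η (0, 1) - η' (0, 1) = 0 := by linear_combination (f1 + f2) / 2
  have dA : star A = star A' := by linear_combination f2 - f1
  exact ⟨clm_ext_frame p (sub_eq_zero.1 dX0) (sub_eq_zero.1 dY0) (sub_eq_zero.1 dT0),
    star_injective dA⟩

lemma connection_spec {p : Heis} (hp : p ≠ 0) :
    omega θ p = h.connForm p ∧ torsion θ p = h.torsCoeff.ext p := by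
  have hex : ∃ q : (Heis →L[ℝ] ℂ) × ℂ, IsConnectionAt θ p q.1 q.2 :=
    ⟨(_, _), h.isConnectionAt hp⟩
  exact h.isConnectionAt_unique hp (Classical.epsilon_spec hex) (h.isConnectionAt hp)

lemma rep_torsion : Rep (torsion θ) h.torsCoeff := fun p => by
  rw [(h.connection_spec p.2).2, SF.ext_coe]

lemma omega_Zbar (p : Punctured) :
    (omega θ p (X p) + Complex.I * omega θ p (Y p)) / 2 = -(dW h.s).val p := by
  have hI : star Complex.I = -Complex.I := Complex.conj_I
  rw [(h.connection_spec p.2).1, h.connForm_apply, h.connForm_apply]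
  simp only [X, Y, theta0_apply, star_one, hI, SF.ext_coe]
  push_cast
  simp
  linear_combination ((dZ h.s).val p + (dW h.s).val p / 2) * Complex.I_sq

/-- Since `θ₀` vanishes on `X` and `Y`, the `θ₀`-part of the connection contributes only through
`dθ₀(X, Y)`, and no derivative of `connCoeff` appears. -/
lemma dform_omega (p : Punctured) : dform (omega θ) p (X p) (Y p) =
    Complex.I * (4 * (dW (dZ h.s) + dZ (dW h.s) + dZ h.s * dW h.s).val p) := by
  have key : ∀ W, HasFDerivAt (fun q => h.connForm q W)
      (W.1 • ((2 : ℂ) • fderiv ℝ (dZ h.s).ext p) - star W.1 • fderiv ℝ (dW h.s).ext p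
        + ((h.connCoeff.ext p) • Complex.ofRealCLM.comp (theta0Deriv.flip W)
          + (theta0 p W : ℂ) • fderiv ℝ h.connCoeff.ext p)) p := by
    intro W
    have h1 : HasFDerivAt (fun q => (theta0 q W : ℂ))
        (Complex.ofRealCLM.comp (theta0Deriv.flip W)) p.1 := by
      refine Complex.ofRealCLM.hasFDerivAt.comp p.1 ?_
      have := (hasFDerivAt_theta0 p).clm_apply (hasFDerivAt_const W p.1)
      simpa using this
    have ha := (((dZ h.s).differentiableAt_ext p.2).hasFDerivAt.const_mul 2).mul_const W.1
    have hb := ((dW h.s).differentiableAt_ext p.2).hasFDerivAt.mul_const (star W.1)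
    have hc := ((h.connCoeff).differentiableAt_ext p.2).hasFDerivAt.mul h1
    refine ((ha.sub hb).add hc).congr_of_eventuallyEq (Filter.Eventually.of_forall fun q => ?_)
    exact h.connForm_apply q W
  have hd : DifferentiableAt ℝ h.connForm p.1 := by
    have ha := ((dZ h.s).differentiableAt_ext p.2)
    have hb := ((dW h.s).differentiableAt_ext p.2)
    have hc := ((h.connCoeff).differentiableAt_ext p.2)
    exact (((ha.const_mul 2).smul (differentiableAt_const _)).sub
      (hb.smul (differentiableAt_const _))).add
      (hc.smul ((differentiableAt_const _).clm_comp (hasFDerivAt_theta0 p.1).differentiableAt))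
  have app : ∀ V W, fderiv ℝ (omega θ) p V W = fderiv ℝ (fun q => h.connForm q W) p V := by
    intro V W
    rw [(eventuallyEq_of_compl_zero (fun q hq => (h.connection_spec hq).1) p.2).fderiv_eq]
    have := (hd.hasFDerivAt.clm_apply (hasFDerivAt_const W p.1)).fderiv
    rw [this]; simp
  have hI : star Complex.I = -Complex.I := Complex.conj_I
  have a1 : fderiv ℝ (dZ h.s).ext p (X p) + Complex.I * fderiv ℝ (dZ h.s).ext p (Y p)
      = 2 * (dW (dZ h.s)).val p := by rw [dW_apply, Zbar]; ring
  have a2 : fderiv ℝ (dW h.s).ext p (X p) - Complex.I * fderiv ℝ (dW h.s).ext p (Y p)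
      = 2 * (dZ (dW h.s)).val p := by rw [dZ_apply, Z]; ring
  have hk : h.connCoeff.val p
      = Complex.I * ((dZ (dW h.s)).val p + 2 * ((dZ h.s).val p * (dW h.s).val p)) := rfl
  rw [dform, app, app, (key _).fderiv, (key _).fderiv]
  simp only [add_apply, sub_apply, smul_apply, ContinuousLinearMap.comp_apply, theta0_X, theta0_Y,
    ContinuousLinearMap.flip_apply, theta0Deriv_apply, smul_eq_mul, SF.ext_coe, hk,
    Complex.ofRealCLM_apply, Complex.ofReal_zero, zero_mul]
  have x1 : (X p).1 = 1 := rfl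
  have y1 : (Y p).1 = Complex.I := rfl
  rw [x1, y1, hI]
  simp only [SF.val_add, SF.val_mul, Complex.one_re, Complex.one_im, Complex.I_re, Complex.I_im,
    star_one]
  push_cast
  linear_combination 2 * Complex.I * a1 + Complex.I * a2
    - (2 * fderiv ℝ (dZ h.s).ext p (Y p) - fderiv ℝ (dW h.s).ext p (Y p)) * Complex.I_sq

lemma val_E' (p : Punctured) : h.E'.val p = (Real.exp (σ p) : ℂ)⁻¹ := by
  change ((Real.exp (-σ p) : ℝ) : ℂ) = _
  rw [Real.exp_neg]; push_cast; rfl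

lemma levi_inv (p : Punctured) : ((levi θ p)⁻¹ : ℂ) = h.E'.val p := by
  rw [h.levi_eq p.2, h.val_E']

/-- The scalar curvature of `e^σ θ₀` as an element of `SF`. -/
def scal : SF := aScal dZ dW h.s h.E'

lemma conj_scal : conj h.scal = h.scal := by
  simp only [scal, aScal, map_neg, map_mul, map_add, map_ofNat, h.conj_E', ← dZ_conj, ← dW_conj,
    h.conj_s]
  ring

lemma rep_scalarCurv : Rep (fun p => (scalarCurv θ p : ℂ)) h.scal := fun p => by
  have hw : h.scal.val p = -(2 * (((Real.exp (σ p))⁻¹ : ℝ)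
      * (dW (dZ h.s) + dZ (dW h.s) + dZ h.s * dW h.s).val p)) := by
    rw [Complex.ofReal_inv, ← h.val_E']; rfl
  have key : scalarCurv θ p = (h.scal.val p).re := by
    unfold scalarCurv
    rw [h.dform_omega, h.levi_eq p.2, hw, ← mul_assoc Complex.I, Complex.I_mul_I]
    generalize (dW (dZ h.s) + dZ (dW h.s) + dZ h.s * dW h.s).val p = w
    have hE : Real.exp (σ p) ≠ 0 := (Real.exp_pos _).ne'
    have e1 : (-1 * (4 * w)).re = -4 * w.re := by simp
    have e2 : (-(2 * (((Real.exp (σ p))⁻¹ : ℝ) * w))).re = -(2 * ((Real.exp (σ p))⁻¹ * w.re)) := by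
      simp [-Complex.ofReal_inv]
    rw [e1, e2]
    field_simp
    ring
  change ((scalarCurv θ p : ℝ) : ℂ) = _
  rw [key, ofReal_re_of_conj h.conj_scal]

lemma rep_div {τ : Heis → ℂ} {t : SF} (ht : Rep τ t) : Rep (div θ τ) (aDiv dW h.s h.E' t) :=
  fun p => by
    rw [div, h.omega_Zbar, h.levi_inv, ht.Zbar p, ht p]
    simp [aDiv]

lemma rep_gradUp {f : Heis → ℝ} {t : SF} (ht : Rep (fun q => (f q : ℂ)) t) :
    Rep (gradUp θ f) (h.E' * dW t) := fun p => by
  rw [gradUp, h.levi_inv, ht.Zbar p]; rfl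

lemma conj_aDiv (t : SF) : conj (aDiv dW h.s h.E' t) = aDiv dZ h.s h.E' (conj t) := by
  simp only [aDiv, map_mul, map_add, h.conj_E', ← dZ_conj, h.conj_s]

lemma rep_sublap {f : Heis → ℝ} {t : SF} (ht : Rep (fun q => (f q : ℂ)) t) :
    Rep (fun p => (sublap θ f p : ℂ)) (aLap dZ dW h.s h.E' t) := fun p => by
  have := h.rep_div ht.Z p
  simp only [sublap, grad]
  rw [this, two_re, h.conj_aDiv, ← dW_conj, rep_conj_eq ht]
  rfl

lemma rep_Wform : Rep (Wform θ) (aForm dZ dW h.s h.E') := fun p => by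
  have h1 := h.rep_scalarCurv.Z p
  have h2 := h.rep_torsion.Zbar p
  have h3 := h.omega_Zbar p
  have h4 : (omega θ p (X p) + Complex.I * omega θ p (Y p)) = -(2 * (dW h.s).val p) := by
    linear_combination 2 * h3
  have e : (2 : SF).val p = 2 := rfl
  rw [Wform, grad, h1, h2, h4, h.levi_inv, h.rep_torsion p, aForm, torsCoeff,
    Derivation.map_smul]
  simp only [SF.val_add, SF.val_mul, SF.val_smul, e, scal]
  linear_combination (-h.E'.val p * ((dW (aTor dZ h.s)).val p
    + 2 * (dW h.s).val p * (aTor dZ h.s).val p)) * Complex.I_sq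

end IsExpForm

/-- Real functions `v` with `Z̄Z̄Z v = 0`. -/
def IsPH (v : SF) : Prop := conj v = v ∧ dW (dW (dZ v)) = 0

lemma IsPH.isPair {v : SF} (hv : IsPH v) : IsPair dZ dW v (dW (dZ v)) (dZ (dW v)) := by
  have h1 : dZ (dZ (dW v)) = 0 := by
    rw [← hv.1, dW_conj, dZ_conj, dZ_conj, hv.2, map_zero]
  refine ⟨rfl, rfl, hv.2, h1, ?_, ?_⟩
  · rw [dW_dZ_dZ, h1, sub_zero, two_smul, two_mul]
  · rw [dZ_dW_dW, hv.2, sub_zero, two_smul, two_mul]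

lemma IsPH.add {v w : SF} (hv : IsPH v) (hw : IsPH w) : IsPH (v + w) :=
  ⟨by rw [map_add, hv.1, hw.1], by simp only [map_add, hv.2, hw.2, add_zero]⟩

lemma IsPH.neg {v : SF} (hv : IsPH v) : IsPH (-v) :=
  ⟨by rw [map_neg, hv.1], by simp only [map_neg, hv.2, neg_zero]⟩

lemma IsPH.sub {v w : SF} (hv : IsPH v) (hw : IsPH w) : IsPH (v - w) := by
  rw [sub_eq_add_neg]; exact hv.add hw.neg

lemma isPH_const (c : ℝ) : IsPH (algebraMap ℂ SF c) := by
  refine ⟨?_, by rw [Derivation.map_algebraMap, map_zero, map_zero]⟩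
  rw [Algebra.algebraMap_eq_smul_one, conj_smul, map_one]
  simp

/-! ### The pseudo-Einstein condition and the conformal formulas for `P₄'` and `Q₄'`. -/

namespace IsExpForm

variable {θ : Heis → Heis →L[ℝ] ℝ} {σ : Heis → ℝ} (h : IsExpForm θ σ)
include h

/-- By `aForm_eq` the form `W₁` is a nowhere zero multiple of `ZZZ̄σ`, which is the conjugate of
`Z̄Z̄Zσ` because `σ` is real. -/
lemma isPseudoEinstein_iff : IsPseudoEinstein θ ↔ IsPH h.s := by
  have h1 := aForm_eq h.E_mul_E' h.dZ_E' (W := dW)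
    (by rw [dW_dZ_dZ, two_smul, two_mul])
  have h2 : dW (dW (dZ h.s)) = conj (dZ (dZ (dW h.s))) := by
    rw [← dW_conj, ← dW_conj, ← dZ_conj, h.conj_s]
  have h3 : IsPseudoEinstein θ ↔ aForm dZ dW h.s h.E' = 0 := by
    refine ⟨fun H => SF.eq_of_forall fun p => ?_, fun H p hp => ?_⟩
    · rw [← h.rep_Wform p, H p p.2]; rfl
    · rw [h.rep_Wform ⟨p, hp⟩, H]; rfl
  rw [h3]
  constructor
  · intro H
    rw [H, mul_zero] at h1
    have h4 : dZ (dZ (dW h.s)) = 0 := by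
      have : (-(1 / 3 : ℂ)) • (-(3 * dZ (dZ (dW h.s)))) = dZ (dZ (dW h.s)) := by
        rw [show (3 : SF) * dZ (dZ (dW h.s)) = (3 : ℂ) • dZ (dZ (dW h.s)) by
          rw [Algebra.smul_def, map_ofNat]]
        module
      rw [← this, ← h1, smul_zero]
    exact ⟨h.conj_s, by rw [h2, h4, map_zero]⟩
  · intro H
    rw [H.isPair.Z_k', mul_zero, neg_zero] at h1
    have : h.E' * (h.E * aForm dZ dW h.s h.E') = aForm dZ dW h.s h.E' := by
      rw [← mul_assoc, mul_comm h.E', h.E_mul_E', one_mul]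
    rw [← this, h1, mul_zero]

lemma rep_Qprime : Rep (fun p => (Qprime θ p : ℂ)) (aQ dZ dW h.s h.E') := fun p => by
  have h1 : ((sublap θ (scalarCurv θ) p : ℝ) : ℂ) = _ := h.rep_sublap h.rep_scalarCurv p
  have h2 : ((scalarCurv θ p : ℝ) : ℂ) = _ := h.rep_scalarCurv p
  have h3 : ((‖torsion θ p‖ : ℝ) : ℂ) ^ 2 = (aTor dZ h.s).val p * (aTor dW h.s).val p := by
    rw [h.rep_torsion p, torsCoeff, SF.val_smul, norm_mul, Complex.norm_I, one_mul,
      ← h.conj_aTor, conj_apply, Complex.star_def, Complex.mul_conj, Complex.normSq_eq_norm_sq]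
    push_cast; rfl
  have e2 : (2 : SF).val p = 2 := rfl
  have e4 : (4 : SF).val p = 4 := rfl
  simp only [Qprime]
  push_cast
  rw [h1, h2, mul_pow, h3, h.levi_inv]
  simp only [aQ, SF.val_add, SF.val_sub, SF.val_neg, SF.val_mul, SF.val_pow, e2, e4, scal]
  ring

lemma rep_Pprime (hW : IsPseudoEinstein θ) {f : Heis → ℝ} {t : SF}
    (ht : Rep (fun q => (f q : ℂ)) t) :
    Rep (fun p => (Pprime θ f p : ℂ)) (aP dZ dW h.s h.E' t) := fun p => by
  have hct := rep_conj_eq ht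
  have h1 : ((sublap θ (sublap θ f) p : ℝ) : ℂ) = _ := h.rep_sublap (h.rep_sublap ht) p
  have r2 : Rep (fun q => torsion θ q * gradUp θ f q) (h.torsCoeff * (h.E' * dW t)) := fun q => by
    change torsion θ q * gradUp θ f q = _
    rw [h.rep_torsion q, h.rep_gradUp ht q]; rfl
  have r3 : Rep (fun q => (scalarCurv θ q : ℂ) * grad f q) (h.scal * dZ t) := fun q => by
    have hs : ((scalarCurv θ q : ℝ) : ℂ) = _ := h.rep_scalarCurv q
    change (scalarCurv θ q : ℂ) * grad f q = _
    rw [hs, grad, ht.Z q]; rfl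
  have h2 := h.rep_div r2 p
  have h3 := h.rep_div r3 p
  have hW0 : Rep (Wform θ) 0 := fun q => hW q q.2
  have h4 := h.rep_div hW0 p
  have e2 : (2 : SF).val p = 2 := rfl
  have e4 : (4 : SF).val p = 4 := rfl
  have h4' : div θ (Wform θ) p = 0 := by rw [h4]; simp [aDiv]
  have h2' : aDiv dW h.s h.E' (h.torsCoeff * (h.E' * dW t))
      = Complex.I • aDiv dW h.s h.E' (aTor dZ h.s * (h.E' * dW t)) := by
    simp only [aDiv, torsCoeff, smul_mul_assoc, Derivation.map_smul, mul_smul_comm, ← smul_add]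
  -- The torsion is `i` times `aTor`, so the imaginary part in `P₄'` is the real part of the
  -- expression without `i`.
  have im_eq : ∀ x : SF, ((((Complex.I • x).val p).im : ℝ) : ℂ) * 2 = (x + conj x).val p := by
    intro x
    rw [← two_re]
    simp [mul_comm]
  have re_eq : ∀ x : SF, (((x.val p).re : ℝ) : ℂ) * 2 = (x + conj x).val p := by
    intro x
    rw [← two_re]
    simp [mul_comm]
  have c2 : conj (aDiv dW h.s h.E' (aTor dZ h.s * (h.E' * dW t)))
      = aDiv dZ h.s h.E' (aTor dW h.s * (h.E' * dZ t)) := by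
    rw [h.conj_aDiv, map_mul, map_mul, h.conj_aTor, h.conj_E', ← dZ_conj, hct]
  have c3 : conj (aDiv dW h.s h.E' (h.scal * dZ t)) = aDiv dZ h.s h.E' (h.scal * dW t) := by
    rw [h.conj_aDiv, map_mul, h.conj_scal, ← dW_conj, hct]
  have i2 := im_eq (aDiv dW h.s h.E' (aTor dZ h.s * (h.E' * dW t)))
  have i3 := re_eq (aDiv dW h.s h.E' (h.scal * dZ t))
  rw [c2] at i2
  rw [c3] at i3
  have hsc : aScal dZ dW h.s h.E' = h.scal := rfl
  simp only [Pprime]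
  rw [hW p p.2, h4', h2, h3, h2']
  push_cast
  rw [h1]
  simp only [aP, SF.val_sub, SF.val_mul, e2, e4, hsc, zero_mul, Complex.zero_re,
    Complex.ofReal_zero, mul_zero]
  linear_combination (-4) * i2 - 2 * i3

/-- `e^{2σ} P₄' f = 4 ΔΔ f + 4 ZZ̄Z̄Z(σ f)` for pluriharmonic `f`. -/
lemma exp_mul_Pprime (hW : IsPseudoEinstein θ) {f : Heis → ℝ} {t : SF}
    (ht : Rep (fun q => (f q : ℂ)) t) (hpt : IsPH t) (p : Punctured) :
    ((Pprime θ f p * Real.exp (2 * σ p) : ℝ) : ℂ)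
      = (4 * aBi dZ dW t + 4 * aPan dZ dW (h.s * t)).val p := by
  rw [← aP_eq h.E_mul_E' h.dZ_E' h.dW_E' (h.isPseudoEinstein_iff.1 hW).isPair hpt.isPair,
    SF.val_mul, ← h.rep_Pprime hW ht p, two_mul, Real.exp_add]
  push_cast
  rw [SF.val_pow, show h.E.val p = (Real.exp (σ p) : ℂ) from rfl]
  push_cast
  ring

/-- `e^{2σ} Q₄' = 4 ΔΔ σ + 2 ZZ̄Z̄Z(σ²)`. -/
lemma exp_mul_Qprime (hW : IsPseudoEinstein θ) (p : Punctured) :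
    ((Qprime θ p * Real.exp (2 * σ p) : ℝ) : ℂ)
      = (4 * aBi dZ dW h.s + 2 * aPan dZ dW (h.s * h.s)).val p := by
  rw [← aQ_eq h.E_mul_E' h.dZ_E' h.dW_E' (h.isPseudoEinstein_iff.1 hW).isPair,
    SF.val_mul, ← h.rep_Qprime p, two_mul, Real.exp_add]
  push_cast
  rw [SF.val_pow, show h.E.val p = (Real.exp (σ p) : ℂ) from rfl]
  push_cast
  ring

end IsExpForm

/-! ### The gauge and the dilations -/

lemma rho_nonneg (p : Heis) : 0 ≤ rho p := by unfold rho; positivity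

lemma rho_pow_four (p : Heis) : rho p ^ 4 = ‖p.1‖ ^ 4 + p.2 ^ 2 := by
  rw [rho, ← Real.rpow_natCast, ← Real.rpow_mul (by positivity)]
  norm_num

lemma rho_pos {p : Heis} (hp : p ≠ 0) : 0 < rho p := by
  unfold rho
  refine Real.rpow_pos_of_pos ?_ _
  by_contra hcon
  have h1 : ‖p.1‖ ^ 4 = 0 := by nlinarith [sq_nonneg p.2, pow_nonneg (norm_nonneg p.1) 4]
  have h2 : p.2 ^ 2 = 0 := by nlinarith [sq_nonneg p.2, pow_nonneg (norm_nonneg p.1) 4]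
  exact hp (Prod.ext (by simpa using h1) (by simpa using h2))

lemma rho_zero : rho 0 = 0 := by simp [rho]

lemma continuous_rho : Continuous rho := by
  unfold rho
  exact Continuous.rpow_const (by fun_prop) fun _ => Or.inr (by norm_num)

lemma rho_dil {c : ℝ} (hc : 0 < c) (p : Heis) : rho (dil c p) = c * rho p := by
  have h : rho (dil c p) ^ 4 = (c * rho p) ^ 4 := by
    rw [mul_pow, rho_pow_four, rho_pow_four, dil, norm_smul, Real.norm_of_nonneg hc.le]
    ring
  exact (pow_left_inj₀ (rho_nonneg _) (mul_nonneg hc.le (rho_nonneg p)) (by norm_num)).1 h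

lemma dil_dil (c d : ℝ) (p : Heis) : dil c (dil d p) = dil (c * d) p := by
  simp [dil, mul_pow, mul_assoc]

@[simp] lemma dil_one (p : Heis) : dil 1 p = p := by simp [dil]

lemma dil_inv_dil {c : ℝ} (hc : c ≠ 0) (p : Heis) : dil c⁻¹ (dil c p) = p := by
  rw [dil_dil, inv_mul_cancel₀ hc, dil_one]

lemma dil_dil_inv {c : ℝ} (hc : c ≠ 0) (p : Heis) : dil c (dil c⁻¹ p) = p := by
  rw [dil_dil, mul_inv_cancel₀ hc, dil_one]

lemma dil_ne_zero {c : ℝ} (hc : c ≠ 0) {p : Heis} (hp : p ≠ 0) : dil c p ≠ 0 := fun h => by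
  apply hp
  rw [← dil_inv_dil hc p, h]; simp [dil]

/-- The dilation as a linear map. -/
def dilL (c : ℝ) : Heis →L[ℝ] Heis :=
  (c • ContinuousLinearMap.id ℝ ℂ).prodMap (c ^ 2 • ContinuousLinearMap.id ℝ ℝ)

lemma dilL_apply (c : ℝ) (p : Heis) : dilL c p = dil c p := rfl

lemma contDiff_dil (c : ℝ) : ContDiff ℝ ∞ (dil c) := (dilL c).contDiff

/-- The exponent is the homogeneous dimension: `c²` from the plane and `c²` from the vertical line.
It is the reason why densities of degree `-4` have well-defined integrals over the quotient. -/
lemma det_dilL (c : ℝ) : LinearMap.det (dilL c : Heis →ₗ[ℝ] Heis) = c ^ 4 := by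
  have : (dilL c : Heis →ₗ[ℝ] Heis)
      = (c • LinearMap.id : ℂ →ₗ[ℝ] ℂ).prodMap (c ^ 2 • LinearMap.id : ℝ →ₗ[ℝ] ℝ) := rfl
  rw [this, LinearMap.det_prodMap, LinearMap.det_smul, LinearMap.det_smul]
  simp [Complex.finrank_real_complex]
  ring

instance : (volume : Measure Heis).IsAddHaarMeasure :=
  inferInstanceAs ((volume : Measure ℂ).prod (volume : Measure ℝ)).IsAddHaarMeasure

lemma map_dil_volume {c : ℝ} (hc : 0 < c) : Measure.map (dil c) (volume : Measure Heis)
    = ENNReal.ofReal (c ^ 4)⁻¹ • (volume : Measure Heis) := by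
  have h := Measure.map_linearMap_addHaar_eq_smul_addHaar (volume : Measure Heis)
    (f := (dilL c : Heis →ₗ[ℝ] Heis)) (by rw [det_dilL]; positivity)
  rw [det_dilL, abs_of_pos (by positivity)] at h
  exact h

/-- The dilation as a homeomorphism. -/
def dilHomeo {c : ℝ} (hc : c ≠ 0) : Heis ≃ₜ Heis where
  toFun := dil c
  invFun := dil c⁻¹
  left_inv := dil_inv_dil hc
  right_inv := dil_dil_inv hc
  continuous_toFun := (contDiff_dil c).continuous
  continuous_invFun := (contDiff_dil c⁻¹).continuous

lemma integral_comp_dil {F : Type*} [NormedAddCommGroup F] [NormedSpace ℝ F] {c : ℝ} (hc : 0 < c)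
    (f : Heis → F) : ∫ p, f (dil c p) = (c ^ 4)⁻¹ • ∫ p, f p := by
  have h : ∫ p, f p ∂(Measure.map (dil c) (volume : Measure Heis)) = ∫ p, f (dil c p) :=
    (dilHomeo hc.ne').measurableEmbedding.integral_map f
  rw [← h, map_dil_volume hc, integral_smul_measure,
    ENNReal.toReal_ofReal (by positivity)]

/-! ### Annuli -/

/-- The annulus `a ≤ ρ < b`. -/
def annulus (a b : ℝ) : Set Heis := {p | a ≤ rho p ∧ rho p < b}

lemma measurableSet_annulus (a b : ℝ) : MeasurableSet (annulus a b) :=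
  (measurableSet_le measurable_const continuous_rho.measurable).inter
    (measurableSet_lt continuous_rho.measurable measurable_const)

lemma isCompact_closedAnnulus (a b : ℝ) : IsCompact {p : Heis | a ≤ rho p ∧ rho p ≤ b} := by
  refine Metric.isCompact_of_isClosed_isBounded
    ((isClosed_le continuous_const continuous_rho).inter
      (isClosed_le continuous_rho continuous_const)) ?_
  refine (Metric.isBounded_iff_subset_closedBall 0).2 ⟨max b (b ^ 2), fun p hp => ?_⟩
  have hb : rho p ≤ b := hp.2
  have h0 := rho_nonneg p
  have h4 := rho_pow_four p
  have h1 : ‖p.1‖ ≤ b := by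
    refine le_trans ?_ hb
    refine le_of_pow_le_pow_left₀ (n := 4) (by norm_num) h0 ?_
    nlinarith [sq_nonneg p.2]
  have h2 : ‖p.2‖ ≤ b ^ 2 := by
    have : ‖p.2‖ ≤ rho p ^ 2 := by
      refine abs_le_of_sq_le_sq ?_ (by positivity)
      nlinarith [pow_nonneg (norm_nonneg p.1) 4]
    exact this.trans (pow_le_pow_left₀ h0 hb 2)
  rw [mem_closedBall_zero_iff, Prod.norm_def]
  exact max_le_max h1 h2

lemma annulus_subset {a : ℝ} (ha : 0 < a) (b : ℝ) :
    {p : Heis | a ≤ rho p ∧ rho p ≤ b} ⊆ {0}ᶜ := by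
  rintro p ⟨h, -⟩ rfl
  rw [rho_zero] at h
  exact absurd h (not_le.2 ha)

lemma integrableOn_annulus {F : Type*} [NormedAddCommGroup F] {g : Heis → F}
    (hg : ContinuousOn g {0}ᶜ) {a : ℝ} (ha : 0 < a) (b : ℝ) : IntegrableOn g (annulus a b) :=
  ((hg.mono (annulus_subset ha b)).integrableOn_compact (isCompact_closedAnnulus a b)).mono_set
    fun _ hp => ⟨hp.1, hp.2.le⟩

lemma dil_mem_annulus {c a b : ℝ} (hc : 0 < c) {p : Heis} :
    dil c p ∈ annulus (c * a) (c * b) ↔ p ∈ annulus a b := by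
  simp only [annulus, Set.mem_ofPred_eq, rho_dil hc, mul_le_mul_iff_right₀ hc,
    mul_lt_mul_iff_right₀ hc]

lemma setIntegral_annulus_dil {F : Type*} [NormedAddCommGroup F] [NormedSpace ℝ F] {c : ℝ}
    (hc : 0 < c) (a b : ℝ) (f : Heis → F) :
    ∫ p in annulus a b, f (dil c p) = (c ^ 4)⁻¹ • ∫ p in annulus (c * a) (c * b), f p := by
  rw [← integral_indicator (measurableSet_annulus _ _),
    ← integral_indicator (measurableSet_annulus _ _), ← integral_comp_dil hc]
  congr 1
  funext p
  by_cases hp : p ∈ annulus a b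
  · rw [Set.indicator_of_mem hp, Set.indicator_of_mem ((dil_mem_annulus hc).2 hp)]
  · rw [Set.indicator_of_notMem hp, Set.indicator_of_notMem (mt (dil_mem_annulus hc).1 hp)]

/-! ### Stokes' theorem on the annulus -/

lemma integral_fderiv_eq_zero {H : Heis → ℂ} (hH : ContDiff ℝ ∞ H) (hc : HasCompactSupport H)
    (v : Heis) : ∫ p, fderiv ℝ H p v = 0 := by
  have hd : ContDiff ℝ ∞ (fun p => fderiv ℝ H p v) :=
    (hH.fderiv_right (m := ∞) le_rfl).clm_apply contDiff_const
  have h1 : Integrable (fun p => fderiv ℝ H p v) :=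
    hd.continuous.integrable_of_hasCompactSupport (hc.fderiv_apply (𝕜 := ℝ) v)
  have h2 : Integrable H := hH.continuous.integrable_of_hasCompactSupport hc
  have := integral_mul_fderiv_eq_neg_fderiv_mul_of_integrable (μ := (volume : Measure Heis))
    (f := fun _ => (1 : ℂ)) (g := H) (v := v) (by simp) (by simpa using h1) (by simpa using h2)
    (fun x _ => differentiableAt_const _) (fun x _ => hH.differentiable (by simp) x)
  simpa using this

/-- As `l` does not depend on `t`, `l ∂ₜH = ∂ₜ(lH)`, so the field is divergence free. -/
lemma integral_fderiv_shear {H : Heis → ℂ} (hH : ContDiff ℝ ∞ H) (hc : HasCompactSupport H)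
    (v : Heis) (l : Heis →L[ℝ] ℝ) (hl : l (0, 1) = 0) :
    ∫ p, fderiv ℝ H p (v + l p • ((0, 1) : Heis)) = 0 := by
  set H' : Heis → ℂ := fun p => (l p : ℂ) * H p with hH'
  have hs : ContDiff ℝ ∞ H' := (Complex.ofRealCLM.comp l).contDiff.mul hH
  have hc' : HasCompactSupport H' := hc.mul_left
  have e : ∀ p, fderiv ℝ H p (v + l p • ((0, 1) : Heis))
      = fderiv ℝ H p v + fderiv ℝ H' p (0, 1) := by
    intro p
    have h1 : HasFDerivAt (fun p : Heis => (l p : ℂ)) (Complex.ofRealCLM.comp l) p :=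
      (Complex.ofRealCLM.comp l).hasFDerivAt
    have h2 : HasFDerivAt H' _ p := h1.mul (hH.differentiable (by simp) p).hasFDerivAt
    rw [h2.fderiv, map_add, map_smul]
    simp [hl]
  simp_rw [e]
  have i1 : ∀ {G : Heis → ℂ}, ContDiff ℝ ∞ G → HasCompactSupport G → ∀ v : Heis,
      Integrable (fun p => fderiv ℝ G p v) := fun hG hcG v =>
    (((hG.fderiv_right (m := ∞) le_rfl).clm_apply contDiff_const).continuous
      ).integrable_of_hasCompactSupport (hcG.fderiv_apply (𝕜 := ℝ) v)
  rw [integral_add (i1 hH hc _) (i1 hs hc' _), integral_fderiv_eq_zero hH hc,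
    integral_fderiv_eq_zero hs hc', add_zero]

/-- A vector field that is homogeneous under dilations and divergence free. -/
structure IsHomField (V : Heis → Heis) : Prop where
  smooth : ContDiff ℝ ∞ V
  dil : ∀ (c : ℝ) (p : Heis), dil c (V p) = c • V (dil c p)
  integral_eq_zero : ∀ {H : Heis → ℂ}, ContDiff ℝ ∞ H → HasCompactSupport H →
    ∫ p, fderiv ℝ H p (V p) = 0

lemma isHomField_X : IsHomField X where
  smooth := contDiff_X
  dil c p := by simp [X, HeisCR.dil]; ring
  integral_eq_zero {H} hH hc := by
    have := integral_fderiv_shear hH hc (1, 0)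
      ((2 : ℝ) • Complex.imCLM.comp (ContinuousLinearMap.fst ℝ ℂ ℝ)) (by simp)
    refine Eq.trans (integral_congr_ae (Filter.Eventually.of_forall fun p => ?_)) this
    simp [X]

lemma isHomField_Y : IsHomField Y where
  smooth := contDiff_Y
  dil c p := by simp [Y, HeisCR.dil]; ring
  integral_eq_zero {H} hH hc := by
    have := integral_fderiv_shear hH hc (Complex.I, 0)
      ((-2 : ℝ) • Complex.reCLM.comp (ContinuousLinearMap.fst ℝ ℂ ℝ)) (by simp)
    refine Eq.trans (integral_congr_ae (Filter.Eventually.of_forall fun p => ?_)) this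
    simp [Y]

/-- A smooth cutoff that vanishes for `ρ ≤ a` and equals `1` for `ρ ≥ b`. -/
def cutoff (a b : ℝ) (p : Heis) : ℝ :=
  Real.smoothTransition ((‖p.1‖ ^ 4 + p.2 ^ 2 - a ^ 4) / (b ^ 4 - a ^ 4))

lemma contDiff_cutoff (a b : ℝ) : ContDiff ℝ ∞ (cutoff a b) := by
  have h1 : ContDiff ℝ ∞ (fun p : Heis => ‖p.1‖ ^ 2) := contDiff_fst.norm_sq ℝ
  have h2 : (fun p : Heis => ‖p.1‖ ^ 4 + p.2 ^ 2) = fun p => (‖p.1‖ ^ 2) ^ 2 + p.2 ^ 2 := by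
    funext p; ring
  have h3 : ContDiff ℝ ∞ (fun p : Heis => ‖p.1‖ ^ 4 + p.2 ^ 2) := by
    rw [h2]; exact (h1.pow 2).add (contDiff_snd.pow 2)
  exact Real.smoothTransition.contDiff.comp ((h3.sub contDiff_const).div_const _)

lemma cutoff_eq_zero {a b : ℝ} (ha : 0 < a) (hab : a < b) {p : Heis} (hp : rho p ≤ a) :
    cutoff a b p = 0 := by
  refine Real.smoothTransition.zero_of_nonpos (div_nonpos_of_nonpos_of_nonneg ?_ ?_)
  · rw [← rho_pow_four, sub_nonpos]
    exact pow_le_pow_left₀ (rho_nonneg p) hp 4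
  · rw [sub_nonneg]
    exact pow_le_pow_left₀ ha.le hab.le 4

lemma cutoff_eq_one {a b : ℝ} (ha : 0 < a) (hab : a < b) {p : Heis} (hp : b ≤ rho p) :
    cutoff a b p = 1 := by
  have h : a ^ 4 < b ^ 4 := pow_lt_pow_left₀ hab ha.le (by norm_num)
  refine Real.smoothTransition.one_of_one_le ((one_le_div (sub_pos.2 h)).2 ?_)
  rw [← rho_pow_four]
  have := pow_le_pow_left₀ (ha.le.trans hab.le) hp 4
  linarith

/-- This is Stokes' theorem on the quotient by `δ_R`. The function `f` is cut off to a compactly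
supported `H` whose translates under the group add up to `f`; then `∫ VH = 0` unfolds to the
integral of `Vf` over one fundamental annulus. -/
lemma setIntegral_annulus_eq_zero_of_one_lt {V : Heis → Heis} (hV : IsHomField V) {a R : ℝ}
    (ha : 0 < a) (hR : 1 < R) (f : SF)
    (hf : ∀ p, p ≠ 0 → f.ext (dil R p) = (R ^ 3 : ℝ)⁻¹ * f.ext p) :
    ∫ p in annulus a (R * a), fderiv ℝ f.ext p (V p) = 0 := by
  have hR0 : 0 < R := by linarith
  have haR : a < R * a := by nlinarith
  obtain ⟨a₁, ha₁, ha₁'⟩ := exists_between haR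
  obtain ⟨b₁, hb₁, hb₁'⟩ := exists_between ha₁'
  have ha₁0 : 0 < a₁ := ha.trans ha₁
  set G : Heis → ℂ := fun p => (cutoff a₁ b₁ p : ℂ) * f.ext p with hG
  have near_zero : ∀ {p}, rho p < a₁ → G =ᶠ[𝓝 p] 0 := by
    intro p hp
    filter_upwards [continuous_rho.continuousAt.eventually_lt continuousAt_const hp] with q hq
    simp [hG, cutoff_eq_zero ha₁0 hb₁ (le_of_lt hq)]
  have far : ∀ {p}, b₁ < rho p → G =ᶠ[𝓝 p] f.ext := by
    intro p hp
    filter_upwards [continuousAt_const.eventually_lt continuous_rho.continuousAt hp] with q hq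
    simp [hG, cutoff_eq_one ha₁0 hb₁ (le_of_lt hq)]
  have hGs : ContDiff ℝ ∞ G := by
    rw [contDiff_iff_contDiffAt]
    intro p
    by_cases hp : p = 0
    · have : rho p < a₁ := by rw [hp, rho_zero]; exact ha₁0
      exact contDiffAt_const.congr_of_eventuallyEq (near_zero this)
    · exact (Complex.ofRealCLM.contDiff.contDiffAt.comp p
        (contDiff_cutoff a₁ b₁).contDiffAt).mul (f.contDiffAt_ext hp)
  have hGd : Differentiable ℝ G := hGs.differentiable (by simp)
  set k : Heis → ℂ := fun p => fderiv ℝ G p (V p) with hk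
  have hkc : Continuous k := ((hGs.fderiv_right (m := ∞) le_rfl).clm_apply hV.smooth).continuous
  set D : Heis → ℂ := fun p => fderiv ℝ f.ext p (V p) with hD
  have hDc : ContinuousOn D {0}ᶜ := (contDiffOn_fderiv_apply f.contDiffOn_ext hV.smooth).continuousOn
  have k_zero : ∀ {p}, rho p < a₁ → k p = 0 := fun hp => by
    simp [hk, (near_zero hp).fderiv_eq]
  have k_far : ∀ {p}, b₁ < rho p → k p = D p := fun hp => by
    simp only [hk, hD, (far hp).fderiv_eq]
  have hVi : ∀ p, dil R⁻¹ (V p) = R⁻¹ • V (dil R⁻¹ p) := fun p => hV.dil _ p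
  have hcomp : ∀ (g : Heis → ℂ) (p : Heis), DifferentiableAt ℝ g (dil R⁻¹ p) →
      HasFDerivAt (fun q => g (dil R⁻¹ q)) ((fderiv ℝ g (dil R⁻¹ p)).comp (dilL R⁻¹)) p :=
    fun g p hg => hg.hasFDerivAt.comp p (dilL R⁻¹).hasFDerivAt
  have hD_dil : ∀ {p}, p ≠ 0 → D p = ((R ^ 4 : ℝ)⁻¹ : ℝ) • D (dil R⁻¹ p) := by
    intro p hp
    have hq : dil R⁻¹ p ≠ 0 := dil_ne_zero (inv_ne_zero hR0.ne') hp
    have e : f.ext =ᶠ[𝓝 p] fun q => (((R ^ 3)⁻¹ : ℝ) : ℂ) * f.ext (dil R⁻¹ q) :=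
      eventuallyEq_of_compl_zero (fun q hq => by
        have := hf (dil R⁻¹ q) (dil_ne_zero (inv_ne_zero hR0.ne') hq)
        rwa [dil_dil_inv hR0.ne'] at this) hp
    have h1 := (hcomp f.ext p (f.differentiableAt_ext hq)).const_mul (((R ^ 3)⁻¹ : ℝ) : ℂ)
    simp only [hD]
    rw [e.fderiv_eq, h1.fderiv]
    simp only [smul_apply, ContinuousLinearMap.comp_apply, dilL_apply, hVi, map_smul,
      Complex.real_smul, smul_eq_mul]
    push_cast
    have : (R : ℂ) ≠ 0 := by exact_mod_cast hR0.ne'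
    field_simp
  -- Homogeneity of degree `-3` makes `H` equal to `(χ - χ ∘ δ_{1/R}) f` off the origin, with `χ`
  -- the cutoff; it vanishes near the origin and wherever both cutoffs equal one.
  set H : Heis → ℂ := fun p => G p - (((R ^ 3)⁻¹ : ℝ) : ℂ) * G (dil R⁻¹ p) with hH
  have hHs : ContDiff ℝ ∞ H := hGs.sub (contDiff_const.mul (hGs.comp (contDiff_dil R⁻¹)))
  have rho_inv : ∀ p, rho (dil R⁻¹ p) = R⁻¹ * rho p := fun p => rho_dil (inv_pos.2 hR0) p
  have lt_iff : ∀ p c, R⁻¹ * rho p < c ↔ rho p < R * c := fun p c => by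
    rw [inv_mul_lt_iff₀ hR0]
  have hHc : HasCompactSupport H := by
    refine HasCompactSupport.intro (isCompact_closedAnnulus a (R * (R * a))) fun p hp => ?_
    have hp' : rho p < a ∨ R * (R * a) < rho p := by
      by_contra hcon
      push Not at hcon
      exact hp hcon
    rcases hp' with hp' | hp'
    · have h1 : rho p < a₁ := hp'.trans ha₁
      have h2 : rho (dil R⁻¹ p) < a₁ := by
        rw [rho_inv, lt_iff]; nlinarith
      simp [hH, (near_zero h1).eq_of_nhds, (near_zero h2).eq_of_nhds]
    · have h2 : b₁ < rho (dil R⁻¹ p) := by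
        rw [rho_inv, lt_inv_mul_iff₀ hR0]; nlinarith
      have h1 : b₁ < rho p := by nlinarith
      have hp0 : p ≠ 0 := by rintro rfl; rw [rho_zero] at h1; linarith
      have := hf (dil R⁻¹ p) (dil_ne_zero (inv_ne_zero hR0.ne') hp0)
      rw [dil_dil_inv hR0.ne'] at this
      simp only [hH, (far h1).eq_of_nhds, (far h2).eq_of_nhds, this]
      exact sub_self _
  have hm : ∀ p, fderiv ℝ H p (V p) = k p - ((R ^ 4 : ℝ)⁻¹ : ℝ) • k (dil R⁻¹ p) := by
    intro p
    have h1 := (hGd p).hasFDerivAt.sub ((hcomp G p (hGd _)).const_mul (((R ^ 3)⁻¹ : ℝ) : ℂ))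
    have h2 : HasFDerivAt H _ p := h1
    rw [h2.fderiv]
    simp only [sub_apply, smul_apply, ContinuousLinearMap.comp_apply, dilL_apply, hVi, map_smul,
      Complex.real_smul, smul_eq_mul, hk]
    push_cast
    have : (R : ℂ) ≠ 0 := by exact_mod_cast hR0.ne'
    field_simp
  have h0 := hV.integral_eq_zero hHs hHc
  simp_rw [hm] at h0
  set m : Heis → ℂ := fun p => k p - ((R ^ 4 : ℝ)⁻¹ : ℝ) • k (dil R⁻¹ p) with hmdef
  have hki : Continuous fun p => k (dil R⁻¹ p) := hkc.comp (contDiff_dil R⁻¹).continuous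
  have hmc : Continuous m := hkc.sub (hki.fun_const_smul _)
  have hRa : 0 < R * a := by positivity
  have hunion : annulus a (R * a) ∪ annulus (R * a) (R * (R * a)) = annulus a (R * (R * a)) := by
    ext p
    simp only [annulus, Set.mem_union, Set.mem_ofPred_eq]
    constructor
    · rintro (⟨h1, h2⟩ | ⟨h1, h2⟩)
      · exact ⟨h1, by nlinarith⟩
      · exact ⟨by linarith, h2⟩
    · rintro ⟨h1, h2⟩
      rcases lt_or_ge (rho p) (R * a) with h3 | h3
      · exact Or.inl ⟨h1, h3⟩
      · exact Or.inr ⟨h3, h2⟩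
  have hdisj : Disjoint (annulus a (R * a)) (annulus (R * a) (R * (R * a))) := by
    rw [Set.disjoint_left]
    rintro p ⟨-, h1⟩ ⟨h2, -⟩
    linarith
  have hsupp : ∫ p in annulus a (R * (R * a)), m p = ∫ p, m p := by
    refine setIntegral_eq_integral_of_forall_compl_eq_zero fun p hp => ?_
    have hp' : rho p < a ∨ R * (R * a) ≤ rho p := by
      by_contra hcon
      push Not at hcon
      exact hp hcon
    rcases hp' with hp' | hp'
    · have h2 : rho (dil R⁻¹ p) < a₁ := by
        rw [rho_inv, lt_iff]; nlinarith
      simp [hmdef, k_zero (hp'.trans ha₁), k_zero h2]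
    · have h2 : b₁ < rho (dil R⁻¹ p) := by
        rw [rho_inv, lt_inv_mul_iff₀ hR0]; nlinarith
      have h1 : b₁ < rho p := by nlinarith
      have hp0 : p ≠ 0 := by rintro rfl; rw [rho_zero] at h1; linarith
      simp only [hmdef]
      rw [k_far h1, k_far h2, hD_dil hp0, sub_self]
  rw [← hsupp, ← hunion, setIntegral_union hdisj (measurableSet_annulus _ _)
    (integrableOn_annulus hmc.continuousOn ha _) (integrableOn_annulus hmc.continuousOn hRa _)] at h0
  have e1 : ∫ p in annulus a (R * a), m p = ∫ p in annulus a (R * a), k p := by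
    refine setIntegral_congr_fun (measurableSet_annulus _ _) fun p hp => ?_
    have h2 : rho (dil R⁻¹ p) < a₁ := by
      rw [rho_inv, lt_iff]; nlinarith [hp.2]
    simp [hmdef, k_zero h2]
  have e2 : ∫ p in annulus (R * a) (R * (R * a)), m p
      = ((R ^ 4 : ℝ)⁻¹ : ℝ) • (∫ p in annulus (R * a) (R * (R * a)), D (dil R⁻¹ p))
        - ((R ^ 4 : ℝ)⁻¹ : ℝ) • ∫ p in annulus (R * a) (R * (R * a)), k (dil R⁻¹ p) := by
    have hDi : ContinuousOn (fun p => D (dil R⁻¹ p)) {0}ᶜ :=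
      hDc.comp (contDiff_dil R⁻¹).continuous.continuousOn
        fun p hp => dil_ne_zero (inv_ne_zero hR0.ne') hp
    rw [← integral_smul, ← integral_smul, ← integral_sub
      ((integrableOn_annulus hDi hRa _).fun_smul _)
      ((integrableOn_annulus hki.continuousOn hRa _).fun_smul _)]
    refine setIntegral_congr_fun (measurableSet_annulus _ _) fun p hp => ?_
    have h1 : b₁ < rho p := lt_of_lt_of_le hb₁' hp.1
    have hp0 : p ≠ 0 := by rintro rfl; rw [rho_zero] at h1; linarith
    simp only [hmdef]
    rw [k_far h1, hD_dil hp0]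
  have hdil : ∀ g : Heis → ℂ, ((R ^ 4 : ℝ)⁻¹ : ℝ) • (∫ p in annulus (R * a) (R * (R * a)),
      g (dil R⁻¹ p)) = ∫ p in annulus a (R * a), g p := by
    intro g
    have := setIntegral_annulus_dil hR0 a (R * a) (fun p => g (dil R⁻¹ p))
    simp_rw [dil_inv_dil hR0.ne'] at this
    exact this.symm
  -- The inner annulus contributes `∫ k`; the outer one, scaled back, contributes `∫ D - ∫ k`. The
  -- cutoff disappears from the sum.
  rw [e1, e2, hdil, hdil] at h0
  linear_combination h0

/-! ### Homogeneous functions and integration over the fundamental domain -/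

/-- `f (δ_r p) = r ^ d f p`. -/
def IsHom (r : ℝ) (d : ℤ) (f : SF) : Prop :=
  ∀ p : Heis, p ≠ 0 → f.ext (dil r p) = (r : ℂ) ^ d * f.ext p

namespace IsHom

variable {r : ℝ} {d e : ℤ} {f g : SF}

lemma mul (hr : r ≠ 0) (hf : IsHom r d f) (hg : IsHom r e g) : IsHom r (d + e) (f * g) :=
  fun p hp => by
    have : (r : ℂ) ≠ 0 := by exact_mod_cast hr
    simp only [SF.ext_mul, hf p hp, hg p hp, zpow_add₀ this]; ring

lemma add (hf : IsHom r d f) (hg : IsHom r d g) : IsHom r d (f + g) := fun p hp => by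
  simp only [SF.ext_add, hf p hp, hg p hp]; ring

lemma smul (c : ℂ) (hf : IsHom r d f) : IsHom r d (c • f) := fun p hp => by
  simp only [SF.ext_smul, hf p hp]; ring

lemma neg (hf : IsHom r d f) : IsHom r d (-f) := by
  rw [← neg_one_smul ℂ f]; exact hf.smul _

lemma sub (hf : IsHom r d f) (hg : IsHom r d g) : IsHom r d (f - g) := by
  rw [sub_eq_add_neg]; exact hf.add hg.neg

lemma conj (hf : IsHom r d f) : IsHom r d (HeisCR.conj f) := fun p hp => by
  simp only [conj_ext, hf p hp]; simp

lemma vfDeriv (hr : r ≠ 0) {V : Heis → Heis} (hV : IsHomField V) (hf : IsHom r d f) :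
    IsHom r (d - 1) (vfDeriv V hV.smooth f) := fun p hp => by
  have hr' : (r : ℂ) ≠ 0 := by exact_mod_cast hr
  have hq : dil r p ≠ 0 := dil_ne_zero hr hp
  rw [SF.ext_of_ne _ hq, SF.ext_of_ne _ hp, vfDeriv_apply, vfDeriv_apply]
  have h1 : HasFDerivAt (fun q => f.ext (dil r q)) ((fderiv ℝ f.ext (dil r p)).comp (dilL r)) p :=
    (f.differentiableAt_ext hq).hasFDerivAt.comp p (dilL r).hasFDerivAt
  have h2 : (fun q => f.ext (dil r q)) =ᶠ[𝓝 p] fun q => (r : ℂ) ^ d * f.ext q :=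
    eventuallyEq_of_compl_zero hf hp
  have h3 := (f.differentiableAt_ext hp).hasFDerivAt.const_mul ((r : ℂ) ^ d)
  have h4 := (h1.congr_of_eventuallyEq h2.symm).unique h3
  have h5 := congrArg (fun L => L (V p)) h4
  simp only [ContinuousLinearMap.comp_apply, dilL_apply, hV.dil, map_smul, smul_apply,
    Complex.real_smul, smul_eq_mul] at h5
  rw [zpow_sub₀ hr', zpow_one]
  field_simp
  linear_combination h5

lemma dZ (hr : r ≠ 0) (hf : IsHom r d f) : IsHom r (d - 1) (dZ f) :=
  ((hf.vfDeriv hr isHomField_X).sub ((hf.vfDeriv hr isHomField_Y).smul Complex.I)).smul (1 / 2)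

lemma dW (hr : r ≠ 0) (hf : IsHom r d f) : IsHom r (d - 1) (dW f) :=
  ((hf.vfDeriv hr isHomField_X).add ((hf.vfDeriv hr isHomField_Y).smul Complex.I)).smul (1 / 2)

end IsHom

lemma integrableOn_fundDomain {F : Type*} [NormedAddCommGroup F] {g : Heis → F} {r : ℝ}
    (hr : 0 < r) (hg : ContinuousOn g {0}ᶜ) : IntegrableOn g (fundDomain r) :=
  integrableOn_annulus hg (lt_min one_pos hr) _

/-- Integration over the fundamental domain. -/
def intF (r : ℝ) (f : SF) : ℂ := ∫ p in fundDomain r, f.ext p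

section intF

variable {r : ℝ} (hr : 0 < r)
include hr

lemma SF.integrableOn (f : SF) : IntegrableOn f.ext (fundDomain r) :=
  integrableOn_fundDomain hr f.contDiffOn_ext.continuousOn

lemma intF_add (f g : SF) : intF r (f + g) = intF r f + intF r g := by
  simp only [intF, SF.ext_add]
  exact integral_add (f.integrableOn hr) (g.integrableOn hr)

omit hr in
lemma intF_smul (c : ℂ) (f : SF) : intF r (c • f) = c * intF r f := by
  simp only [intF, SF.ext_smul]
  exact integral_const_mul _ _

omit hr in
lemma intF_neg (f : SF) : intF r (-f) = -intF r f := by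
  rw [← neg_one_smul ℂ f, intF_smul, neg_one_mul]

lemma intF_sub (f g : SF) : intF r (f - g) = intF r f - intF r g := by
  rw [sub_eq_add_neg, intF_add hr, intF_neg, sub_eq_add_neg]

omit hr in
lemma intF_conj (f : SF) : intF r (conj f) = star (intF r f) := by
  simp only [intF, conj_ext]
  exact integral_conj

omit hr in
lemma intF_zero : intF r 0 = 0 := by
  rw [← zero_smul ℂ (0 : SF), intF_smul, zero_mul]

lemma intF_vfDeriv (hr1 : r ≠ 1) {V : Heis → Heis} (hV : IsHomField V) {f : SF}
    (hf : IsHom r (-3) f) : intF r (vfDeriv V hV.smooth f) = 0 := by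
  have hint : intF r (vfDeriv V hV.smooth f)
      = ∫ p in annulus (min 1 r) (max 1 r), fderiv ℝ f.ext p (V p) := by
    refine setIntegral_congr_fun (measurableSet_annulus _ _) fun p hp => ?_
    have hp0 : p ≠ 0 := annulus_subset (lt_min one_pos hr) (max 1 r) ⟨hp.1, hp.2.le⟩
    rw [SF.ext_of_ne _ hp0, vfDeriv_apply]
  rw [hint]
  rcases lt_or_gt_of_ne hr1 with h1 | h1
  · rw [min_eq_right h1.le, max_eq_left h1.le]
    -- For `r < 1` the annulus is `r ≤ ρ < 1`, and the inverse generator `δ_{1/r}` plays the role of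
    -- the expanding dilation.
    have := setIntegral_annulus_eq_zero_of_one_lt hV hr (one_lt_inv_iff₀.2 ⟨hr, h1⟩) f (by
      intro p hp
      have h2 := hf (dil r⁻¹ p) (dil_ne_zero (inv_ne_zero hr.ne') hp)
      rw [dil_dil_inv hr.ne'] at h2
      rw [h2]
      have : (r : ℂ) ≠ 0 := by exact_mod_cast hr.ne'
      generalize f.ext (dil r⁻¹ p) = x
      rw [zpow_neg, show (3 : ℤ) = ((3 : ℕ) : ℤ) from rfl, zpow_natCast]
      push_cast
      field_simp)
    rwa [inv_mul_cancel₀ hr.ne'] at this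
  · rw [min_eq_left h1.le, max_eq_right h1.le]
    have := setIntegral_annulus_eq_zero_of_one_lt hV one_pos h1 f (by
      intro p hp
      rw [hf p hp]
      push_cast
      rw [zpow_neg]
      norm_cast)
    rwa [mul_one] at this

lemma intF_dZ (hr1 : r ≠ 1) {f : SF} (hf : IsHom r (-3) f) : intF r (dZ f) = 0 := by
  simp only [dZ, dX, dY, Derivation.smul_apply, Derivation.sub_apply, intF_smul, intF_sub hr]
  rw [intF_vfDeriv hr hr1 isHomField_X hf, intF_vfDeriv hr hr1 isHomField_Y hf]
  simp

lemma intF_dW (hr1 : r ≠ 1) {f : SF} (hf : IsHom r (-3) f) : intF r (dW f) = 0 := by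
  simp only [dW, dX, dY, Derivation.smul_apply, Derivation.add_apply, intF_smul, intF_add hr]
  rw [intF_vfDeriv hr hr1 isHomField_X hf, intF_vfDeriv hr hr1 isHomField_Y hf]
  simp

/-- Integration by parts for `Z₁`. -/
lemma intF_mul_dZ (hr1 : r ≠ 1) {f g : SF} {d e : ℤ} (hf : IsHom r d f) (hg : IsHom r e g)
    (hde : d + e = -3) : intF r (f * dZ g) = -intF r (dZ f * g) := by
  have h := intF_dZ hr hr1 (hde ▸ hf.mul hr.ne' hg)
  rw [Derivation.leibniz, intF_add hr, smul_eq_mul, smul_eq_mul, mul_comm g] at h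
  linear_combination h

/-- Integration by parts for `Z̄₁`. -/
lemma intF_mul_dW (hr1 : r ≠ 1) {f g : SF} {d e : ℤ} (hf : IsHom r d f) (hg : IsHom r e g)
    (hde : d + e = -3) : intF r (f * dW g) = -intF r (dW f * g) := by
  have h := intF_dW hr hr1 (hde ▸ hf.mul hr.ne' hg)
  rw [Derivation.leibniz, intF_add hr, smul_eq_mul, smul_eq_mul, mul_comm g] at h
  linear_combination h

end intF

/-! ### The coordinate functions and the complex gauge `q = |z|² - it` -/

/-- The coordinate `z` as an element of `SF`. -/
def zS : SF := SF.mk (fun p => p.1) contDiff_fst.contDiffOn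
/-- The coordinate `t` as an element of `SF`. -/
def tS : SF := SF.mk (fun p => (p.2 : ℂ)) (Complex.ofRealCLM.contDiff.comp contDiff_snd).contDiffOn
/-- The complex gauge `q = |z|² - it`. -/
def qS : SF := zS * conj zS - Complex.I • tS

lemma vfDeriv_zS (V : Heis → Heis) (hV : ContDiff ℝ ∞ V) (p : Punctured) :
    (vfDeriv V hV zS).val p = (V p).1 := by
  have e : zS.ext =ᶠ[𝓝 p.1] fun q => q.1 := SF.ext_mk_eventuallyEq _ _ p.2
  rw [vfDeriv_apply, e.fderiv_eq, fderiv_fst]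
  rfl

lemma vfDeriv_tS (V : Heis → Heis) (hV : ContDiff ℝ ∞ V) (p : Punctured) :
    (vfDeriv V hV tS).val p = (V p).2 := by
  have e : tS.ext =ᶠ[𝓝 p.1] fun q => (q.2 : ℂ) := SF.ext_mk_eventuallyEq _ _ p.2
  rw [vfDeriv_apply, e.fderiv_eq]
  have := (Complex.ofRealCLM.hasFDerivAt.comp p.1 (hasFDerivAt_snd (𝕜 := ℝ) (p := p.1))).fderiv
  exact congrArg (fun L => L (V p)) this

lemma dZ_zS : dZ zS = 1 := SF.eq_of_forall fun p => by
  simp only [dZ, dX, dY, Derivation.smul_apply, Derivation.sub_apply, SF.val_smul, SF.val_sub,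
    vfDeriv_zS, X, Y, SF.val_one, Complex.I_mul_I]
  norm_num

lemma dW_zS : dW zS = 0 := SF.eq_of_forall fun p => by
  simp only [dW, dX, dY, Derivation.smul_apply, Derivation.add_apply, SF.val_smul, SF.val_add,
    vfDeriv_zS, X, Y, SF.val_zero, Complex.I_mul_I]
  norm_num

lemma dZ_tS : dZ tS = Complex.I • conj zS := SF.eq_of_forall fun p => by
  have : (conj zS).val p = star p.1.1 := conj_apply _ _
  simp only [dZ, dX, dY, Derivation.smul_apply, Derivation.sub_apply, SF.val_smul, SF.val_sub,
    vfDeriv_tS, X, Y, this]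
  apply Complex.ext <;> simp

lemma dZ_conj_zS : dZ (conj zS) = 0 := by rw [dZ_conj, dW_zS, map_zero]
lemma dW_conj_zS : dW (conj zS) = 1 := by rw [dW_conj, dZ_zS, map_one]

lemma conj_tS : conj tS = tS := SF.eq_of_forall fun p => by
  have : tS.val p = (p.1.2 : ℂ) := rfl
  rw [conj_apply, this]; simp

lemma dW_tS : dW tS = -(Complex.I • zS) := by
  rw [← conj_tS, dW_conj, dZ_tS, conj_smul, conj_conj, show star Complex.I = -Complex.I from
    Complex.conj_I, neg_smul]

lemma dZ_qS : dZ qS = 2 * conj zS := by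
  simp only [qS, map_sub, Derivation.leibniz, Derivation.map_smul, dZ_zS, dZ_tS, dZ_conj_zS,
    smul_smul, Complex.I_mul_I, smul_eq_mul]
  rw [neg_one_smul]; ring

/-- The gauge `q` is a CR function with `|q| = ρ²`; its logarithm therefore exhibits `log ρ²` as
pluriharmonic. -/
lemma dW_qS : dW qS = 0 := by
  simp only [qS, map_sub, Derivation.leibniz, Derivation.map_smul, dW_zS, dW_tS, dW_conj_zS,
    smul_neg, smul_smul, Complex.I_mul_I, smul_eq_mul]
  rw [neg_one_smul]; ring

lemma qS_val (p : Punctured) : qS.val p = (Complex.normSq p.1.1 : ℂ) - Complex.I * p.1.2 := by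
  simp only [qS, SF.val_sub, SF.val_mul, SF.val_smul, conj_apply]
  change p.1.1 * star p.1.1 - Complex.I * p.1.2 = _
  rw [Complex.star_def, Complex.mul_conj]

lemma qS_re (p : Punctured) : (qS.val p).re = Complex.normSq p.1.1 := by simp [qS_val]
lemma qS_im (p : Punctured) : (qS.val p).im = -p.1.2 := by simp [qS_val]

lemma norm_qS (p : Punctured) : ‖qS.val p‖ = rho p ^ 2 := by
  have h : ‖qS.val p‖ ^ 2 = (rho p ^ 2) ^ 2 := by
    rw [← Complex.normSq_eq_norm_sq, Complex.normSq_apply, qS_re, qS_im, ← pow_mul, rho_pow_four,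
      Complex.normSq_eq_norm_sq]
    ring
  exact (pow_left_inj₀ (norm_nonneg _) (by positivity) (by norm_num)).1 h

lemma qS_ne_zero (p : Punctured) : qS.val p ≠ 0 := by
  rw [← norm_pos_iff, norm_qS]
  exact pow_pos (rho_pos p.2) 2

/-- The real part `|z|²` is nonnegative and `q` vanishes only at the origin, so the principal
logarithm is globally smooth on `ℍ¹ \ {0}` and no branch has to be chosen. -/
lemma qS_mem_slitPlane (p : Punctured) : qS.val p ∈ Complex.slitPlane := by
  rw [Complex.mem_slitPlane_iff]
  by_contra hcon
  push Not at hcon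
  have h1 := hcon.1
  rw [qS_re] at h1
  exact qS_ne_zero p (Complex.ext (by rw [qS_re]; exact le_antisymm h1 (Complex.normSq_nonneg _))
    hcon.2)

/-- The function `1 / q`. -/
def pS : SF := SF.mk (fun p => (qS.ext p)⁻¹) (qS.contDiffOn_ext.inv fun p hp => by
  rw [qS.ext_of_ne hp]; exact qS_ne_zero _)

lemma pS_val (p : Punctured) : pS.val p = (qS.val p)⁻¹ := by simp [pS]

lemma pS_mul_qS : pS * qS = 1 := SF.eq_of_forall fun p => by
  simp [pS_val, qS_ne_zero]

lemma dZ_pS : dZ pS = -(2 * conj zS * pS ^ 2) := by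
  rw [dZ.leibniz_of_mul_eq_one pS_mul_qS, dZ_qS, smul_eq_mul]; ring

lemma dW_pS : dW pS = 0 := by
  rw [dW.leibniz_of_mul_eq_one pS_mul_qS, dW_qS, smul_zero]

lemma pS_add_conj : pS + conj pS = 2 * zS * conj zS * pS * conj pS := by
  have h2 : conj pS * conj qS = 1 := by rw [← map_mul, pS_mul_qS, map_one]
  have h3 : qS + conj qS = 2 * (zS * conj zS) := by
    simp only [qS, map_sub, map_mul, conj_conj, conj_smul, conj_tS,
      show star Complex.I = -Complex.I from Complex.conj_I, neg_smul]
    ring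
  linear_combination (pS * conj pS) * h3 - conj pS * pS_mul_qS - pS * h2

lemma contDiffOn_log_qS : ContDiffOn ℝ ∞ (fun p => Complex.log (qS.ext p)) {0}ᶜ := fun p hp =>
  (((Complex.contDiffAt_log (n := ∞) (x := qS.ext p) (by
    rw [qS.ext_of_ne hp]; exact qS_mem_slitPlane _)).restrict_scalars ℝ).comp p
    (qS.contDiffAt_ext hp)).contDiffWithinAt

/-- The logarithm of `q`. -/
def logS : SF := SF.mk (fun p => Complex.log (qS.ext p)) contDiffOn_log_qS

lemma logS_val (p : Punctured) : logS.val p = Complex.log (qS.val p) := by simp [logS]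

lemma vfDeriv_logS (V : Heis → Heis) (hV : ContDiff ℝ ∞ V) :
    vfDeriv V hV logS = pS * vfDeriv V hV qS := SF.eq_of_forall fun p => by
  have e : logS.ext =ᶠ[𝓝 p.1] fun q => Complex.log (qS.ext q) := SF.ext_mk_eventuallyEq _ _ p.2
  have h : HasFDerivAt (fun q => Complex.log (qS.ext q)) _ p.1 :=
    (((Complex.hasDerivAt_log (z := qS.ext p.1) (by
      rw [qS.ext_coe]; exact qS_mem_slitPlane p)).hasFDerivAt.restrictScalars ℝ).comp p.1
      (qS.differentiableAt_ext p.2).hasFDerivAt)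
  rw [SF.val_mul, vfDeriv_apply, vfDeriv_apply, pS_val, e.fderiv_eq, h.fderiv]
  simp [mul_comm]

lemma dZ_logS : dZ logS = 2 * conj zS * pS := by
  have : dZ logS = pS * dZ qS := by
    simp only [dZ, dX, dY, Derivation.smul_apply, Derivation.sub_apply]
    rw [vfDeriv_logS, vfDeriv_logS]
    simp only [mul_smul_comm, mul_sub]
  rw [this, dZ_qS]; ring

lemma dW_logS : dW logS = 0 := by
  have : dW logS = pS * dW qS := by
    simp only [dW, dX, dY, Derivation.smul_apply, Derivation.add_apply]
    rw [vfDeriv_logS, vfDeriv_logS]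
    simp only [mul_smul_comm, mul_add]
  rw [this, dW_qS, mul_zero]

lemma dZ_conj_logS : dZ (conj logS) = 0 := by rw [dZ_conj, dW_logS, map_zero]
lemma dW_conj_logS : dW (conj logS) = 2 * zS * conj pS := by
  rw [dW_conj, dZ_logS, map_mul, map_mul, conj_conj, map_ofNat]

/-- The function `-log |q| = -log ρ²`. -/
def sS : SF := (-(1 / 2) : ℂ) • (logS + conj logS)
/-- The argument of `q`. -/
def phiS : SF := (-(Complex.I / 2)) • (logS - conj logS)

lemma smul_two (c : ℂ) (f : SF) : c • (2 * f) = (c * 2) • f := by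
  rw [mul_smul, two_smul, two_mul]

lemma dZ_sS : dZ sS = -(conj zS * pS) := by
  simp only [sS, Derivation.map_smul, map_add, dZ_logS, dZ_conj_logS, add_zero, mul_assoc, smul_two]
  norm_num

lemma dW_sS : dW sS = -(zS * conj pS) := by
  simp only [sS, Derivation.map_smul, map_add, dW_logS, dW_conj_logS, zero_add, mul_assoc, smul_two]
  norm_num

lemma dW_dZ_sS : dW (dZ sS) = -pS := by
  simp only [dZ_sS, map_neg, Derivation.leibniz, dW_conj_zS, dW_pS, smul_eq_mul]; ring

lemma conj_sS : conj sS = sS := by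
  simp only [sS, conj_smul, map_add, conj_conj, add_comm]
  simp

lemma isPH_sS : IsPH sS := ⟨conj_sS, by rw [dW_dZ_sS, map_neg, dW_pS, neg_zero]⟩

lemma dZ_phiS : dZ phiS = -(Complex.I • (conj zS * pS)) := by
  simp only [phiS, Derivation.map_smul, map_sub, dZ_logS, dZ_conj_logS, sub_zero, mul_assoc,
    smul_two]
  rw [← neg_smul]; congr 1; ring

lemma conj_phiS : conj phiS = phiS := by
  simp only [phiS, conj_smul, map_sub, conj_conj]
  rw [show star (-(Complex.I / 2)) = Complex.I / 2 by simp [Complex.conj_I]; ring]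
  module

lemma dW_phiS : dW phiS = Complex.I • (zS * conj pS) := by
  rw [← conj_phiS, dW_conj, dZ_phiS, map_neg, conj_smul, map_mul, conj_conj,
    show star Complex.I = -Complex.I from Complex.conj_I, neg_smul, neg_neg]

/-- Equivalently, `log q = -s + iφ` is annihilated by `Z̄`. Under `Z̄` the non-invariant `s` can be
exchanged for the dilation-invariant `φ`. -/
lemma dW_sS_eq : dW sS = Complex.I • dW phiS := by
  rw [dW_sS, dW_phiS, smul_smul, Complex.I_mul_I, neg_one_smul]

lemma dW_conj_pS : dW (conj pS) = -(2 * zS * conj pS ^ 2) := by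
  rw [dW_conj, dZ_pS]; simp only [map_neg, map_mul, map_pow, conj_conj, map_ofNat]

lemma dZ_conj_pS : dZ (conj pS) = 0 := by
  rw [dZ_conj, dW_pS, map_zero]

lemma aPan_sS_sq : aPan dZ dW (sS * sS) = -(2 * (pS ^ 2 + conj pS ^ 2)) := by
  rw [aPan_mul isPH_sS.isPair isPH_sS.isPair]
  have h1 : 2 * dW (dZ sS) * dW sS + 2 * dW (dZ sS) * dW sS + dZ sS * dW (dW sS)
      + dW (dW sS) * dZ sS = 2 * (zS * pS * conj pS) - 2 * (zS * conj pS ^ 2) := by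
    rw [dW_dZ_sS, dW_sS, dZ_sS, map_neg, dW.leibniz, dW_zS, dW_conj_pS]
    simp only [smul_eq_mul]
    linear_combination (2 * zS * conj pS) * pS_add_conj
  rw [h1]
  simp only [map_sub, Derivation.leibniz, smul_eq_mul, dZ_zS, dZ_pS, dZ_conj_pS, deriv_two, pow_two]
  linear_combination (2 * pS) * pS_add_conj

/-- The difference `s² - φ²` is the real part of `(log q)²`, hence is killed by `ZZ̄Z̄Z`; the value
is the one already found for `s²`. The point is that `φ²`, unlike `s²`, lives on the quotient. -/
lemma aPan_phiS_sq : aPan dZ dW (phiS * phiS) = -(2 * (pS ^ 2 + conj pS ^ 2)) := by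
  have h1 : phiS * phiS = sS * sS - (1 / 2 : ℂ) • (logS * logS + conj logS * conj logS) := by
    simp only [phiS, sS, smul_mul_smul_comm]
    rw [show -(Complex.I / 2) * -(Complex.I / 2) = -(1 / 4 : ℂ) by
      linear_combination (1 / 4 : ℂ) * Complex.I_sq]
    rw [show (logS - conj logS) * (logS - conj logS)
      = logS * logS + conj logS * conj logS - (logS * conj logS + logS * conj logS) by ring,
      show (logS + conj logS) * (logS + conj logS)
      = logS * logS + conj logS * conj logS + (logS * conj logS + logS * conj logS) by ring]
    module
  have h2 : aPan dZ dW (logS * logS + conj logS * conj logS) = 0 := by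
    simp only [aPan, map_add, Derivation.leibniz, smul_eq_mul, dZ_logS, dW_logS,
      dW_conj_zS, dZ_conj_zS, dW_pS, dZ_pS, deriv_two, dZ_conj_logS, map_zero]
    simp
  have h3 : aPan dZ dW (phiS * phiS) = aPan dZ dW (sS * sS)
      - (1 / 2 : ℂ) • aPan dZ dW (logS * logS + conj logS * conj logS) := by
    rw [h1]
    simp only [aPan, map_sub, Derivation.map_smul]
  rw [h3, h2, smul_zero, sub_zero, aPan_sS_sq]

lemma aBi_sS : aBi dZ dW sS = 2 * (pS ^ 2 + conj pS ^ 2) := by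
  have h1 : dZ (dW sS) = -conj pS := by
    rw [← conj_sS, dW_conj, dZ_conj, dW_dZ_sS, map_neg]
  simp only [aBi, dW_dZ_sS, h1, map_add, map_neg, dZ_pS, dW_pS, dZ_conj_pS, dW_conj_pS,
    Derivation.leibniz, smul_eq_mul, pow_two, deriv_two, dW_conj_zS, dZ_zS, map_zero, neg_zero]
  ring

lemma four_aBi_sS : 4 * aBi dZ dW sS + 2 * aPan dZ dW (sS * sS) = 4 * (pS ^ 2 + conj pS ^ 2) := by
  rw [aBi_sS, aPan_sS_sq]; ring

/-! ### Homogeneity of the coordinate functions -/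

section Homogeneity

variable {r : ℝ}

lemma isHom_zS (hr : r ≠ 0) : IsHom r 1 zS := fun p hp => by
  rw [SF.ext_of_ne _ (dil_ne_zero hr hp), SF.ext_of_ne _ hp]
  change r • p.1 = (r : ℂ) ^ (1 : ℤ) * p.1
  simp

variable (hr : 0 < r)
include hr

lemma qS_dil {p : Heis} (hp : p ≠ 0) : qS.ext (dil r p) = ((r ^ 2 : ℝ) : ℂ) * qS.ext p := by
  rw [SF.ext_of_ne _ (dil_ne_zero hr.ne' hp), SF.ext_of_ne _ hp, qS_val, qS_val]
  simp only [dil, Complex.real_smul, map_mul, Complex.normSq_ofReal]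
  push_cast
  ring

lemma isHom_pS : IsHom r (-2) pS := fun p hp => by
  have h := qS_dil hr hp
  rw [SF.ext_of_ne _ (dil_ne_zero hr.ne' hp), SF.ext_of_ne _ hp] at h ⊢
  rw [pS_val, pS_val, h, mul_inv, zpow_neg]
  push_cast
  rfl

lemma isHom_phiS : IsHom r 0 phiS := fun p hp => by
  have h : ∀ p : Punctured, phiS.val p = ((Complex.arg (qS.val p) : ℝ) : ℂ) := fun p => by
    have h1 : logS.val p = Complex.log (qS.val p) := logS_val p
    simp only [phiS, SF.val_smul, SF.val_sub, conj_apply, h1]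
    apply Complex.ext <;> simp [Complex.log_im]; ring
  have h2 := qS_dil hr hp
  rw [SF.ext_of_ne _ (dil_ne_zero hr.ne' hp), SF.ext_of_ne _ hp] at h2 ⊢
  rw [h, h, h2, Complex.arg_real_mul _ (by positivity)]
  simp

/-- Under the dilation `s` itself changes by an additive constant; only its derivatives are
homogeneous. -/
lemma isHom_dZ_sS : IsHom r (-1) (dZ sS) := by
  rw [dZ_sS]
  exact ((isHom_zS hr.ne').conj.mul hr.ne' (isHom_pS hr)).neg

lemma isHom_dW_sS : IsHom r (-1) (dW sS) := by
  rw [← conj_sS, dW_conj]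
  exact (isHom_dZ_sS hr).conj

end Homogeneity

/-! ### Integral identities for pluriharmonic functions -/

/-- The sublaplacian `ZZ̄ + Z̄Z` of `θ₀`. -/
def lapS (v : SF) : SF := dW (dZ v) + dZ (dW v)

lemma lapS_add (u v : SF) : lapS (u + v) = lapS u + lapS v := by
  simp only [lapS, map_add]; ring

lemma aBi_eq_lapS (v : SF) : aBi dZ dW v = dW (dZ (lapS v)) + dZ (dW (lapS v)) := rfl

lemma IsHom.lapS {r : ℝ} {d : ℤ} {v : SF} (hr : r ≠ 0) (hv : IsHom r d v) :
    IsHom r (d - 1 - 1) (lapS v) :=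
  ((hv.dZ hr).dW hr).add ((hv.dW hr).dZ hr)

lemma IsPH.lapS_eq {v : SF} (hv : IsPH v) : lapS v = dW (dZ v) + conj (dW (dZ v)) := by
  rw [lapS, ← dZ_conj, ← dW_conj, hv.1]

section Integrals

variable {r : ℝ} (hr : 0 < r) (hr1 : r ≠ 1)
include hr hr1

lemma intF_mul_aBi {u v : SF} (hu : IsHom r 0 u) (hv : IsHom r 0 v) :
    intF r (u * aBi dZ dW v) = intF r (lapS u * lapS v) := by
  have hl := hv.lapS hr.ne'
  rw [aBi_eq_lapS, mul_add, intF_add hr,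
    intF_mul_dW hr hr1 hu (hl.dZ hr.ne') (by norm_num),
    intF_mul_dZ hr hr1 (hu.dW hr.ne') hl (by norm_num),
    intF_mul_dZ hr hr1 hu (hl.dW hr.ne') (by norm_num),
    intF_mul_dW hr hr1 (hu.dZ hr.ne') hl (by norm_num), neg_neg, neg_neg, ← intF_add hr,
    ← add_mul, add_comm (dZ (dW u))]
  rfl

/-- Three integrations by parts move the outer derivatives onto `u`, where they form `Z̄Z̄Zu = 0`.
-/
lemma intF_mul_aPan {u g : SF} (hu : IsHom r 0 u) (hpu : IsPH u) (hg : IsHom r 0 g) :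
    intF r (u * aPan dZ dW g) = 0 := by
  have h1 := hg.dZ hr.ne'
  rw [aPan, intF_mul_dZ hr hr1 hu ((h1.dW hr.ne').dW hr.ne') (by norm_num),
    intF_mul_dW hr hr1 (hu.dZ hr.ne') (h1.dW hr.ne') (by norm_num),
    intF_mul_dW hr hr1 ((hu.dZ hr.ne').dW hr.ne') h1 (by norm_num), hpu.2, zero_mul, intF_zero]
  simp

omit hr1 in
lemma isHom_aPan_sS_mul {v : SF} (hv : IsHom r 0 v) :
    IsHom r (-3) (2 * dW (dZ sS) * dW v + 2 * dW (dZ v) * dW sS + dZ sS * dW (dW v)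
      + dW (dW sS) * dZ v) := by
  have hr' := hr.ne'
  have hZs := isHom_dZ_sS hr
  have hWs := isHom_dW_sS hr
  rw [← map_ofNat (algebraMap ℂ SF) 2, Algebra.algebraMap_eq_smul_one]
  simp only [smul_mul_assoc, one_mul]
  exact (((((hZs.dW hr').mul hr' (hv.dW hr') : IsHom r (-1 - 1 + (0 - 1)) _).smul _).add
    ((((hv.dZ hr').dW hr').mul hr' hWs : IsHom r (0 - 1 - 1 + -1) _).smul _)).add
      (hZs.mul hr' ((hv.dW hr').dW hr') : IsHom r (-1 + (0 - 1 - 1)) _)).add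
      ((hWs.dW hr').mul hr' (hv.dZ hr') : IsHom r (-1 - 1 + (0 - 1)) _)

/-- The argument of `intF_mul_aPan` fails because `sS * v` is not invariant: no boundary term may be
dropped while `sS` is undifferentiated. `aPan_mul` first rewrites the operator with derivatives of
`sS` only; further integrations by parts then cancel everything except one term, in which `sS` is
traded for `phiS`. -/
lemma intF_mul_aPan_sS_mul {u v : SF} (hu : IsHom r 0 u) (hpu : IsPH u) (hv : IsHom r 0 v)
    (hpv : IsPH v) : intF r (u * aPan dZ dW (sS * v)) = 0 := by
  have hr' := hr.ne'
  have hZu : IsHom r (-1) (dZ u) := hu.dZ hr'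
  have hZv : IsHom r (-1) (dZ v) := hv.dZ hr'
  have hWv : IsHom r (-1) (dW v) := hv.dW hr'
  have hF : IsHom r (-2) (dW (dZ u)) := hZu.dW hr'
  have hk : IsHom r (-2) (dW (dZ v)) := hZv.dW hr'
  have hZs := isHom_dZ_sS hr
  have hWs := isHom_dW_sS hr
  have hS : IsHom r (-2) (dW (dZ sS)) := hZs.dW hr'
  rw [aPan_mul isPH_sS.isPair hpv.isPair,
    intF_mul_dZ hr hr1 hu (isHom_aPan_sS_mul hr hv) (by norm_num)]
  have i1 := intF_mul_dW hr hr1 (hZu.mul hr' hZs) hWv (by norm_num)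
  have i2 := intF_mul_dW hr hr1 (hZu.mul hr' hZv) hWs (by norm_num)
  have i3 := intF_mul_dW hr hr1 (hS.mul hr' hZu) hv (by norm_num)
  have i4 := intF_mul_dW hr hr1 (hF.mul hr' hZs) hv (by norm_num)
  have i5 := intF_mul_dW hr hr1 ((hk.mul hr' hZu).sub (hF.mul hr' hZv)) (isHom_phiS hr)
    (by norm_num)
  -- Replacing `Z̄s` by `iZ̄φ` permits integrating `Z̄` off the invariant `φ`. It falls on the
  -- antisymmetric factor `Z̄Zv · Zu - Z̄Zu · Zv`, which `Z̄` annihilates because `Z̄Zu` and `Z̄Zv`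
  -- are CR.
  have e5 : intF r ((dW (dZ v) * dZ u - dW (dZ u) * dZ v) * dW sS) = 0 := by
    rw [dW_sS_eq, mul_smul_comm, intF_smul, i5]
    have : dW (dW (dZ v) * dZ u - dW (dZ u) * dZ v) = 0 := by
      simp only [map_sub, Derivation.leibniz, smul_eq_mul, hpu.2, hpv.2]; ring
    rw [this, zero_mul, intF_zero]; simp
  simp only [Derivation.leibniz, smul_eq_mul, hpu.2, isPH_sS.2, mul_zero, add_zero] at i1 i2 i3 i4
  -- The grouping follows the identities: the first two brackets have integrals zero by `i1` and
  -- `i2`, the third by `i3` and `i4`, whose right sides coincide, and the last by `e5`.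
  have key : dZ u * (2 * dW (dZ sS) * dW v + 2 * dW (dZ v) * dW sS + dZ sS * dW (dW v)
        + dW (dW sS) * dZ v)
      = (dZ u * dZ sS * dW (dW v) + (dZ u * dW (dZ sS) + dZ sS * dW (dZ u)) * dW v)
        + (dZ u * dZ v * dW (dW sS) + (dZ u * dW (dZ v) + dZ v * dW (dZ u)) * dW sS)
        + (dW (dZ sS) * dZ u * dW v - dW (dZ u) * dZ sS * dW v)
        + (dW (dZ v) * dZ u - dW (dZ u) * dZ v) * dW sS := by ring
  rw [key]
  simp only [intF_add hr, intF_sub hr, e5, i1, i2, i3, i4]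
  rw [mul_comm (dW (dZ sS))]
  ring

/-- Since `k` is CR and `Z̄ z̄ = 1`, the integrand is the exact derivative `Z̄(z̄ k²)` of a function
of degree `-3`. -/
lemma intF_sq_eq_zero {k : SF} (hk : IsHom r (-2) k) (hWk : dW k = 0) : intF r (k * k) = 0 := by
  have := intF_mul_dW hr hr1 (hk.mul hr.ne' hk) (isHom_zS hr.ne').conj (by norm_num)
  rw [dW_conj_zS, mul_one, Derivation.leibniz, hWk, smul_zero, add_zero, zero_mul, intF_zero] at this
  rw [this, neg_zero]

/-- With `k = Z̄Zv`, `Δv = k + k̄`. The squares of `k` and `k̄` integrate to zero, so only the cross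
term `2|k|²` remains. -/
lemma intF_lapS_sq {v : SF} (hv : IsHom r 0 v) (hpv : IsPH v) :
    intF r (lapS v * lapS v) = 2 * intF r (dW (dZ v) * conj (dW (dZ v))) := by
  have h := intF_sq_eq_zero hr hr1 ((hv.dZ hr.ne').dW hr.ne') hpv.2
  have h2 := intF_conj (r := r) (dW (dZ v) * dW (dZ v))
  rw [h, star_zero, map_mul] at h2
  rw [hpv.lapS_eq]
  have e : (dW (dZ v) + conj (dW (dZ v))) * (dW (dZ v) + conj (dW (dZ v)))
      = dW (dZ v) * dW (dZ v) + conj (dW (dZ v)) * conj (dW (dZ v))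
        + (dW (dZ v) * conj (dW (dZ v)) + dW (dZ v) * conj (dW (dZ v))) := by ring
  rw [e]
  simp only [intF_add hr, h, h2]
  ring

end Integrals

/-! ### Vanishing and rigidity on the quotient -/

lemma exists_zpow_dil_mem {r : ℝ} (hr : 0 < r) (hr1 : r ≠ 1) {p : Heis} (hp : p ≠ 0) :
    ∃ n : ℤ, dil (r ^ n) p ∈ fundDomain r := by
  rcases lt_or_gt_of_ne hr1 with h | h
  · obtain ⟨n, h1, h2⟩ := exists_mem_Ico_zpow (rho_pos hp) (one_lt_inv_iff₀.2 ⟨hr, h⟩)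
    -- The half-open interval is given for powers of `r⁻¹ > 1`; one extra factor `r` moves the gauge
    -- from `[1, r⁻¹)` to `[r, 1)`.
    refine ⟨n + 1, ?_⟩
    have hn : 0 < r ^ n := zpow_pos hr n
    rw [inv_zpow, inv_le_iff_one_le_mul₀ hn] at h1
    rw [inv_zpow, lt_inv_comm₀ (rho_pos hp) (zpow_pos hr _)] at h2
    have h3 := (lt_inv_comm₀ (zpow_pos hr _) (rho_pos hp)).1 h2
    rw [fundDomain, Set.mem_ofPred_eq, rho_dil (zpow_pos hr _), min_eq_right h.le, max_eq_left h.le]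
    constructor
    · rw [zpow_add_one₀ hr.ne']
      nlinarith
    · rw [← lt_inv_mul_iff₀ (zpow_pos hr _), mul_one]
      exact h3
  · obtain ⟨n, h1, h2⟩ := exists_mem_Ico_zpow (rho_pos hp) h
    refine ⟨-n, ?_⟩
    have hn : 0 < r ^ n := zpow_pos hr n
    rw [fundDomain, Set.mem_ofPred_eq, rho_dil (zpow_pos hr _), min_eq_left h.le, max_eq_right h.le,
      zpow_neg, inv_mul_lt_iff₀ hn, ← div_eq_inv_mul, one_le_div hn, ← zpow_add_one₀ hr.ne']
    exact ⟨h1, h2⟩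

lemma dil_zpow_invariant {α : Type*} {r : ℝ} (hr : r ≠ 0) {g : Heis → α}
    (h : ∀ p, p ≠ 0 → g (dil r p) = g p) (n : ℤ) {p : Heis} (hp : p ≠ 0) :
    g (dil (r ^ n) p) = g p := by
  induction n using Int.induction_on with
  | zero => simp
  | succ n ih =>
    rw [add_comm, zpow_add₀ hr, zpow_one, ← dil_dil, h _ (dil_ne_zero (zpow_ne_zero _ hr) hp), ih]
  | pred n ih =>
    rw [← ih, ← h _ (dil_ne_zero (zpow_ne_zero (-n - 1) hr) hp), dil_dil, ← zpow_one_add₀ hr]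
    congr 3; ring

lemma eq_zero_of_setIntegral_fundDomain {r : ℝ} (hr : 0 < r) (hr1 : r ≠ 1) {g : Heis → ℝ}
    (hg : ContinuousOn g {0}ᶜ) (h0 : ∀ p, 0 ≤ g p)
    (hinv : ∀ p, p ≠ 0 → (g (dil r p) = 0 ↔ g p = 0)) (hint : ∫ p in fundDomain r, g p = 0)
    {p : Heis} (hp : p ≠ 0) : g p = 0 := by
  set V : Set Heis := ({0}ᶜ ∩ g ⁻¹' {0}ᶜ) ∩ {p | min 1 r < rho p ∧ rho p < max 1 r} with hV
  have hVo : IsOpen V := (hg.isOpen_inter_preimage isOpen_compl_zero isOpen_compl_singleton).inter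
    ((isOpen_lt continuous_const continuous_rho).inter (isOpen_lt continuous_rho continuous_const))
  have hae := (setIntegral_eq_zero_iff_of_nonneg_ae (Filter.Eventually.of_forall h0)
    (integrableOn_fundDomain hr hg)).1 hint
  have hVe : V = ∅ := by
    rw [← hVo.measure_eq_zero_iff (μ := volume)]
    rw [Filter.EventuallyEq, ae_restrict_iff' (show MeasurableSet (fundDomain r) from
      measurableSet_annulus _ _)] at hae
    refine measure_mono_null (fun q hq => ?_) hae
    exact fun h => hq.1.2 (h ⟨hq.2.1.le, hq.2.2⟩)
  by_contra hcon
  obtain ⟨n, hn⟩ := exists_zpow_dil_mem hr hr1 hp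
  set q := dil (r ^ n) p with hq
  have hq0 : q ≠ 0 := dil_ne_zero (zpow_ne_zero _ hr.ne') hp
  have hgq : g q ≠ 0 := fun h =>
    hcon ((dil_zpow_invariant (g := fun p => g p = 0) hr.ne'
      (fun p hp => propext (hinv p hp)) n hp).mp h)
  -- The representative `q` may lie on the inner boundary of the annulus. A dilation by `c` slightly
  -- above `1` moves it into the open annulus while `g` stays nonzero, contradicting `V = ∅`.
  have hc : ContinuousAt (fun c : ℝ => dil c q) 1 := by
    unfold dil; fun_prop
  have hev : ∀ᶠ c in 𝓝 (1 : ℝ), dil c q ∈ {0}ᶜ ∩ g ⁻¹' {0}ᶜ ∧ rho (dil c q) < max 1 r := by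
    refine (hc.eventually_mem ((hg.isOpen_inter_preimage isOpen_compl_zero
      isOpen_compl_singleton).mem_nhds ?_)).and
      ((continuous_rho.continuousAt.comp hc).eventually_lt continuousAt_const ?_)
    · rw [dil_one]; exact ⟨hq0, hgq⟩
    · rw [Function.comp_apply, dil_one]; exact hn.2
  obtain ⟨c, ⟨h1, h2⟩, hc1⟩ :=
    ((hev.filter_mono nhdsWithin_le_nhds).and (self_mem_nhdsWithin (s := Set.Ioi (1 : ℝ)))).exists
  have hc1 : (1 : ℝ) < c := hc1
  have : dil c q ∈ V := by
    refine ⟨h1, ?_, h2⟩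
    rw [rho_dil (by positivity)]
    have := rho_pos hq0
    nlinarith [hn.1]
  rw [hVe] at this
  exact this

/-- For `z ≠ 0` the whole vertical line is available, so `g(z, t)` does not depend on `t`.
Contracting by `δ_a` and readjusting the height to `1` gives `g(z, t) = g(aⁿz, 1)`, which tends to
`g(0, 1)`. The punctured `t`-axis follows by continuity. -/
lemma const_of_fderiv_vertical {r : ℝ} (hr : 0 < r) (hr1 : r ≠ 1) {g : Heis → ℂ}
    (hg : DifferentiableOn ℝ g {0}ᶜ) (hinv : ∀ p, p ≠ 0 → g (dil r p) = g p)
    (hT : ∀ p, p ≠ 0 → fderiv ℝ g p (0, 1) = 0) {p : Heis} (hp : p ≠ 0) : g p = g (0, 1) := by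
  obtain ⟨a, ha0, ha1, ha⟩ : ∃ a : ℝ, 0 < a ∧ a < 1 ∧ ∀ p, p ≠ 0 → g (dil a p) = g p := by
    rcases lt_or_gt_of_ne hr1 with h | h
    · exact ⟨r, hr, h, hinv⟩
    · refine ⟨r⁻¹, inv_pos.2 hr, inv_lt_one_of_one_lt₀ h, fun p hp => ?_⟩
      rw [← hinv _ (dil_ne_zero (inv_ne_zero hr.ne') hp), dil_dil_inv hr.ne']
  have hdiff : ∀ p : Heis, p ≠ 0 → DifferentiableAt ℝ g p := fun p hp =>
    (hg p hp).differentiableAt (isOpen_compl_zero.mem_nhds hp)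
  have hvert : ∀ z : ℂ, z ≠ 0 → ∀ s t : ℝ, g (z, s) = g (z, t) := fun z hz s t => by
    have hne : ∀ t : ℝ, ((z, t) : Heis) ≠ 0 := fun t h => hz (congrArg Prod.fst h)
    have hd : ∀ t : ℝ, HasDerivAt (fun t : ℝ => g (z, t)) 0 t := fun t => by
      have h1 : HasDerivAt (fun t : ℝ => ((z, t) : Heis)) (0, 1) t :=
        (hasDerivAt_const t z).prodMk (hasDerivAt_id t)
      have := (hdiff (z, t) (hne t)).hasFDerivAt.comp_hasDerivAt t h1
      rwa [hT _ (hne t)] at this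
    exact is_const_of_deriv_eq_zero (fun t => (hd t).differentiableAt) (fun t => (hd t).deriv) s t
  have h01 : ((0, 1) : Heis) ≠ 0 := fun h => one_ne_zero (congrArg Prod.snd h)
  have hz : ∀ z : ℂ, z ≠ 0 → ∀ t : ℝ, g (z, t) = g (0, 1) := fun z hz t => by
    have h1 : ∀ n : ℕ, g ((a ^ n) • z, 1) = g (z, t) := fun n => by
      have h2 := dil_zpow_invariant ha0.ne' ha n (p := (z, t)) fun h => hz (congrArg Prod.fst h)
      rw [← h2, zpow_natCast]
      exact hvert _ (smul_ne_zero (pow_ne_zero _ ha0.ne') hz) _ _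
    have h3 : Filter.Tendsto (fun n : ℕ => (((a ^ n) • z, 1) : Heis)) Filter.atTop (𝓝 (0, 1)) := by
      refine Filter.Tendsto.prodMk_nhds ?_ tendsto_const_nhds
      have := (tendsto_pow_atTop_nhds_zero_of_lt_one ha0.le ha1).smul_const z
      rwa [zero_smul] at this
    have h4 := (hdiff _ h01).continuousAt.tendsto.comp h3
    exact tendsto_nhds_unique (tendsto_const_nhds.congr fun n => (h1 n).symm) h4
  obtain ⟨z, t⟩ := p
  by_cases hz0 : z = 0
  · subst hz0
    have h1 : Filter.Tendsto (fun w : ℂ => ((w, t) : Heis)) (𝓝[≠] 0) (𝓝 (0, t)) :=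
      Filter.Tendsto.prodMk_nhds nhdsWithin_le_nhds tendsto_const_nhds
    have h2 := (hdiff _ hp).continuousAt.tendsto.comp h1
    have h3 : Filter.Tendsto (g ∘ fun w : ℂ => ((w, t) : Heis)) (𝓝[≠] 0) (𝓝 (g (0, 1))) :=
      tendsto_const_nhds.congr' (by
        filter_upwards [self_mem_nhdsWithin] with w hw
        exact (hz w hw t).symm)
    exact tendsto_nhds_unique h2 h3
  · exact hz z hz0 t

lemma intF_mul_conj (r : ℝ) (k : SF) :
    intF r (k * conj k) = ((∫ p in fundDomain r, Complex.normSq (k.ext p) : ℝ) : ℂ) := by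
  rw [intF, ← integral_complex_ofReal]
  congr 1
  funext p
  rw [SF.ext_mul, conj_ext, ← Complex.mul_conj]
  rfl

section Rigidity

variable {r : ℝ} (hr : 0 < r) (hr1 : r ≠ 1) {v : SF} (hv : IsHom r 0 v) (hpv : IsPH v)
include hr hr1 hv hpv

/-- The energy `∫ (Δv)²` is real and nonnegative. -/
lemma intF_lapS_sq_eq : intF r (lapS v * lapS v)
    = ((2 * ∫ p in fundDomain r, Complex.normSq ((dW (dZ v)).ext p) : ℝ) : ℂ) := by
  rw [intF_lapS_sq hr hr1 hv hpv, intF_mul_conj]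
  push_cast; rfl

/-- Zero energy gives `Z̄Zv = 0`, conjugation gives `ZZ̄v = 0`, and `[Z̄, Z] = 2i∂ₜ` yields `∂ₜv =
0`. -/
lemma const_of_intF_lapS_sq (h : intF r (lapS v * lapS v) = 0) {p : Heis} (hp : p ≠ 0) :
    v.ext p = v.ext (0, 1) := by
  have hr' : (r : ℂ) ≠ 0 := by exact_mod_cast hr.ne'
  rw [intF_lapS_sq_eq hr hr1 hv hpv, Complex.ofReal_eq_zero] at h
  have hk := (hv.dZ hr.ne').dW hr.ne'
  have hk0 : dW (dZ v) = 0 := SF.eq_of_forall fun q => by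
    have := eq_zero_of_setIntegral_fundDomain hr hr1
      (Complex.continuous_normSq.comp_continuousOn (dW (dZ v)).contDiffOn_ext.continuousOn)
      (fun p => Complex.normSq_nonneg _) (fun p hp => by
        rw [Function.comp_apply, Function.comp_apply, Complex.normSq_eq_zero,
          Complex.normSq_eq_zero, hk p hp, mul_eq_zero, or_iff_right (zpow_ne_zero _ hr')])
      (by simpa using h) q.2
    rw [Function.comp_apply, Complex.normSq_eq_zero, SF.ext_coe] at this
    exact this
  have hT : dT v = 0 := by
    have h1 := dW_dZ v
    have h2 : dZ (dW v) = 0 := by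
      rw [← hpv.1, dW_conj, dZ_conj, hk0, map_zero]
    rw [hk0, h2, zero_add] at h1
    exact ((smul_eq_zero.1 h1.symm).resolve_left (by simp))
  refine const_of_fderiv_vertical hr hr1 (fun p hp => (v.differentiableAt_ext hp).differentiableWithinAt)
    (fun p hp => by rw [hv p hp]; simp) (fun q hq => ?_) hp
  have := congrArg (fun f => f.val ⟨q, hq⟩) hT
  simpa [dT, vfDeriv_apply] using this

end Rigidity

/-! ### Pluriharmonic functions as solutions of `Z̄Z̄Z v = 0` -/

/-- `f` vanishes on `N`. -/
def VanishesOn (N : Set Heis) (f : SF) : Prop := ∀ p : Punctured, p.1 ∈ N → f.val p = 0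

namespace VanishesOn

variable {N : Set Heis} {f g : SF}

lemma add (hf : VanishesOn N f) (hg : VanishesOn N g) : VanishesOn N (f + g) := fun p hp => by
  rw [SF.val_add, hf p hp, hg p hp, add_zero]

lemma smul (c : ℂ) (hf : VanishesOn N f) : VanishesOn N (c • f) := fun p hp => by
  rw [SF.val_smul, hf p hp, mul_zero]

lemma conj (hf : VanishesOn N f) : VanishesOn N (conj f) := fun p hp => by
  rw [conj_apply, hf p hp, star_zero]

variable (hN : IsOpen N)
include hN

lemma vfDeriv (V : Heis → Heis) (hV : ContDiff ℝ ∞ V) (hf : VanishesOn N f) :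
    VanishesOn N (vfDeriv V hV f) := fun p hp => by
  have h : f.ext =ᶠ[𝓝 p.1] fun _ => 0 :=
    Filter.eventually_of_mem ((hN.inter isOpen_compl_zero).mem_nhds ⟨hp, p.2⟩) fun q hq => by
      rw [f.ext_of_ne hq.2]; exact hf ⟨q, hq.2⟩ hq.1
  rw [vfDeriv_apply, h.fderiv_eq]
  simp

lemma dZ (hf : VanishesOn N f) : VanishesOn N (dZ f) := by
  have h := ((hf.vfDeriv hN X contDiff_X).add
    ((hf.vfDeriv hN Y contDiff_Y).smul (-Complex.I))).smul (1 / 2)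
  convert h using 1
  simp only [HeisCR.dZ, dX, dY, Derivation.smul_apply, Derivation.sub_apply]
  module

lemma dW (hf : VanishesOn N f) : VanishesOn N (dW f) :=
  ((hf.vfDeriv hN X contDiff_X).add ((hf.vfDeriv hN Y contDiff_Y).smul Complex.I)).smul (1 / 2)

end VanishesOn

/-- If `v = Re g` with `g` CR near a point, then `Z̄Zg = 2i∂ₜg` is again CR, since `∂ₜ` commutes
with `Z̄`, and `Zḡ = 0`. -/
lemma dW_dW_dZ_vanishesOn {N : Set Heis} (hN : IsOpen N) {v g : SF}
    (hv : VanishesOn N (v + (-(1 / 2) : ℂ) • (g + conj g))) (hg : VanishesOn N (dW g)) :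
    VanishesOn N (dW (dW (dZ v))) := by
  have h1 : dW (dW (dZ v)) = dW (dW (dZ (v + (-(1 / 2) : ℂ) • (g + conj g))))
      + (1 / 2 : ℂ) • (dW (dZ (dW g) + (2 * Complex.I) • dT g) + dW (dW (conj (dW g)))) := by
    rw [← dW_dZ, ← dZ_conj]
    simp only [map_add, Derivation.map_smul]
    module
  rw [h1]
  refine ((hv.dZ hN).dW hN |>.dW hN).add (VanishesOn.smul _ (VanishesOn.add ?_
    ((hg.conj.dW hN).dW hN)))
  rw [map_add, Derivation.map_smul, ← dT_dW]
  exact ((hg.dZ hN).dW hN).add ((hg.vfDeriv hN _ _).smul _)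

/-- A bump function extends a local function to an element of `SF`, so that the derivation calculus
applies to local CR functions. -/
lemma exists_eqOn_nhds {U : Set Heis} (hU : IsOpen U) {f : Heis → ℂ} (hf : ContDiffOn ℝ ∞ f U)
    {p : Heis} (hp : p ∈ U) :
    ∃ (g : SF) (N : Set Heis), IsOpen N ∧ p ∈ N ∧ N ⊆ U ∧ ∀ q ∈ N, q ≠ 0 → g.ext q = f q := by
  obtain ⟨ε, hε, hball⟩ := Metric.isOpen_iff.1 hU p hp
  let χ : ContDiffBump p := ⟨ε / 3, ε / 2, by positivity, by linarith⟩
  have hsub : Metric.closedBall p (ε / 2) ⊆ U :=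
    (Metric.closedBall_subset_ball (by linarith)).trans hball
  have hsm : ContDiff ℝ ∞ (fun q => (χ q : ℝ) • f q) := by
    refine contDiff_iff_contDiffAt.2 fun q => ?_
    by_cases hq : q ∈ U
    · exact χ.contDiffAt.smul (hf.contDiffAt (hU.mem_nhds hq))
    · have h1 : (fun q => (χ q : ℝ) • f q) =ᶠ[𝓝 q] fun _ => 0 := by
        refine Filter.eventually_of_mem ((Metric.isClosed_closedBall (x := p)
          (ε := ε / 2)).isOpen_compl.mem_nhds fun h => hq (hsub h)) fun q' hq' => ?_
        change χ q' • f q' = 0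
        rw [χ.zero_of_le_dist (by
          rw [Set.mem_compl_iff, Metric.mem_closedBall, not_le] at hq'; exact hq'.le), zero_smul]
      exact contDiffAt_const.congr_of_eventuallyEq h1
  refine ⟨SF.mk _ hsm.contDiffOn, Metric.ball p (ε / 3), Metric.isOpen_ball,
    Metric.mem_ball_self (by positivity), (Metric.ball_subset_ball (by linarith)).trans hball,
    fun q hq hq0 => ?_⟩
  rw [SF.ext_mk _ _ hq0, χ.one_of_mem_closedBall (Metric.ball_subset_closedBall hq), one_smul]

/-- A CR function `f` with real part `v` must satisfy `Zf = 2Zv`, `Z̄f = 0` and, by the commutator,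
`∂ₜf = -iZ̄Zv`. The one-form with these components is closed exactly because `v` is in the kernel of
`Z̄Z̄Z`; it is integrated on a ball by the Poincaré lemma. -/
lemma exists_conjugate {v : SF} (hv : IsPH v) {p : Heis} (hp : p ≠ 0) :
    ∃ (U : Set Heis) (f : Heis → ℂ), IsOpen U ∧ p ∈ U ∧ ContDiffOn ℝ ∞ f U ∧
      ∀ q ∈ U, q ≠ 0 ∧ Zbar f q = 0 ∧ v.ext q = ((f q).re : ℂ) := by
  obtain ⟨ε, hε, hball⟩ := Metric.isOpen_iff.1 isOpen_compl_zero p hp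
  set U := Metric.ball p ε with hU
  have hUo : IsOpen U := Metric.isOpen_ball
  set a : SF := (2 : ℂ) • dZ v with ha
  set b : SF := (-Complex.I) • dW (dZ v) with hb
  set L : Heis → Heis →L[ℝ] ℂ := fun q => a.ext q • (ContinuousLinearMap.fst ℝ ℂ ℝ : Heis →L[ℝ] ℂ)
    + b.ext q • Complex.ofRealCLM.comp ((2 : ℝ) • theta0 q) with hL
  have hLs : ContDiffOn ℝ ∞ L {0}ᶜ := by
    refine (a.contDiffOn_ext.smul contDiffOn_const).add (b.contDiffOn_ext.smul ?_)
    exact ((contDiff_const (c := Complex.ofRealCLM)).clm_comp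
      (contDiff_theta0.const_smul (2 : ℝ))).contDiffOn
  have hLapply : ∀ q V, L q V = a.ext q * V.1 + b.ext q * (2 * theta0 q V) := fun q V => by
    simp [hL]
  have hdL : ∀ q, q ≠ 0 → ∀ V W, fderiv ℝ L q V W = fderiv ℝ a.ext q V * W.1
      + fderiv ℝ b.ext q V * (2 * theta0 q W) + b.ext q * (2 * theta0Deriv V W) := by
    intro q hq V W
    have h1 : HasFDerivAt (fun q => L q W) ((ContinuousLinearMap.apply ℝ ℂ W).comp
        (fderiv ℝ L q)) q :=
      (ContinuousLinearMap.apply ℝ ℂ W).hasFDerivAt.comp q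
        ((hLs.contDiffAt (isOpen_compl_zero.mem_nhds hq)).differentiableAt (by simp)).hasFDerivAt
    have h2 : HasFDerivAt (fun q => (theta0 q W : ℂ)) (Complex.ofRealCLM.comp
        ((ContinuousLinearMap.apply ℝ ℝ W).comp theta0Deriv)) q :=
      Complex.ofRealCLM.hasFDerivAt.comp q ((ContinuousLinearMap.apply ℝ ℝ W).hasFDerivAt.comp q
        (hasFDerivAt_theta0 q))
    have h3 := (((a.differentiableAt_ext hq).hasFDerivAt.mul_const W.1).add
      ((b.differentiableAt_ext hq).hasFDerivAt.mul (h2.const_mul 2)))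
    have h4 : (fun q => L q W) = fun q => a.ext q * W.1 + b.ext q * (2 * theta0 q W) :=
      funext fun q => hLapply q W
    rw [h4] at h1
    have h5 := congrArg (fun T => T V) (h1.unique h3)
    simp only [ContinuousLinearMap.comp_apply, ContinuousLinearMap.apply_apply] at h5
    rw [h5]
    simp
    ring
  have hZW := dW_dZ v
  have hWa : dW a = (2 * Complex.I) • b := by
    rw [ha, hb, Derivation.map_smul, smul_smul]; congr 1
    linear_combination 2 * Complex.I_mul_I
  have hWb : dW b = 0 := by rw [hb, Derivation.map_smul, hv.2, smul_zero]
  -- Together with `hWa` and `hWb`, this is the closedness of `a dz + 2b θ₀` in the frame.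
  have hTa : dT a = dZ b := by
    have h1 := hv.isPair.WZZ
    rw [dW_dZ, two_mul (dZ (dW (dZ v))), add_right_inj, dT_dZ] at h1
    rw [ha, hb, Derivation.map_smul, Derivation.map_smul, dT_dZ, ← h1, smul_smul]; congr 1
    linear_combination 2 * Complex.I_mul_I
  have hclosed : ∀ q ∈ U, ∀ V W, fderiv ℝ L q V W = fderiv ℝ L q W V := by
    intro q hqU V W
    have hq : q ≠ 0 := hball hqU
    have e1 : Zbar a.ext q = 2 * Complex.I * b.ext q := by
      rw [← dW_apply a ⟨q, hq⟩, hWa, b.ext_of_ne hq]; rfl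
    have e2 : Zbar b.ext q = 0 := by rw [← dW_apply b ⟨q, hq⟩, hWb]; rfl
    have e3 : fderiv ℝ a.ext q (0, 1) = Z b.ext q := by
      rw [← dZ_apply b ⟨q, hq⟩, ← hTa]; rfl
    rw [hdL q hq, hdL q hq, fderiv_frame a.ext q V, fderiv_frame a.ext q W, fderiv_frame b.ext q V,
      fderiv_frame b.ext q W, e1, e2, e3, theta0Deriv_apply, theta0Deriv_apply]
    have key : star V.1 * W.1 - star W.1 * V.1
        = 2 * Complex.I * (V.1.re * W.1.im - V.1.im * W.1.re) := by
      apply Complex.ext <;> simp <;> ring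
    push_cast
    linear_combination (2 * Complex.I * b.ext q) * key
      + (4 * b.ext q * (V.1.re * W.1.im - V.1.im * W.1.re)) * Complex.I_mul_I
  obtain ⟨f, hf⟩ := (convex_ball p ε).exists_forall_hasFDerivAt_of_fderiv_symmetric hUo
    ((hLs.mono hball).differentiableOn (by simp)) hclosed
  have hfs : ContDiffOn ℝ ∞ f U := by
    rw [contDiffOn_infty_iff_fderiv_of_isOpen hUo]
    refine ⟨fun q hq => (hf q hq).differentiableAt.differentiableWithinAt, ?_⟩
    exact (hLs.mono hball).congr fun q hq => (hf q hq).fderiv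
  have hvre : ∀ q ∈ U, v.ext q = ((v.ext q).re : ℂ) := fun q hq => by
    have h1 := congrArg (fun f => f.ext q) hv.1
    simp only [conj_ext] at h1
    exact (Complex.conj_eq_iff_re.1 h1).symm
  -- The primitive is determined up to a constant: `d(Re f) = dv` on the ball, and the resulting
  -- real constant `c` is subtracted from `f`.
  have hder : ∀ q ∈ U, HasFDerivAt (fun q => (f q).re - (v.ext q).re) (0 : Heis →L[ℝ] ℝ) q := by
    intro q hqU
    have hq : q ≠ 0 := hball hqU
    have h1 := (Complex.reCLM.hasFDerivAt.comp q (hf q hqU)).sub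
      (Complex.reCLM.hasFDerivAt.comp q (v.differentiableAt_ext hq).hasFDerivAt)
    refine h1.congr_fderiv (ContinuousLinearMap.ext fun V => ?_)
    have e1 : a.ext q = 2 * Z v.ext q := by
      rw [ha, SF.ext_of_ne _ hq, SF.val_smul, dZ_apply]
    have e2 : Zbar v.ext q = star (Z v.ext q) := by
      rw [← dZ_apply v ⟨q, hq⟩, ← dW_apply v ⟨q, hq⟩, ← conj_apply, ← dW_conj, hv.1]
    have e3 : (b.ext q).re = (fderiv ℝ v.ext q (0, 1)).re := by
      have h2 : dW (dZ v) - conj (dW (dZ v)) = (2 * Complex.I) • dT v := by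
        rw [← dZ_conj, ← dW_conj, hv.1, sub_eq_iff_eq_add', ← dW_dZ]
      have h3 := congrArg (fun f => f.val ⟨q, hq⟩) h2
      simp only [SF.val_sub, conj_apply, SF.val_smul, dT, vfDeriv_apply] at h3
      rw [hb, SF.ext_of_ne _ hq, SF.val_smul]
      have h4 := congrArg Complex.im h3
      simp at h4
      simp
      linarith
    have e4 : (b.ext q * (2 * theta0 q V)).re = 2 * theta0 q V * (b.ext q).re := by
      rw [mul_comm, ← Complex.ofReal_ofNat, ← Complex.ofReal_mul, Complex.re_ofReal_mul]
    have e5 : (2 * theta0 q V * fderiv ℝ v.ext q (0, 1)).re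
        = 2 * theta0 q V * (fderiv ℝ v.ext q (0, 1)).re := by
      rw [← Complex.ofReal_ofNat, ← Complex.ofReal_mul, Complex.re_ofReal_mul]
    simp only [sub_apply, ContinuousLinearMap.comp_apply, Complex.reCLM_apply, zero_apply]
    rw [hLapply, fderiv_frame v.ext q V, Complex.add_re, Complex.add_re, e4, e5, e3, e1, e2]
    simp
    ring
  obtain ⟨c, hc⟩ := hUo.exists_is_const_of_fderiv_eq_zero (convex_ball p ε).isPreconnected
    (fun q hq => (hder q hq).differentiableAt.differentiableWithinAt)
    (fun q hq => (hder q hq).fderiv)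
  refine ⟨U, fun q => f q - c, hUo, Metric.mem_ball_self hε, hfs.sub contDiffOn_const,
    fun q hq => ⟨hball hq, ?_, ?_⟩⟩
  · rw [Zbar, ((hf q hq).sub_const (c : ℂ)).fderiv, hLapply, hLapply, theta0_X, theta0_Y]
    simp only [X, Y, Complex.ofReal_zero, mul_zero]
    linear_combination (a.ext q / 2) * Complex.I_mul_I
  · rw [hvre q hq]
    congr 1
    have := hc q hq
    simp at this ⊢
    linarith

/-! ### Functions on the quotient and their pullbacks. -/

section Quotient

variable {r : ℝ}

lemma lift_of_ne (w : M r → ℝ) {p : Heis} (hp : p ≠ 0) : lift w p = w (Quot.mk _ ⟨p, hp⟩) := by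
  simp [lift, hp]

lemma mk_dil (hr : r ≠ 0) {p : Heis} (hp : p ≠ 0) :
    (Quot.mk _ ⟨dil r p, dil_ne_zero hr hp⟩ : M r) = Quot.mk _ ⟨p, hp⟩ :=
  (Quot.sound (r := fun p q : Punctured => q.1 = dil r p.1) (a := ⟨p, hp⟩) rfl).symm

lemma lift_dil (hr : r ≠ 0) (w : M r → ℝ) {p : Heis} (hp : p ≠ 0) :
    lift w (dil r p) = lift w p := by
  rw [lift_of_ne w hp, lift_of_ne w (dil_ne_zero hr hp), mk_dil hr hp]

lemma lift_descend {f : Heis → ℝ} (hf : ∀ p, p ≠ 0 → f (dil r p) = f p) {p : Heis} (hp : p ≠ 0) :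
    lift (descend f : M r → ℝ) p = f p := by
  rw [lift_of_ne _ hp, descend]
  let g : M r → ℝ := Quot.lift (fun q : Punctured => f q.1) fun a b hab => by
    rw [hab, hf _ a.2]
  have h1 : ∀ m : M r, f m.out.1 = g m := fun m => congrArg g (Quot.out_eq m)
  rw [h1]

/-- The pullback of a smooth function as an element of `SF`. -/
def IsSmooth.toSF {w : M r → ℝ} (h : IsSmooth w) : SF := SF.ofReal (lift w) h

lemma IsSmooth.toSF_val {w : M r → ℝ} (h : IsSmooth w) (p : Punctured) :
    h.toSF.val p = (lift w p : ℂ) := rfl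

lemma IsSmooth.isHom (hr : r ≠ 0) {w : M r → ℝ} (h : IsSmooth w) : IsHom r 0 h.toSF :=
  fun p hp => by
    rw [SF.ext_of_ne _ hp, SF.ext_of_ne _ (dil_ne_zero hr hp)]
    simp [IsSmooth.toSF_val, lift_dil hr w hp]

theorem mem_pluriharmonic_iff {w : M r → ℝ} :
    w ∈ pluriharmonic r ↔ ∃ h : IsSmooth w, IsPH h.toSF := by
  refine ⟨fun ⟨h, hw⟩ => ⟨h, conj_ofReal _ _, SF.eq_of_forall fun p => ?_⟩, fun ⟨h, hw⟩ =>
    ⟨h, fun p hp => ?_⟩⟩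
  · obtain ⟨U, f, hU, hpU, hf, hUf⟩ := hw p p.2
    obtain ⟨g, N, hN, hpN, hNU, hg⟩ := exists_eqOn_nhds hU hf hpU
    refine dW_dW_dZ_vanishesOn hN (g := g) (fun q hq => ?_) (fun q hq => ?_) p hpN
    · have h1 : g.val q = f q := by rw [← hg q hq q.2, g.ext_coe]
      have h2 := (hUf q (hNU hq) q.2).2
      simp only [SF.val_add, SF.val_smul, conj_apply, h1, IsSmooth.toSF_val, h2]
      apply Complex.ext <;> simp
      ring
    · have h1 : g.ext =ᶠ[𝓝 q.1] f := Filter.eventually_of_mem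
        ((hN.inter isOpen_compl_zero).mem_nhds ⟨hq, q.2⟩) fun q' hq' => hg q' hq'.1 hq'.2
      rw [dW_apply, Zbar, h1.fderiv_eq]
      exact (hUf q (hNU hq) q.2).1
  · obtain ⟨U, f, hU, hpU, hf, hUf⟩ := exists_conjugate hw hp
    refine ⟨U, f, hU, hpU, hf, fun q hq hq0 => ⟨(hUf q hq).2.1, ?_⟩⟩
    have h1 := (hUf q hq).2.2
    rw [SF.ext_of_ne _ hq0] at h1
    exact Complex.ofReal_injective h1

end Quotient

/-! ### Contact forms on the quotient -/

lemma sS_val (p : Punctured) : sS.val p = ((-Real.log (rho p ^ 2) : ℝ) : ℂ) := by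
  have h1 : (Complex.log (qS.val p)).re = Real.log (rho p ^ 2) := by
    rw [Complex.log_re, norm_qS]
  simp only [sS, SF.val_smul, SF.val_add, conj_apply, logS_val]
  rw [← h1]
  apply Complex.ext <;> simp
  ring

lemma exp_neg_log_rho_sq {p : Heis} (hp : p ≠ 0) :
    Real.exp (-Real.log (rho p ^ 2)) = (rho p ^ 2)⁻¹ := by
  rw [Real.exp_neg, Real.exp_log (pow_pos (rho_pos hp) 2)]

lemma contDiffOn_log_rho_sq : ContDiffOn ℝ ∞ (fun p => -Real.log (rho p ^ 2)) {0}ᶜ := by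
  have h := Complex.reCLM.contDiff.comp_contDiffOn sS.contDiffOn_ext
  refine h.congr fun p hp => ?_
  rw [Function.comp_apply, sS.ext_of_ne hp, sS_val]
  rfl

lemma isExpForm_theta1 : IsExpForm theta1 (fun p => -Real.log (rho p ^ 2)) :=
  ⟨contDiffOn_log_rho_sq, fun p hp => by rw [exp_neg_log_rho_sq hp]; rfl⟩

lemma isExpForm_theta1_s : isExpForm_theta1.s = sS :=
  SF.eq_of_forall fun p => by rw [sS_val]; rfl

lemma theta0_dil (r : ℝ) (p V : Heis) : theta0 (dil r p) (dil r V) = r ^ 2 * theta0 p V := by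
  simp only [theta0_apply, dil, Complex.smul_re, Complex.smul_im, smul_eq_mul]
  ring

/-- The form `θ₀` scales by `r²`, so invariance of `e^σ θ₀` means that `e^σ` scales by `r⁻²`,
exactly as `ρ⁻²` does. -/
lemma isHom_zero_iff {r : ℝ} (hr : 0 < r) {θ : Heis → Heis →L[ℝ] ℝ} {σ : Heis → ℝ}
    (h : IsExpForm θ σ) :
    IsHom r 0 (h.s - sS) ↔ ∀ p, p ≠ 0 → Real.exp (σ (dil r p)) * r ^ 2 = Real.exp (σ p) := by
  refine forall₂_congr fun p hp => ?_
  have hd := dil_ne_zero hr.ne' hp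
  rw [SF.ext_of_ne _ hp, SF.ext_of_ne _ hd, SF.val_sub, SF.val_sub, sS_val, sS_val]
  change (σ (dil r p) : ℂ) - _ = _ * ((σ p : ℂ) - _) ↔ _
  rw [zpow_zero, one_mul, ← Complex.ofReal_sub, ← Complex.ofReal_sub, Complex.ofReal_inj,
    rho_dil hr, mul_pow, Real.log_mul (by positivity) (pow_pos (rho_pos hp) 2).ne',
    show Real.exp (σ (dil r p)) * r ^ 2 = Real.exp (σ (dil r p) + Real.log (r ^ 2)) by
      rw [Real.exp_add, Real.exp_log (by positivity)], Real.exp_eq_exp]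
  constructor <;> intro H <;> linarith

namespace IsContactForm

variable {r : ℝ} {θ : Heis → Heis →L[ℝ] ℝ} (hc : IsContactForm r θ)
include hc

lemma eq_smul_theta0 {p : Heis} (hp : p ≠ 0) : θ p = (2 * θ p (0, 1)) • theta0 p := by
  refine clm_ext_frame p ?_ ?_ ?_
  · rw [hc.ker_X p hp]; simp
  · rw [hc.ker_Y p hp]; simp
  · simp [theta0_apply]; ring

lemma contDiffOn_coeff : ContDiffOn ℝ ∞ (fun p => 2 * θ p (0, 1)) {0}ᶜ :=
  contDiffOn_const.mul (hc.smooth.clm_apply contDiffOn_const)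

/-- The coefficient of `θ₀` equals the Levi form, because the term with its derivative vanishes on
the kernel. -/
lemma coeff_pos {p : Heis} (hp : p ≠ 0) : 0 < 2 * θ p (0, 1) := by
  have h0 := (hc.contDiffOn_coeff.contDiffAt (isOpen_compl_zero.mem_nhds hp)).differentiableAt
    (by simp)
  have h1 := (h0.hasFDerivAt.smul (hasFDerivAt_theta0 p)).congr_of_eventuallyEq
    (eventuallyEq_of_compl_zero (fun q hq => hc.eq_smul_theta0 hq) hp)
  have h2 := hc.levi_pos p hp
  rw [levi, dform, h1.fderiv] at h2
  simp [theta0Deriv_apply, X, Y] at h2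
  have e1 := theta0_X p
  have e2 := theta0_Y p
  simp only [X, Y, neg_mul] at e1 e2
  simp [e1, e2] at h2
  linarith

lemma isExpForm : IsExpForm θ (fun p => Real.log (2 * θ p (0, 1))) :=
  ⟨hc.contDiffOn_coeff.log fun p hp => (hc.coeff_pos hp).ne', fun p hp => by
    rw [Real.exp_log (hc.coeff_pos hp)]; exact hc.eq_smul_theta0 hp⟩

lemma isHom (hr : 0 < r) : IsHom r 0 (hc.isExpForm.s - sS) := by
  refine (isHom_zero_iff hr _).2 fun p hp => ?_
  rw [Real.exp_log (hc.coeff_pos hp), Real.exp_log (hc.coeff_pos (dil_ne_zero hr.ne' hp)),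
    ← hc.invariant p hp (0, 1)]
  have : dil r ((0, 1) : Heis) = r ^ 2 • ((0, 1) : Heis) := by simp [dil]
  rw [this, map_smul, smul_eq_mul]
  ring

end IsContactForm

lemma IsExpForm.isContactForm {r : ℝ} (hr : 0 < r) {θ : Heis → Heis →L[ℝ] ℝ} {σ : Heis → ℝ}
    (h : IsExpForm θ σ) (hu : IsHom r 0 (h.s - sS)) : IsContactForm r θ where
  smooth := (h.smooth.exp.smul contDiff_theta0.contDiffOn).congr h.eq
  ne_zero p hp h0 := by
    have := congrArg (fun L => L (0, 1)) (h.eq p hp)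
    rw [h0] at this
    simp [theta0_apply] at this
  ker_X p hp := by rw [h.eq p hp]; simp
  ker_Y p hp := by rw [h.eq p hp]; simp
  levi_pos p hp := by rw [h.levi_eq hp]; exact Real.exp_pos _
  invariant p hp V := by
    have := (isHom_zero_iff hr h).1 hu p hp
    rw [h.eq _ (dil_ne_zero hr.ne' hp), h.eq p hp, smul_apply, smul_apply, theta0_dil, ← this,
      smul_eq_mul, smul_eq_mul]
    ring

lemma IsExpForm.conformal {r : ℝ} {θ : Heis → Heis →L[ℝ] ℝ} {σ : Heis → ℝ}
    (h : IsExpForm θ σ) {w : M r → ℝ} (hw : IsSmooth w) :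
    IsExpForm (conformal w θ) (fun p => lift w p + σ p) :=
  ⟨hw.add h.smooth, fun p hp => by
    rw [HeisCR.conformal, h.eq p hp, smul_smul, Real.exp_add]⟩

/-! ### The densities of `P₄'` and `Q₄'` -/

/-- The density `e^{2σ} P₄' v` for `σ = -log ρ² + u`. -/
def densP (u v : SF) : SF := 4 * aBi dZ dW v + 4 * aPan dZ dW ((sS + u) * v)

/-- The density `e^{2σ} Q₄'` for `σ = -log ρ² + u`. -/
def densQ (u : SF) : SF := 4 * aBi dZ dW (sS + u) + 2 * aPan dZ dW ((sS + u) * (sS + u))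

/-- Expanding `(s + u)²` isolates the contribution of `s` alone, which is `-2P(φ²)`; the mixed term
and `ΔΔu` form `densP 0 u`. Everything is now expressed so that it pairs with pluriharmonic
functions on the quotient. -/
lemma densQ_eq (u : SF) : densQ u = (-2 : ℂ) • aPan dZ dW (phiS * phiS)
    + (2 : ℂ) • aPan dZ dW (u * u) + densP 0 u := by
  have h1 : aPan dZ dW ((sS + u) * (sS + u))
      = aPan dZ dW (sS * sS) + 2 * aPan dZ dW (sS * u) + aPan dZ dW (u * u) := by
    rw [show (sS + u) * (sS + u) = sS * sS + (sS * u + sS * u) + u * u by ring]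
    simp only [aPan, map_add]; ring
  have h2 : aBi dZ dW (sS + u) = aBi dZ dW sS + aBi dZ dW u := by
    simp only [aBi, map_add]; ring
  have h3 : 4 * aBi dZ dW sS + 2 * aPan dZ dW (sS * sS) = (-2 : ℂ) • aPan dZ dW (phiS * phiS) := by
    rw [four_aBi_sS, aPan_phiS_sq, neg_smul, two_smul]; ring
  rw [densQ, densP, h1, h2, ← h3, two_smul, add_zero]; ring

lemma densQ_const (c : ℂ) : densQ (algebraMap ℂ SF c) = 4 * (pS ^ 2 + conj pS ^ 2) := by
  have h1 : densP 0 (algebraMap ℂ SF c) = 0 := by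
    rw [densP, Algebra.algebraMap_eq_smul_one, mul_smul_comm, mul_one, add_zero]
    simp only [aBi, aPan, Derivation.map_smul, isPH_sS.2, Derivation.map_one_eq_zero, map_zero,
      add_zero, smul_zero, mul_zero]
  have h2 : aPan dZ dW (algebraMap ℂ SF c * algebraMap ℂ SF c) = 0 := by
    rw [← map_mul]
    simp only [aPan, Derivation.map_algebraMap, map_zero]
  rw [densQ_eq, h1, h2, aPan_phiS_sq, smul_zero, add_zero, add_zero,
    show (-2 : ℂ) • -(2 * (pS ^ 2 + conj pS ^ 2)) = (4 : ℂ) • (pS ^ 2 + conj pS ^ 2) by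
      rw [two_mul]; module, Algebra.smul_def, map_ofNat]

section Hom

variable {r : ℝ} (hr : 0 < r)
include hr

lemma isHom_aPan {g : SF} (hg : IsHom r 0 g) : IsHom r (-4) (aPan dZ dW g) :=
  (((hg.dZ hr.ne').dW hr.ne').dW hr.ne').dZ hr.ne'

/-- The product `s v` is not homogeneous, but by `aPan_mul` the operator sees only derivatives of
`s`. -/
lemma isHom_densP {u v : SF} (hu : IsHom r 0 u) (hv : IsHom r 0 v) (hpv : IsPH v) :
    IsHom r (-4) (densP u v) := by
  have e1 : (4 : SF) = (4 : ℂ) • (1 : SF) := by rw [← Algebra.algebraMap_eq_smul_one, map_ofNat]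
  have h1 : IsHom r (-4) (aBi dZ dW v) := by
    have h := hv.lapS hr.ne'
    exact ((h.dZ hr.ne').dW hr.ne').add ((h.dW hr.ne').dZ hr.ne')
  have h2 : aPan dZ dW ((sS + u) * v) = aPan dZ dW (sS * v) + aPan dZ dW (u * v) := by
    rw [add_mul]; simp only [aPan, map_add]
  rw [densP, h2, e1]
  simp only [smul_mul_assoc, one_mul]
  refine (h1.smul 4).add (((?_ : IsHom r (-4) _).add
    (isHom_aPan hr (hu.mul hr.ne' hv : IsHom r (0 + 0) _))).smul 4)
  rw [aPan_mul isPH_sS.isPair hpv.isPair]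
  exact (isHom_aPan_sS_mul hr hv).dZ hr.ne'

lemma isHom_densQ {u : SF} (hu : IsHom r 0 u) (hpu : IsPH u) : IsHom r (-4) (densQ u) := by
  rw [densQ_eq]
  exact (((isHom_aPan hr ((isHom_phiS hr).mul hr.ne' (isHom_phiS hr) :
    IsHom r (0 + 0) _)).smul _).add ((isHom_aPan hr (hu.mul hr.ne' hu :
    IsHom r (0 + 0) _)).smul _)).add (isHom_densP hr (fun p hp => by
      rw [SF.ext_of_ne _ hp, SF.ext_of_ne _ (dil_ne_zero hr.ne' hp)]; simp) hu hpu)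

variable (hr1 : r ≠ 1)
include hr1

lemma intF_mul_densP {u v w : SF} (hu : IsHom r 0 u) (hv : IsHom r 0 v) (hpv : IsPH v)
    (hw : IsHom r 0 w) (hpw : IsPH w) :
    intF r (v * densP u w) = 4 * intF r (lapS v * lapS w) := by
  have h1 : aPan dZ dW ((sS + u) * w) = aPan dZ dW (sS * w) + aPan dZ dW (u * w) := by
    rw [add_mul]; simp only [aPan, map_add]
  have e1 : (4 : SF) = (4 : ℂ) • (1 : SF) := by rw [← Algebra.algebraMap_eq_smul_one, map_ofNat]
  rw [densP, h1, e1, ← mul_add]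
  simp only [smul_mul_assoc, one_mul, mul_smul_comm, intF_smul]
  rw [mul_add, mul_add, intF_add hr, intF_add hr, intF_mul_aBi hr hr1 hv hw,
    intF_mul_aPan_sS_mul hr hr1 hv hpv hw hpw,
    intF_mul_aPan hr hr1 hv hpv ((hu.mul hr.ne' hw : IsHom r (0 + 0) _))]
  ring

lemma intF_mul_densQ {u v : SF} (hu : IsHom r 0 u) (hpu : IsPH u) (hv : IsHom r 0 v)
    (hpv : IsPH v) : intF r (v * densQ u) = 4 * intF r (lapS v * lapS u) := by
  rw [densQ_eq, mul_add, mul_add, intF_add hr, intF_add hr, mul_smul_comm, mul_smul_comm, intF_smul,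
    intF_smul, intF_mul_aPan hr hr1 hv hpv ((isHom_phiS hr).mul hr.ne' (isHom_phiS hr) :
      IsHom r (0 + 0) _), intF_mul_aPan hr hr1 hv hpv (hu.mul hr.ne' hu : IsHom r (0 + 0) _),
    intF_mul_densP hr hr1 (fun p hp => by
      rw [SF.ext_of_ne _ hp, SF.ext_of_ne _ (dil_ne_zero hr.ne' hp)]; simp) hv hpv hu hpu]
  ring

end Hom

/-! ### Integration on the quotient -/

section Measure

variable {r : ℝ}

lemma fundDomain_ne_zero (hr : 0 < r) {p : Heis} (hp : p ∈ fundDomain r) : p ≠ 0 :=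
  annulus_subset (lt_min one_pos hr) (max 1 r) ⟨hp.1, hp.2.le⟩

lemma measurableSet_fundDomain : MeasurableSet (fundDomain r) := measurableSet_annulus _ _

lemma measurableEmbedding_punctured : MeasurableEmbedding (Subtype.val : Punctured → Heis) :=
  MeasurableEmbedding.subtype_coe (s := {p : Heis | p ≠ 0}) isOpen_compl_zero.measurableSet

lemma range_punctured : Set.range (Subtype.val : Punctured → Heis) = {0}ᶜ := by
  ext p; simp

/-- The quotient carries the final `σ`-algebra, so measurability is tested on the pullback. -/
lemma measurable_of_continuousOn_lift {g : M r → ℝ} (hg : ContinuousOn (lift g) {0}ᶜ) :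
    Measurable g := by
  have h1 : Continuous (fun p : Punctured => g (Quot.mk _ p)) := by
    have h2 : (fun p : Punctured => g (Quot.mk _ p)) = fun p : Punctured => lift g p := by
      funext p; rw [lift_of_ne g p.2]
    rw [h2]
    exact hg.comp_continuous continuous_subtype_val fun p => p.2
  exact fun s hs => h1.measurable hs

lemma exists_bound_of_continuousOn_lift (hr : 0 < r) (hr1 : r ≠ 1) {g : M r → ℝ}
    (hg : ContinuousOn (lift g) {0}ᶜ) : ∃ C, ∀ m, ‖g m‖ ≤ C := by
  obtain ⟨C, hC⟩ := (isCompact_closedAnnulus (min 1 r) (max 1 r)).exists_bound_of_continuousOn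
    (hg.mono (annulus_subset (lt_min one_pos hr) _))
  refine ⟨C, fun m => ?_⟩
  induction m using Quot.ind with
  | mk p =>
    obtain ⟨n, hn⟩ := exists_zpow_dil_mem hr hr1 p.2
    rw [← lift_of_ne g p.2, ← dil_zpow_invariant hr.ne' (fun q hq => lift_dil hr.ne' g hq) n p.2]
    exact hC _ ⟨hn.1, hn.2.le⟩

variable (hr : 0 < r) {θ : Heis → Heis →L[ℝ] ℝ} {σ : Heis → ℝ} (h : IsExpForm θ σ)
include hr h

lemma IsExpForm.withDensity_eq : ((volume : Measure Heis).restrict (fundDomain r)).withDensity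
      (fun p => ENNReal.ofReal (volDensity θ p))
    = ((volume : Measure Heis).restrict (fundDomain r)).withDensity
      (fun p => ENNReal.ofReal (Real.exp (2 * σ p))) := by
  refine withDensity_congr_ae ?_
  filter_upwards [ae_restrict_mem measurableSet_fundDomain] with p hp
  rw [h.volDensity_eq (fundDomain_ne_zero hr hp)]

lemma IsExpForm.integrableOn_exp : IntegrableOn (fun p => Real.exp (2 * σ p)) (fundDomain r) :=
  integrableOn_fundDomain hr (contDiffOn_const.mul h.smooth).exp.continuousOn

lemma IsExpForm.isFiniteMeasure_vol : IsFiniteMeasure (vol r θ) := by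
  have h1 : IsFiniteMeasure (((volume : Measure Heis).restrict (fundDomain r)).withDensity
      (fun p => ENNReal.ofReal (volDensity θ p))) := by
    rw [h.withDensity_eq hr]
    exact isFiniteMeasure_withDensity_ofReal (h.integrableOn_exp hr).2
  have h2 : IsFiniteMeasure (Measure.comap (Subtype.val : Punctured → Heis)
      (((volume : Measure Heis).restrict (fundDomain r)).withDensity
      (fun p => ENNReal.ofReal (volDensity θ p)))) := by
    refine ⟨?_⟩
    rw [measurableEmbedding_punctured.comap_apply]
    exact measure_lt_top _ _
  exact Measure.isFiniteMeasure_map _ _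

lemma IsExpForm.integral_vol {g : M r → ℝ} (hg : Measurable g) :
    ∫ m, g m ∂(vol r θ) = ∫ p in fundDomain r, lift g p * Real.exp (2 * σ p) := by
  have h1 : ∀ p : Punctured, g (Quot.mk _ p) = lift g p := fun p => (lift_of_ne g p.2).symm
  rw [vol, integral_map measurable_quot_mk.aemeasurable hg.aestronglyMeasurable]
  simp only [h1]
  rw [← measurableEmbedding_punctured.integral_map (lift g), measurableEmbedding_punctured.map_comap,
    range_punctured, h.withDensity_eq hr, restrict_withDensity isOpen_compl_zero.measurableSet,
    Measure.restrict_restrict isOpen_compl_zero.measurableSet,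
    Set.inter_eq_right.2 (show fundDomain r ⊆ {0}ᶜ from fun p hp => fundDomain_ne_zero hr hp),
    integral_withDensity_eq_integral_toReal_smul₀]
  · refine setIntegral_congr_fun measurableSet_fundDomain fun p hp => ?_
    simp only [ENNReal.toReal_ofReal (Real.exp_pos _).le, smul_eq_mul, mul_comm]
  · exact (h.integrableOn_exp hr).aemeasurable.ennreal_ofReal
  · exact Filter.Eventually.of_forall fun p => ENNReal.ofReal_lt_top

lemma IsExpForm.memLp (hr1 : r ≠ 1) {g : M r → ℝ} (hg : ContinuousOn (lift g) {0}ᶜ) :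
    MemLp g 2 (vol r θ) := by
  have := h.isFiniteMeasure_vol hr
  obtain ⟨C, hC⟩ := exists_bound_of_continuousOn_lift hr hr1 hg
  exact MemLp.of_bound (measurable_of_continuousOn_lift hg).aestronglyMeasurable C
    (Filter.Eventually.of_forall hC)

end Measure

/-! ### The projection `τ` -/

section Tau

variable {r : ℝ} {θ : Heis → Heis →L[ℝ] ℝ}

/-- The projection is self-adjoint and fixes `w`; hence `τ` can be dropped in every pairing with a
pluriharmonic function. -/
lemma integral_mul_tau {w f : M r → ℝ} (hw : w ∈ pluriharmonic r) (hw2 : MemLp w 2 (vol r θ))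
    (hf : MemLp f 2 (vol r θ)) :
    ∫ m, w m * tau r θ f m ∂(vol r θ) = ∫ m, w m * f m ∂(vol r θ) := by
  have h1 : hw2.toLp w ∈ pluriharmonicL2 r θ :=
    Submodule.le_topologicalClosure _ (Submodule.subset_span ⟨w, hw, hw2.coeFn_toLp⟩)
  have h2 : tau r θ f = (pluriharmonicL2 r θ).starProjection (hf.toLp f) := by
    simp [tau, hf]
  have h3 : inner ℝ (hw2.toLp w) (tau r θ f) = inner ℝ (hw2.toLp w) (hf.toLp f) := by
    rw [h2, ← Submodule.inner_starProjection_left_eq_right,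
      Submodule.starProjection_eq_self_iff.2 h1]
  rw [L2.inner_def, L2.inner_def] at h3
  calc ∫ m, w m * tau r θ f m ∂(vol r θ)
      = ∫ m, inner ℝ (hw2.toLp w m) (tau r θ f m) ∂(vol r θ) := by
        refine integral_congr_ae ?_
        filter_upwards [hw2.coeFn_toLp] with m hm
        rw [hm, Real.inner_apply]
    _ = _ := h3
    _ = ∫ m, w m * f m ∂(vol r θ) := by
        refine integral_congr_ae ?_
        filter_upwards [hw2.coeFn_toLp, hf.coeFn_toLp] with m hm hm'
        rw [hm, hm', Real.inner_apply]

lemma tau_eq_zero {f : M r → ℝ} (hf : MemLp f 2 (vol r θ))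
    (h : ∀ w ∈ pluriharmonic r, ∫ m, w m * f m ∂(vol r θ) = 0) : tau r θ f = 0 := by
  have h2 : tau r θ f = (pluriharmonicL2 r θ).starProjection (hf.toLp f) := by
    simp [tau, hf]
  rw [h2, Submodule.starProjection_apply_eq_zero_iff, Submodule.orthogonal_closure,
    Submodule.mem_orthogonal]
  intro F hF
  induction hF using Submodule.span_induction with
  | mem F hF =>
    obtain ⟨w, hw, hFw⟩ := hF
    rw [L2.inner_def, ← h w hw]
    refine integral_congr_ae ?_
    filter_upwards [hFw, hf.coeFn_toLp] with m hm hm'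
    rw [hm, hm', Real.inner_apply]
  | zero => simp
  | add F G _ _ hF hG => rw [inner_add_left, hF, hG, add_zero]
  | smul c F _ hF => rw [inner_smul_left, hF, mul_zero]

end Tau

/-! ### The `II`-functional -/

lemma lapS_const (c : ℂ) : lapS (algebraMap ℂ SF c) = 0 := by
  simp only [lapS, Derivation.map_algebraMap, map_zero, add_zero]

lemma isHom_const {r : ℝ} (hr : r ≠ 0) (c : ℂ) : IsHom r 0 (algebraMap ℂ SF c) := fun p hp => by
  rw [SF.ext_of_ne _ hp, SF.ext_of_ne _ (dil_ne_zero hr hp), Algebra.algebraMap_eq_smul_one]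
  simp

section Smooth

variable {r : ℝ}

lemma exists_isSmooth {v : SF} (hv : IsHom r 0 v) :
    ∃ (w : M r → ℝ), IsSmooth w ∧ ∀ p : Punctured, lift w p = (v.val p).re := by
  have h1 : ∀ p, p ≠ 0 → lift (descend (fun p => (v.ext p).re) : M r → ℝ) p = (v.ext p).re :=
    fun p hp => lift_descend (fun p hp => by rw [hv p hp]; simp) hp
  refine ⟨descend fun p => (v.ext p).re, ?_, fun p => by rw [h1 p p.2, v.ext_coe]⟩
  exact (Complex.reCLM.contDiff.comp_contDiffOn v.contDiffOn_ext).congr h1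

lemma exists_pluriharmonic {v : SF} (hv : IsHom r 0 v) (hpv : IsPH v) :
    ∃ (w : M r → ℝ) (h : IsSmooth w), w ∈ pluriharmonic r ∧ h.toSF = v := by
  obtain ⟨w, hw, hwv⟩ := exists_isSmooth hv
  have h1 : hw.toSF = v := SF.eq_of_forall fun p => by
    rw [hw.toSF_val, hwv p]
    have h2 := congrArg (fun f => f.val p) hpv.1
    simp only [conj_apply] at h2
    exact Complex.conj_eq_iff_re.1 h2
  exact ⟨w, hw, mem_pluriharmonic_iff.2 ⟨hw, h1 ▸ hpv⟩, h1⟩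

lemma IsSmooth.toSF_ext {w : M r → ℝ} (h : IsSmooth w) {p : Heis} (hp : p ≠ 0) :
    h.toSF.ext p = (lift w p : ℂ) := by
  rw [SF.ext_of_ne _ hp, h.toSF_val]

lemma one_mem_pluriharmonic (hr : r ≠ 0) : (fun _ => 1 : M r → ℝ) ∈ pluriharmonic r := by
  obtain ⟨w, h, hw, hv⟩ := exists_pluriharmonic (isHom_const hr ((1 : ℝ) : ℂ)) (isPH_const 1)
  suffices h1 : (fun _ => 1 : M r → ℝ) = w from h1 ▸ hw
  funext m
  induction m using Quot.ind with
  | mk p =>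
    have h1 := h.toSF_val p
    rw [hv, Algebra.algebraMap_eq_smul_one, SF.val_smul, SF.val_one, mul_one] at h1
    rw [← lift_of_ne w p.2, ← Complex.ofReal_injective h1]

end Smooth

/-! ### Pairing functions on the quotient with homogeneous densities of degree `-4`. -/

section Density

variable {r : ℝ} (hr : 0 < r) {θ : Heis → Heis →L[ℝ] ℝ} {σ : Heis → ℝ} (h : IsExpForm θ σ)
  {f : Heis → ℝ} {D : SF} (hfD : ∀ p : Punctured, ((f p * Real.exp (2 * σ p) : ℝ) : ℂ) = D.val p)
include hr h hfD

/-- Both `D` and `e^{2σ}` have degree `-4`, so their quotient `f` is invariant and the choice of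
representatives in `descend` is immaterial. -/
lemma IsExpForm.lift_descend_density (hu : IsHom r 0 (h.s - sS)) (hD : IsHom r (-4) D) {p : Heis}
    (hp : p ≠ 0) : lift (descend f : M r → ℝ) p = f p := by
  refine lift_descend (fun p hp => ?_) hp
  have hd := dil_ne_zero hr.ne' hp
  have h1 := (isHom_zero_iff hr h).1 hu p hp
  have h2 := hD p hp
  rw [SF.ext_of_ne _ hp, SF.ext_of_ne _ hd, ← hfD ⟨p, hp⟩, ← hfD ⟨_, hd⟩, zpow_neg] at h2
  norm_cast at h2
  rw [two_mul, two_mul, Real.exp_add, Real.exp_add, ← h1] at h2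
  have h3 := Real.exp_pos (σ (dil r p))
  field_simp at h2
  exact h2

omit hr in
lemma IsExpForm.continuousOn_density : ContinuousOn f {0}ᶜ := by
  have h1 : ContinuousOn (fun p => (D.ext p).re * (Real.exp (2 * σ p))⁻¹) {0}ᶜ :=
    (Complex.continuous_re.comp_continuousOn D.contDiffOn_ext.continuousOn).mul
      ((contDiffOn_const.mul h.smooth).exp.continuousOn.inv₀ fun p _ => (Real.exp_pos _).ne')
  refine h1.congr fun p hp => ?_
  change f p = (D.ext p).re * (Real.exp (2 * σ p))⁻¹
  rw [D.ext_of_ne hp, ← hfD ⟨p, hp⟩, Complex.ofReal_re, mul_inv_cancel_right₀ (Real.exp_pos _).ne']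

variable (hu : IsHom r 0 (h.s - sS)) (hD : IsHom r (-4) D)
include hu hD

lemma IsExpForm.memLp_density (hr1 : r ≠ 1) : MemLp (descend f : M r → ℝ) 2 (vol r θ) :=
  h.memLp hr hr1 ((h.continuousOn_density hfD).congr fun _ hp =>
    h.lift_descend_density hr hfD hu hD hp)

lemma IsExpForm.integral_mul_density {w : M r → ℝ} (hw : IsSmooth w) :
    ((∫ m, w m * (descend f : M r → ℝ) m ∂(vol r θ) : ℝ) : ℂ) = intF r (hw.toSF * D) := by
  have h1 : ∀ p : Heis, p ≠ 0 → lift (fun m => w m * (descend f : M r → ℝ) m) p = lift w p * f p :=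
    fun p hp => by
      rw [lift_of_ne _ hp, ← lift_of_ne w hp, ← lift_of_ne (descend f) hp,
        h.lift_descend_density hr hfD hu hD hp]
  rw [h.integral_vol hr, intF, ← integral_complex_ofReal]
  · refine setIntegral_congr_fun measurableSet_fundDomain fun p hp => ?_
    have hp := fundDomain_ne_zero hr hp
    simp only [SF.ext_mul, hw.toSF_ext hp, h1 p hp]
    rw [D.ext_of_ne hp, ← hfD ⟨p, hp⟩]
    push_cast; ring
  · exact measurable_of_continuousOn_lift ((hw.continuousOn.mul
      (h.continuousOn_density hfD)).congr h1)

end Density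

section Functional

variable {r : ℝ} (hr : 0 < r) (hr1 : r ≠ 1) {θ : Heis → Heis →L[ℝ] ℝ} {σ : Heis → ℝ}
  (h : IsExpForm θ σ) (hpe : IsPseudoEinstein θ) (hu : IsHom r 0 (h.s - sS))
include hr hr1 hpe hu

omit hr hr1 hu in
lemma IsExpForm.exp_mul_Pprime_lift {w : M r → ℝ} (hw : IsSmooth w) (hpw : IsPH hw.toSF)
    (p : Punctured) : ((Pprime θ (lift w) p * Real.exp (2 * σ p) : ℝ) : ℂ)
      = (densP (h.s - sS) hw.toSF).val p := by
  rw [h.exp_mul_Pprime hpe (rep_ofReal _ hw) hpw, densP, add_sub_cancel]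
  rfl

omit hr hr1 hu in
lemma IsExpForm.exp_mul_Qprime_eq (p : Punctured) :
    ((Qprime θ p * Real.exp (2 * σ p) : ℝ) : ℂ) = (densQ (h.s - sS)).val p := by
  rw [h.exp_mul_Qprime hpe, densQ, add_sub_cancel]

omit hr hr1 hu in
lemma IsExpForm.isPH_sub : IsPH (h.s - sS) := (h.isPseudoEinstein_iff.1 hpe).sub isPH_sS

lemma IsExpForm.integral_mul_Qbar {w : M r → ℝ} (hw : IsSmooth w) (hpw : IsPH hw.toSF) :
    ((∫ m, w m * Qbar r θ m ∂(vol r θ) : ℝ) : ℂ)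
      = 4 * intF r (lapS hw.toSF * lapS (h.s - sS)) := by
  have hD := isHom_densQ hr hu (h.isPH_sub hpe)
  have hfD := h.exp_mul_Qprime_eq hpe
  rw [Qbar, integral_mul_tau (mem_pluriharmonic_iff.2 ⟨hw, hpw⟩) (h.memLp hr hr1 hw.continuousOn)
    (h.memLp_density hr hfD hu hD hr1), h.integral_mul_density hr hfD hu hD hw,
    intF_mul_densQ hr hr1 hu (h.isPH_sub hpe) (hw.isHom hr.ne') hpw]

lemma IsExpForm.integral_mul_Pbar {w : M r → ℝ} (hw : IsSmooth w) (hpw : IsPH hw.toSF) :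
    ((∫ m, w m * Pbar r θ w m ∂(vol r θ) : ℝ) : ℂ)
      = 4 * intF r (lapS hw.toSF * lapS hw.toSF) := by
  have hD := isHom_densP hr hu (hw.isHom hr.ne') hpw
  have hfD := h.exp_mul_Pprime_lift hpe hw hpw
  rw [Pbar, integral_mul_tau (mem_pluriharmonic_iff.2 ⟨hw, hpw⟩) (h.memLp hr hr1 hw.continuousOn)
    (h.memLp_density hr hfD hu hD hr1), h.integral_mul_density hr hfD hu hD hw,
    intF_mul_densP hr hr1 hu (hw.isHom hr.ne') hpw (hw.isHom hr.ne') hpw]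

/-- Constants are pluriharmonic and `Δ1 = 0`, so pairing with `1` gives zero. This removes the
logarithmic term from `II`. -/
lemma IsExpForm.integral_Qbar : ∫ m, Qbar r θ m ∂(vol r θ) = 0 := by
  obtain ⟨hs, hp⟩ := mem_pluriharmonic_iff.1 (one_mem_pluriharmonic (r := r) hr.ne')
  have h1 := h.integral_mul_Qbar hr hr1 hpe hu hs hp
  have h2 : hs.toSF = algebraMap ℂ SF 1 := SF.eq_of_forall fun p => by
    rw [hs.toSF_val, lift_of_ne _ p.2, map_one]; simp
  rw [h2, lapS_const, zero_mul, intF_zero, mul_zero] at h1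
  simpa using h1

lemma IsExpForm.Qbar_eq_zero (hl : lapS (h.s - sS) = 0) : Qbar r θ = 0 := by
  have hD := isHom_densQ hr hu (h.isPH_sub hpe)
  have hfD := h.exp_mul_Qprime_eq hpe
  refine tau_eq_zero (h.memLp_density hr hfD hu hD hr1) fun w hw => ?_
  obtain ⟨hs, hp⟩ := mem_pluriharmonic_iff.1 hw
  have h1 := h.integral_mul_density hr hfD hu hD hs
  rw [intF_mul_densQ hr hr1 hu (h.isPH_sub hpe) (hs.isHom hr.ne') hp, hl, mul_zero,
    intF_zero, mul_zero] at h1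
  exact_mod_cast h1

/-- `II(w) = 4 ∫ (Δ(w + u))² - 4 ∫ (Δu)²` for the contact form `ρ⁻² e^u θ₀`. -/
lemma IsExpForm.II_eq {w : M r → ℝ} (hw : IsSmooth w) (hpw : IsPH hw.toSF) :
    (II r θ w : ℂ) = 4 * intF r (lapS (hw.toSF + (h.s - sS)) * lapS (hw.toSF + (h.s - sS)))
      - 4 * intF r (lapS (h.s - sS) * lapS (h.s - sS)) := by
  have h1 := h.integral_mul_Qbar hr hr1 hpe hu hw hpw
  have h2 := h.integral_mul_Pbar hr hr1 hpe hu hw hpw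
  have h3 : ∫ m, Qbar r θ m * w m ∂(vol r θ) = ∫ m, w m * Qbar r θ m ∂(vol r θ) :=
    integral_congr_ae (Filter.Eventually.of_forall fun m => mul_comm _ _)
  rw [II, h.integral_Qbar hr hr1 hpe hu, zero_mul, sub_zero, h3]
  push_cast
  rw [h1, h2, lapS_add]
  have h4 : ∀ a b : SF, (a + b) * (a + b) = a * a + (a * b + a * b) + b * b := fun a b => by ring
  rw [h4]
  simp only [intF_add hr]
  ring

/-- By `II_eq` the functional is a constant plus a nonnegative energy of `w + u`, where `u = σ + log
ρ²`. The energy vanishes at `w = -u`, so minimizers are the `w` of zero energy, and rigidity makes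
`w + u` constant. -/
lemma IsExpForm.isMinimizer_iff {w : M r → ℝ} :
    IsMinimizer r θ w ↔ ∃ c : ℝ, ∀ p : Heis, p ≠ 0 → lift w p + σ p = -Real.log (rho p ^ 2) + c := by
  have hr' := hr.ne'
  have hpu := h.isPH_sub hpe
  set u := h.s - sS with hu_def
  have hnn : ∀ {v : SF}, IsHom r 0 v → IsPH v →
      ∃ e : ℝ, 0 ≤ e ∧ intF r (lapS v * lapS v) = (e : ℂ) := fun hv hpv =>
    ⟨_, mul_nonneg two_pos.le (integral_nonneg fun p => Complex.normSq_nonneg _),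
      intF_lapS_sq_eq hr hr1 hv hpv⟩
  have hII : ∀ {w : M r → ℝ} (hw : IsSmooth w), IsPH hw.toSF →
      (II r θ w : ℂ) = 4 * intF r (lapS (hw.toSF + u) * lapS (hw.toSF + u))
        - 4 * intF r (lapS u * lapS u) := fun hw hpw => h.II_eq hr hr1 hpe hu hw hpw
  have hval : ∀ {w : M r → ℝ} (hw : IsSmooth w) (p : Punctured), (hw.toSF + u).val p
      = ((lift w p + σ p + Real.log (rho p ^ 2) : ℝ) : ℂ) := fun hw p => by
    have : h.s.val p = (σ p : ℂ) := rfl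
    rw [SF.val_add, hw.toSF_val, hu_def, SF.val_sub, sS_val, this]
    push_cast; ring
  obtain ⟨e₀, he₀, hee₀⟩ := hnn hu hpu
  constructor
  · rintro ⟨hw, hmin⟩
    obtain ⟨hs, hp⟩ := mem_pluriharmonic_iff.1 hw
    -- The competitor `-u` is admissible because `u` is invariant and pluriharmonic; it attains the
    -- lower bound.
    obtain ⟨v, hvs, hv, hvu⟩ := exists_pluriharmonic hu.neg hpu.neg
    have h1 := hII hvs (hvu ▸ hpu.neg)
    rw [hvu, neg_add_cancel, show lapS 0 = 0 by simp only [lapS, map_zero, add_zero],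
      zero_mul, intF_zero, mul_zero, zero_sub, hee₀] at h1
    have h2 := hII hs hp
    have hvhom := (hs.isHom hr').add hu
    have hvph := hp.add hpu
    obtain ⟨e, he, hee⟩ := hnn hvhom hvph
    rw [hee, hee₀] at h2
    have h3 := hmin v hv
    norm_cast at h1 h2
    rw [h1, h2] at h3
    have he0 : e = 0 := by linarith
    rw [he0, Complex.ofReal_zero] at hee
    refine ⟨((hs.toSF + u).ext (0, 1)).re, fun p hp0 => ?_⟩
    have h4 := const_of_intF_lapS_sq hr hr1 hvhom hvph hee hp0
    rw [← h4, SF.ext_of_ne _ hp0, hval hs ⟨p, hp0⟩, Complex.ofReal_re]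
    ring
  · rintro ⟨c, hc⟩
    have hs : IsSmooth w := by
      refine ((contDiffOn_log_rho_sq.add (contDiffOn_const (c := c))).sub h.smooth).congr
        fun p hp => ?_
      have := hc p hp
      change _ = -Real.log (rho p ^ 2) + c - σ p
      linarith
    have h1 : hs.toSF + u = algebraMap ℂ SF c := SF.eq_of_forall fun p => by
      rw [hval hs p, Algebra.algebraMap_eq_smul_one, SF.val_smul, SF.val_one, mul_one, hc p p.2]
      congr 1; ring
    have hp : IsPH hs.toSF := by
      rw [← add_sub_cancel_right hs.toSF u, h1]
      exact (isPH_const c).sub hpu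
    refine ⟨mem_pluriharmonic_iff.2 ⟨hs, hp⟩, fun v hv => ?_⟩
    obtain ⟨hvs, hvp⟩ := mem_pluriharmonic_iff.1 hv
    have h2 := hII hs hp
    have h3 := hII hvs hvp
    obtain ⟨e, he, hee⟩ := hnn ((hvs.isHom hr').add hu) (hvp.add hpu)
    rw [h1, lapS_const, zero_mul, intF_zero, mul_zero, zero_sub, hee₀] at h2
    rw [hee, hee₀] at h3
    norm_cast at h2 h3
    rw [h2, h3]
    linarith

end Functional

/-! ### The topology of the quotient -/

lemma mk_dil_zpow {r : ℝ} (hr : r ≠ 0) (n : ℤ) (p : Punctured) :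
    (Quot.mk _ ⟨dil (r ^ n) p, dil_ne_zero (zpow_ne_zero n hr) p.2⟩ : M r) = Quot.mk _ p := by
  classical
  -- The iteration lemma needs a function on all of `Heis`; the class map is extended to the origin
  -- by `none`.
  have h := dil_zpow_invariant (g := fun q : Heis => if h : q ≠ 0 then
    some (Quot.mk _ ⟨q, h⟩ : M r) else none) hr (fun q hq => by
      rw [dif_pos hq, dif_pos (dil_ne_zero hr hq)]
      exact congrArg some (mk_dil hr hq)) n p.2
  rw [dif_pos p.2, dif_pos (dil_ne_zero (zpow_ne_zero n hr) p.2)] at h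
  exact Option.some_injective _ h

lemma compactSpace_M {r : ℝ} (hr : 0 < r) (hr1 : r ≠ 1) : CompactSpace (M r) := by
  refine ⟨?_⟩
  have h1 : IsCompact {p : Punctured | min 1 r ≤ rho p ∧ rho p ≤ max 1 r} := by
    rw [Subtype.isCompact_iff]
    convert isCompact_closedAnnulus (min 1 r) (max 1 r) using 1
    ext p
    constructor
    · rintro ⟨q, hq, rfl⟩; exact hq
    · exact fun hp => ⟨⟨p, annulus_subset (lt_min one_pos hr) _ hp⟩, hp, rfl⟩
  convert h1.image (continuous_quot_mk (r := fun p q : Punctured => q.1 = dil r p.1)) using 1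
  refine (Set.eq_univ_of_forall fun m => ?_).symm
  induction m using Quot.ind with
  | mk p =>
    obtain ⟨n, hn⟩ := exists_zpow_dil_mem hr hr1 p.2
    exact ⟨⟨dil (r ^ n) p, dil_ne_zero (zpow_ne_zero n hr.ne') p.2⟩, ⟨hn.1, hn.2.le⟩,
      mk_dil_zpow hr.ne' n p⟩

/-- The projection `(z, t) ↦ (|z| z, t) / ρ²` to the unit sphere. -/
def sphereVec (p : Heis) : EuclideanSpace ℝ (Fin 3) :=
  !₂[‖p.1‖ * p.1.re / rho p ^ 2, ‖p.1‖ * p.1.im / rho p ^ 2, p.2 / rho p ^ 2]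

lemma norm_sphereVec {p : Heis} (hp : p ≠ 0) : ‖sphereVec p‖ = 1 := by
  have h := pow_pos (rho_pos hp) 2
  have h2 : ‖p.1‖ ^ 2 = p.1.re ^ 2 + p.1.im ^ 2 := by
    rw [← Complex.normSq_eq_norm_sq, Complex.normSq_apply]; ring
  rw [EuclideanSpace.norm_eq, Real.sqrt_eq_one, Fin.sum_univ_three]
  simp only [sphereVec, Real.norm_eq_abs, sq_abs, PiLp.toLp_apply, Matrix.cons_val_zero,
    Matrix.cons_val_one, Matrix.cons_val]
  have h3 := rho_pow_four p
  field_simp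
  rw [div_eq_one_iff_eq (pow_pos (rho_pos hp) 4).ne']
  linear_combination (-‖p.1‖ ^ 2) * h2 - h3

lemma sphereVec_dil {c : ℝ} (hc : 0 < c) (p : Heis) : sphereVec (dil c p) = sphereVec p := by
  simp only [sphereVec, rho_dil hc]
  simp only [dil, norm_smul, Real.norm_of_nonneg hc.le, Complex.smul_re, Complex.smul_im,
    smul_eq_mul]
  congr 1
  have hc' := hc.ne'
  have e : ∀ a b : ℝ, c ^ 2 * a / (c ^ 2 * b) = a / b := fun a b =>
    mul_div_mul_left _ _ (pow_ne_zero 2 hc')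
  rw [mul_pow, e, ← e (‖p.1‖ * p.1.re), ← e (‖p.1‖ * p.1.im)]
  ring_nf

/-- The map `ℍ¹ \ {0} → S¹ × S²`. -/
def toTorus (r : ℝ) (p : Punctured) : Circle × Metric.sphere (0 : EuclideanSpace ℝ (Fin 3)) 1 :=
  (Circle.exp (2 * Real.pi * (Real.log (rho p) / Real.log r)),
    ⟨sphereVec p, mem_sphere_zero_iff_norm.2 (norm_sphereVec p.2)⟩)

lemma continuous_toTorus (r : ℝ) : Continuous (toTorus r) := by
  have h1 : Continuous fun p : Punctured => rho p := continuous_rho.comp continuous_subtype_val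
  have h0 : ∀ p : Punctured, rho p ^ 2 ≠ 0 := fun p => (pow_pos (rho_pos p.2) 2).ne'
  refine Continuous.prodMk ?_ (Continuous.subtype_mk ?_ _)
  · exact Circle.exp.continuous.comp (continuous_const.mul
      ((h1.log fun p => (rho_pos p.2).ne').div_const _))
  · refine (PiLp.continuous_toLp 2 _).comp (continuous_pi fun i => ?_)
    have hz : Continuous fun p : Punctured => p.1.1 := continuous_fst.comp continuous_subtype_val
    have ht : Continuous fun p : Punctured => p.1.2 := continuous_snd.comp continuous_subtype_val
    have h2 := h1.pow 2
    fin_cases i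
    · exact (hz.norm.mul (Complex.continuous_re.comp hz)).div h2 h0
    · exact (hz.norm.mul (Complex.continuous_im.comp hz)).div h2 h0
    · exact ht.div h2 h0

lemma eq_of_sphereVec_eq {p q : Heis} (hp : p ≠ 0) (hρ : rho p = rho q)
    (h : sphereVec p = sphereVec q) : p = q := by
  have h0 : rho q ^ 2 ≠ 0 := by rw [← hρ]; exact (pow_pos (rho_pos hp) 2).ne'
  have e0 := congrArg (fun v => v 0) h
  have e1 := congrArg (fun v => v 1) h
  have e2 := congrArg (fun v => v 2) h
  simp only [sphereVec, PiLp.toLp_apply, Matrix.cons_val_zero,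
    Matrix.cons_val_one, Matrix.cons_val, hρ, div_left_inj' h0] at e0 e1 e2
  have hz : ‖p.1‖ • p.1 = ‖q.1‖ • q.1 := by
    apply Complex.ext <;> simp [e0, e1]
  have hn : ‖p.1‖ = ‖q.1‖ := by
    have h1 := congrArg norm hz
    rw [norm_smul, norm_smul, norm_norm, norm_norm] at h1
    exact (mul_self_inj (norm_nonneg _) (norm_nonneg _)).1 h1
  refine Prod.ext ?_ e2
  by_cases hp0 : ‖p.1‖ = 0
  · rw [norm_eq_zero.1 hp0, norm_eq_zero.1 (hn.symm.trans hp0)]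
  · rw [← hn] at hz
    exact smul_right_injective ℂ hp0 hz

/-- The circle coordinate is `log ρ / log r` modulo one and the sphere coordinate is the
dilation-invariant `sphereVec`. The induced map is a continuous bijection from a compact space to a
Hausdorff space. -/
theorem nonempty_homeomorph {r : ℝ} (hr : 0 < r) (hr1 : r ≠ 1) :
    Nonempty (M r ≃ₜ Circle × Metric.sphere (0 : EuclideanSpace ℝ (Fin 3)) 1) := by
  have := compactSpace_M hr hr1
  have hlog : Real.log r ≠ 0 := Real.log_ne_zero_of_pos_of_ne_one hr hr1
  have hinv : ∀ p q : Punctured, q.1 = dil r p.1 → toTorus r p = toTorus r q := fun p q hpq => by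
    refine Prod.ext ?_ (Subtype.ext ?_)
    · simp only [toTorus, hpq, rho_dil hr, Real.log_mul hr.ne' (rho_pos p.2).ne', add_div,
        div_self hlog, mul_add, mul_one]
      rw [add_comm, Circle.periodic_exp]
    · simp only [toTorus, hpq, sphereVec_dil hr]
  let F : M r → Circle × Metric.sphere (0 : EuclideanSpace ℝ (Fin 3)) 1 := Quot.lift (toTorus r) hinv
  have hF : Continuous F := continuous_quot_lift hinv (continuous_toTorus r)
  have hinj : Function.Injective F := by
    intro a b hab
    induction a using Quot.ind with
    | mk p =>
    induction b using Quot.ind with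
    | mk q =>
    have h1 : Circle.exp _ = Circle.exp _ := congrArg Prod.fst hab
    have h2 : sphereVec p = sphereVec q := congrArg (fun x => (Prod.snd x).1) hab
    obtain ⟨n, hn⟩ := Circle.exp_eq_exp.1 h1
    have h3 : Real.log (rho p) = Real.log (r ^ n * rho q) := by
      rw [Real.log_mul (zpow_pos hr n).ne' (rho_pos q.2).ne', Real.log_zpow]
      have := Real.pi_pos.ne'
      field_simp at hn
      linarith
    have h4 := Real.log_injOn_pos (rho_pos p.2) (mul_pos (zpow_pos hr n) (rho_pos q.2)) h3
    rw [← rho_dil (zpow_pos hr n)] at h4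
    rw [← sphereVec_dil (zpow_pos hr n) q.1] at h2
    rw [← mk_dil_zpow hr.ne' n q]
    congr 1
    exact Subtype.ext (eq_of_sphereVec_eq p.2 h4 h2)
  have hsurj : Function.Surjective F := by
    rintro ⟨η, ⟨v, hv⟩⟩
    rw [mem_sphere_zero_iff_norm, EuclideanSpace.norm_eq, Real.sqrt_eq_one,
      Fin.sum_univ_three] at hv
    simp only [Real.norm_eq_abs, sq_abs] at hv
    set ζ : ℂ := ⟨v 0, v 1⟩ with hζ
    obtain ⟨s, hs, hs2⟩ : ∃ s : ℝ, 0 ≤ s ∧ s * s = ‖ζ‖ :=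
      ⟨Real.sqrt ‖ζ‖, Real.sqrt_nonneg _, Real.mul_self_sqrt (norm_nonneg _)⟩
    -- This inverts `z ↦ |z| z`, with `s = √|ζ|`; at `ζ = 0` the convention `0⁻¹ = 0` gives the
    -- correct value.
    set z : ℂ := s⁻¹ • ζ with hz
    have hnz : ‖z‖ = s := by
      rw [hz, norm_smul, norm_inv, Real.norm_of_nonneg hs, ← hs2]
      by_cases h0 : s = 0
      · rw [h0]; simp
      · rw [← mul_assoc, inv_mul_cancel₀ h0, one_mul]
    have hzz : ‖z‖ • z = ζ := by
      rw [hnz, hz]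
      by_cases h0 : s = 0
      · rw [h0, mul_zero] at hs2
        rw [norm_eq_zero.1 hs2.symm, smul_zero, smul_zero]
      · rw [smul_smul, mul_inv_cancel₀ h0, one_smul]
    set p₀ : Heis := (z, v 2) with hp₀
    have hρ : rho p₀ = 1 := by
      have h1 : rho p₀ ^ 4 = 1 ^ 4 := by
        have h2 : ‖z‖ ^ 4 = v 0 ^ 2 + v 1 ^ 2 := by
          rw [hnz, show s ^ 4 = (s * s) ^ 2 by ring, hs2, ← Complex.normSq_eq_norm_sq,
            Complex.normSq_apply]
          simp [hζ]; ring
        rw [rho_pow_four, h2, one_pow, hv]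
      exact (pow_left_inj₀ (rho_nonneg _) zero_le_one (by norm_num)).1 h1
    have hp₀0 : p₀ ≠ 0 := fun h => by rw [h, rho_zero] at hρ; exact zero_ne_one hρ
    -- Starting from the point of gauge one, dilating by `c` makes the circle coordinate equal to
    -- `η` and leaves the sphere coordinate unchanged.
    set c : ℝ := Real.exp (Complex.arg η / (2 * Real.pi) * Real.log r) with hc
    have hcpos : 0 < c := Real.exp_pos _
    refine ⟨Quot.mk _ ⟨dil c p₀, dil_ne_zero hcpos.ne' hp₀0⟩, ?_⟩
    refine Prod.ext ?_ (Subtype.ext ?_)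
    · change Circle.exp (2 * Real.pi * (Real.log (rho (dil c p₀)) / Real.log r)) = η
      rw [rho_dil hcpos, hρ, mul_one, hc, Real.log_exp, mul_div_cancel_right₀ _ hlog,
        mul_div_cancel₀ _ (by positivity), Circle.exp_arg]
    · change sphereVec (dil c p₀) = v
      rw [sphereVec_dil hcpos]
      have hre := congrArg Complex.re hzz
      have him := congrArg Complex.im hzz
      simp only [Complex.smul_re, Complex.smul_im, smul_eq_mul] at hre him
      ext i
      fin_cases i
      · simpa [sphereVec, hρ] using hre
      · simpa [sphereVec, hρ] using him
      · change v 2 / rho p₀ ^ 2 = v 2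
        rw [hρ, one_pow, div_one]
  exact ⟨hF.homeoOfEquivCompactToT2 (f := Equiv.ofBijective F ⟨hinj, hsurj⟩)⟩

/-! ### Constant multiples of `ρ⁻² θ₀` -/

lemma four_mul_pS_sq_add (p : Punctured) : (4 * (pS ^ 2 + conj pS ^ 2)).val p
    = ((8 * (‖p.1.1‖ ^ 4 - p.1.2 ^ 2) / rho p ^ 8 : ℝ) : ℂ) := by
  have e4 : (4 : SF).val p = 4 := rfl
  have hq := qS_ne_zero p
  have hq' : star (qS.val p) ≠ 0 := star_ne_zero.2 hq
  have h1 : qS.val p * star (qS.val p) = ((rho p ^ 4 : ℝ) : ℂ) := by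
    rw [Complex.star_def, Complex.mul_conj, Complex.normSq_eq_norm_sq, norm_qS]
    push_cast; ring
  have h2 : qS.val p ^ 2 + star (qS.val p) ^ 2
      = ((2 * (‖p.1.1‖ ^ 4 - p.1.2 ^ 2) : ℝ) : ℂ) := by
    rw [show ‖p.1.1‖ ^ 4 = (Complex.normSq p.1.1) ^ 2 by rw [Complex.normSq_eq_norm_sq]; ring,
      ← qS_re p, show p.1.2 = -(qS.val p).im by rw [qS_im, neg_neg]]
    apply Complex.ext <;> simp [pow_two] <;> ring
  rw [SF.val_mul, SF.val_add, SF.val_pow, SF.val_pow, conj_apply, pS_val, e4, star_inv₀]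
  have h3 : (qS.val p)⁻¹ ^ 2 + (star (qS.val p))⁻¹ ^ 2
      = (qS.val p ^ 2 + star (qS.val p) ^ 2) / (qS.val p * star (qS.val p)) ^ 2 := by
    field_simp
    ring
  rw [h3, h1, h2]
  push_cast
  ring

namespace IsExpForm

variable {θ : Heis → Heis →L[ℝ] ℝ} {σ : Heis → ℝ} (h : IsExpForm θ σ) {c : ℝ}
  (hc : h.s - sS = algebraMap ℂ SF c)
include hc

lemma isPseudoEinstein_of_sub_eq_const : IsPseudoEinstein θ := by
  rw [h.isPseudoEinstein_iff, ← sub_add_cancel h.s sS, hc]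
  exact (isPH_const c).add isPH_sS

lemma Qprime_mul_exp_of_sub_eq_const {p : Heis} (hp : p ≠ 0) :
    Qprime θ p * Real.exp (2 * σ p) = 8 * (‖p.1‖ ^ 4 - p.2 ^ 2) / rho p ^ 8 := by
  have h1 := h.exp_mul_Qprime_eq (h.isPseudoEinstein_of_sub_eq_const hc) ⟨p, hp⟩
  rw [hc, densQ_const, four_mul_pS_sq_add] at h1
  exact Complex.ofReal_injective h1

lemma exists_Qprime_ne_zero : ∃ p : Heis, p ≠ 0 ∧ Qprime θ p ≠ 0 := by
  have h10 : ((1, 0) : Heis) ≠ 0 := fun h => one_ne_zero (congrArg Prod.fst h)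
  refine ⟨(1, 0), h10, fun h0 => ?_⟩
  have h1 := h.Qprime_mul_exp_of_sub_eq_const hc h10
  have h2 := rho_pos h10
  rw [h0, zero_mul] at h1
  have h3 : (8 * (‖(1 : ℂ)‖ ^ 4 - 0 ^ 2) / rho (1, 0) ^ 8 : ℝ) ≠ 0 :=
    div_ne_zero (by norm_num) (pow_pos h2 8).ne'
  exact h3 h1.symm

end IsExpForm

lemma isExpForm_theta1_sub : isExpForm_theta1.s - sS = algebraMap ℂ SF (0 : ℝ) := by
  rw [isExpForm_theta1_s, sub_self, Complex.ofReal_zero, map_zero]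

lemma IsExpForm.conformal_eq_smul_theta1_iff {r : ℝ} {θ : Heis → Heis →L[ℝ] ℝ} {σ : Heis → ℝ}
    (h : IsExpForm θ σ) (w : M r → ℝ) :
    (∃ c : ℝ, 0 < c ∧ ∀ p : Heis, p ≠ 0 → HeisCR.conformal w θ p = c • theta1 p) ↔
      ∃ c : ℝ, ∀ p : Heis, p ≠ 0 → lift w p + σ p = -Real.log (rho p ^ 2) + c := by
  have key : ∀ (c : ℝ) (p : Heis), p ≠ 0 → (HeisCR.conformal w θ p = Real.exp c • theta1 p ↔
      lift w p + σ p = -Real.log (rho p ^ 2) + c) := fun c p hp => by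
    rw [HeisCR.conformal, h.eq p hp, theta1, ← exp_neg_log_rho_sq hp, smul_smul, smul_smul,
      ← Real.exp_add, ← Real.exp_add, add_comm c]
    refine ⟨fun H => ?_, fun H => by rw [H]⟩
    have h1 := congrArg (fun L => L (0, 1)) H
    simpa [theta0_apply] using h1
  constructor
  · rintro ⟨c, hc, H⟩
    refine ⟨Real.log c, fun p hp => (key _ p hp).1 ?_⟩
    rw [Real.exp_log hc]
    exact H p hp
  · rintro ⟨c, H⟩
    exact ⟨Real.exp c, Real.exp_pos c, fun p hp => (key c p hp).2 (H p hp)⟩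

/-! ### Existence and uniqueness of minimizers and their contact forms. -/

section Main

variable {r : ℝ} (hr : 0 < r) (hr1 : r ≠ 1) {θ : Heis → Heis →L[ℝ] ℝ} {σ : Heis → ℝ}
  (h : IsExpForm θ σ)
include hr hr1 h

lemma IsExpForm.Qbar_eq_zero_of_sub_eq_const {c : ℝ} (hc : h.s - sS = algebraMap ℂ SF c) :
    Qbar r θ = 0 :=
  h.Qbar_eq_zero hr hr1 (h.isPseudoEinstein_of_sub_eq_const hc)
    (hc ▸ isHom_const hr.ne' _) (hc ▸ lapS_const _)

variable (hpe : IsPseudoEinstein θ) (hu : IsHom r 0 (h.s - sS))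
include hpe hu

lemma IsExpForm.exists_isMinimizer : ∃ w : M r → ℝ, IsMinimizer r θ w := by
  obtain ⟨w, hs, -, hw⟩ := exists_pluriharmonic hu.neg (h.isPH_sub hpe).neg
  refine ⟨w, (h.isMinimizer_iff hr hr1 hpe hu).2 ⟨0, fun p hp => ?_⟩⟩
  have h1 := hs.toSF_val ⟨p, hp⟩
  rw [hw, neg_sub, SF.val_sub, sS_val, show h.s.val ⟨p, hp⟩ = (σ p : ℂ) from rfl] at h1
  norm_cast at h1
  rw [← h1]; ring

lemma IsExpForm.isMinimizer_unique {w v : M r → ℝ} (hw : IsMinimizer r θ w)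
    (hv : IsMinimizer r θ v) : ∃ c : ℝ, ∀ m, v m = w m + c := by
  obtain ⟨a, ha⟩ := (h.isMinimizer_iff hr hr1 hpe hu).1 hw
  obtain ⟨b, hb⟩ := (h.isMinimizer_iff hr hr1 hpe hu).1 hv
  refine ⟨b - a, fun m => ?_⟩
  induction m using Quot.ind with
  | mk p =>
    rw [← lift_of_ne w p.2, ← lift_of_ne v p.2]
    linarith [ha p p.2, hb p p.2]

/-- For a minimizer the exponent of `e^w θ` differs from `-log ρ²` by a constant, so the
computations for constant multiples of `ρ⁻²θ₀` apply. -/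
lemma IsExpForm.conformal_of_isMinimizer {w : M r → ℝ} (hw : IsMinimizer r θ w) :
    IsContactForm r (HeisCR.conformal w θ) ∧ IsPseudoEinstein (HeisCR.conformal w θ) ∧
      Qbar r (HeisCR.conformal w θ) = 0 ∧
      ∃ p : Heis, p ≠ 0 ∧ Qprime (HeisCR.conformal w θ) p ≠ 0 := by
  obtain ⟨hs, -⟩ := mem_pluriharmonic_iff.1 hw.1
  obtain ⟨c, hc⟩ := (h.isMinimizer_iff hr hr1 hpe hu).1 hw
  have h' := h.conformal hs
  have hc' : h'.s - sS = algebraMap ℂ SF c := SF.eq_of_forall fun p => by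
    rw [SF.val_sub, sS_val, show h'.s.val p = ((lift w p + σ p : ℝ) : ℂ) from rfl, hc p p.2,
      Algebra.algebraMap_eq_smul_one, SF.val_smul, SF.val_one]
    push_cast; ring
  exact ⟨h'.isContactForm hr (hc' ▸ isHom_const hr.ne' _), h'.isPseudoEinstein_of_sub_eq_const hc',
    h'.Qbar_eq_zero_of_sub_eq_const hr hr1 hc', h'.exists_Qprime_ne_zero hc'⟩

end Main

end HeisCR

end

theorem theorem5p1 (r : ℝ) (hr0 : 0 < r) (hr1 : r ≠ 1) :
    -- the quotient is `S¹ × S²`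
    Nonempty (HeisCR.M r ≃ₜ Circle × Metric.sphere (0 : EuclideanSpace ℝ (Fin 3)) 1) ∧
    -- `ρ⁻² θ₀` descends to a pseudo-Einstein contact form
    HeisCR.IsContactForm r HeisCR.theta1 ∧
    HeisCR.IsPseudoEinstein HeisCR.theta1 ∧
    -- its projected `Q'`-curvature vanishes, its `Q'`-curvature does not
    HeisCR.Qbar r HeisCR.theta1 = 0 ∧
    (∀ p : HeisCR.Heis, p ≠ 0 →
      HeisCR.Qprime HeisCR.theta1 p
        = 8 * (‖p.1‖ ^ 4 - p.2 ^ 2) / (‖p.1‖ ^ 4 + p.2 ^ 2)) ∧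
    (∃ p : HeisCR.Heis, p ≠ 0 ∧ HeisCR.Qprime HeisCR.theta1 p ≠ 0) ∧
    -- for every pseudo-Einstein background contact form `θ` on the quotient:
    ∀ θ : HeisCR.Heis → HeisCR.Heis →L[ℝ] ℝ,
      HeisCR.IsContactForm r θ → HeisCR.IsPseudoEinstein θ →
      -- a minimizer exists, and it is unique up to an additive constant
      (∃ w, HeisCR.IsMinimizer r θ w) ∧
      (∀ w v, HeisCR.IsMinimizer r θ w → HeisCR.IsMinimizer r θ v →
        ∃ c : ℝ, ∀ m, v m = w m + c) ∧
      -- the minimizers are the `w` for which `e^w θ` is a constant multiple of `ρ⁻² θ₀`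
      (∀ w, HeisCR.IsMinimizer r θ w ↔
        ∃ c : ℝ, 0 < c ∧ ∀ p : HeisCR.Heis, p ≠ 0 →
          HeisCR.conformal w θ p = c • HeisCR.theta1 p) ∧
      -- the contact form of a minimizer has vanishing `Q̄'` but nonvanishing `Q'`
      (∀ w, HeisCR.IsMinimizer r θ w →
        HeisCR.IsContactForm r (HeisCR.conformal w θ) ∧
        HeisCR.IsPseudoEinstein (HeisCR.conformal w θ) ∧
        HeisCR.Qbar r (HeisCR.conformal w θ) = 0 ∧
        ∃ p : HeisCR.Heis, p ≠ 0 ∧ HeisCR.Qprime (HeisCR.conformal w θ) p ≠ 0) := by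
  refine ⟨HeisCR.nonempty_homeomorph hr0 hr1,
    HeisCR.isExpForm_theta1.isContactForm hr0
      (HeisCR.isExpForm_theta1_sub ▸ HeisCR.isHom_const hr0.ne' _),
    HeisCR.isExpForm_theta1.isPseudoEinstein_of_sub_eq_const HeisCR.isExpForm_theta1_sub,
    HeisCR.isExpForm_theta1.Qbar_eq_zero_of_sub_eq_const hr0 hr1 HeisCR.isExpForm_theta1_sub,
    fun p hp => ?_,
    HeisCR.isExpForm_theta1.exists_Qprime_ne_zero HeisCR.isExpForm_theta1_sub,
    fun θ hθ hpe => ?_⟩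
  · have h1 := HeisCR.isExpForm_theta1.Qprime_mul_exp_of_sub_eq_const
      HeisCR.isExpForm_theta1_sub hp
    have h2 := HeisCR.rho_pos hp
    rw [two_mul, Real.exp_add, HeisCR.exp_neg_log_rho_sq hp] at h1
    rw [← HeisCR.rho_pow_four, eq_div_iff (pow_pos h2 4).ne']
    field_simp at h1
    linear_combination h1
  · have h := hθ.isExpForm
    have hu := hθ.isHom hr0
    exact ⟨h.exists_isMinimizer hr0 hr1 hpe hu,
      fun w v hw hv => h.isMinimizer_unique hr0 hr1 hpe hu hw hv,
      fun w => (h.isMinimizer_iff hr0 hr1 hpe hu).trans (h.conformal_eq_smul_theta1_iff w).symm,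
      fun w hw => h.conformal_of_isMinimizer hr0 hr1 hpe hu hw⟩
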